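/- Let $\ell$ be a prime. A Demushkin group is a pro-$\ell$ group $G$ such that $H^1(G,\mathbb{F}_\ell)$ is finite-dimensional, $H^2(G,\mathbb{F}_\ell)\simeq\mathbb{F}_\ell$, $H^3(G,\mathbb{F}_\ell)=0$, and the cup product $H^1(G,\mathbb{F}_\ell)\times H^1(G,\mathbb{F}_\ell)\to H^2(G,\mathbb{F}_\ell)$ is a perfect pairing. Its canonical orientation is the continuous homomorphism $\eth_G\colon G\to\mathbb{Z}_\ell^\times$ through which $G$ acts on its dualizing module $I\simeq\mathbb{Q}_\ell/\mathbb{Z}_\ell$, that is, on the discrete $\ell$-primary torsion $G$-module $I$ representing the functor $A\mapsto \mathrm{Hom}(H^2(G,A),\mathbb{Q}/\mathbb{Z})$ on finite discrete $G$-modules $A$ of $\ell$-power order. For a pro-$\ell$ group $G$ and a continuous homomorphism $\theta\colon G\to\mathbb{Z}_\ell^\times$ (with $\mathrm{im}(\theta)\subseteq 1+4\mathbb{Z}_2$ if $\ell=2$), let $\mathbb{Z}_\ell(1)$ denote $\mathbb{Z}_\ell$ with the action $g\cdot v=\theta(g)v$, and let $K_\theta(G)$ be the closed subgroup of $G$ generated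 by the elements $h^{-\theta(g)}ghg^{-1}$ with $g\in G$ and $h\in\ker(\theta)$. The pair $(G,\theta)$ is Kummerian if the natural map $H^1(G,\mathbb{Z}_\ell(1)/\ell^n)\to H^1(G,\mathbb{Z}_\ell(1)/\ell)$ is surjective for every $n\ge 1$; it has the Bogomolov property if it is Kummerian and $K_\theta(G)$ is a free pro-$\ell$ group. Theorem. Let $G$ be a Demushkin group with canonical orientation $\eth_G\colon G\to\mathbb{Z}_\ell^\times$, and suppose that $\mathrm{im}(\eth_G)\subseteq 1+4\mathbb{Z}_2$ if $\ell=2$. Then $(G,\eth_G)$ has the Bogomolov property, that is, $(G,\eth_G)$ is Kummerian and $K_{\eth_G}(G)$ is a free pro-$\ell$ group. -/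

import Mathlib

open Filter Topology

universe u v w

set_option linter.unusedSectionVars false

/-! ### Continuous cochain cohomology with discrete coefficients -/

namespace ContCoh

section Defs

variable {k : Type v} {G : Type u} {A : Type w} [CommRing k] [Group G] [TopologicalSpace G]
  [AddCommGroup A] [Module k A]

/-- A representation of `G` on `A`, where `A` carries the discrete topology, is continuous if and
only if all stabilizers are open. -/
def IsDiscreteRep (ρ : Representation k G A) : Prop :=
  ∀ a : A, IsOpen {g : G | ρ g a = a}

/-- The differential on inhomogeneous cochains:
`(d f)(g₀, …, gₙ) = g₀ • f(g₁, …, gₙ) + ∑ⱼ (-1) ^ (j + 1) • f(g₀, …, gⱼ gⱼ₊₁, …, gₙ)`,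
where the last summand is `(-1) ^ (n + 1) • f(g₀, …, gₙ₋₁)`. -/
def diff (ρ : Representation k G A) (n : ℕ) :
    ((Fin n → G) → A) →ₗ[k] ((Fin (n + 1) → G) → A) where
  toFun f g := ρ (g 0) (f fun i => g i.succ) +
    ∑ j : Fin (n + 1), (-1 : k) ^ ((j : ℕ) + 1) • f (Fin.contractNth j (· * ·) g)
  map_add' f g := by
    ext x
    simp [Finset.sum_add_distrib, add_add_add_comm]
  map_smul' r f := by
    ext x
    simp [Finset.smul_sum, smul_comm r]

lemma diff_apply (ρ : Representation k G A) (n : ℕ) (f : (Fin n → G) → A) (g : Fin (n + 1) → G) :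
    diff ρ n f g = ρ (g 0) (f fun i => g i.succ) +
      ∑ j : Fin (n + 1), (-1 : k) ^ ((j : ℕ) + 1) • f (Fin.contractNth j (· * ·) g) := rfl

/-- Continuous cochains `Gⁿ → A`. As `A` is discrete, these are the locally constant maps. -/
def cochains (k : Type v) (G : Type u) (A : Type w) [CommRing k] [TopologicalSpace G]
    [AddCommGroup A] [Module k A] (n : ℕ) : Submodule k ((Fin n → G) → A) where
  carrier := {f | IsLocallyConstant f}
  zero_mem' := IsLocallyConstant.const 0
  add_mem' hf hg := hf.add hg
  smul_mem' c _ hf := hf.comp (c • ·)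

/-- Continuous `n`-cocycles. -/
def cocycles (ρ : Representation k G A) (n : ℕ) : Submodule k ((Fin n → G) → A) :=
  cochains k G A n ⊓ LinearMap.ker (diff ρ n)

/-- Continuous `n`-coboundaries. -/
def coboundaries (ρ : Representation k G A) : (n : ℕ) → Submodule k ((Fin n → G) → A)
  | 0 => ⊥
  | n + 1 => (cochains k G A n).map (diff ρ n)

/-- Continuous cohomology `Hⁿ(G, A)` of `G` with coefficients in the discrete `G`-module `A`. -/
abbrev H (ρ : Representation k G A) (n : ℕ) : Type _ :=
  cocycles ρ n ⧸ (coboundaries ρ n).submoduleOf (cocycles ρ n)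

end Defs

section Functoriality

variable {k : Type v} {G : Type u} {A B : Type*} [CommRing k] [Group G] [TopologicalSpace G]
  [AddCommGroup A] [Module k A] [AddCommGroup B] [Module k B]
  {ρ : Representation k G A} {σ : Representation k G B}

/-- The map on (not necessarily continuous) cochains induced by a homomorphism of `G`-modules. -/
def cochainMap (f : Representation.IntertwiningMap ρ σ) (n : ℕ) :
    ((Fin n → G) → A) →ₗ[k] ((Fin n → G) → B) :=
  f.toLinearMap.compLeft (Fin n → G)

lemma diff_cochainMap (f : Representation.IntertwiningMap ρ σ) (n : ℕ) (c : (Fin n → G) → A) :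
    diff σ n (cochainMap f n c) = cochainMap f (n + 1) (diff ρ n c) := by
  ext x
  have h : ∀ (g : G) (a : A), f.toLinearMap (ρ g a) = σ g (f.toLinearMap a) := fun g a =>
    LinearMap.congr_fun (f.isIntertwining' g) a
  simp only [diff_apply, cochainMap, LinearMap.compLeft_apply,
    Function.comp_apply, map_add, map_sum, map_smul, h]

lemma cochainMap_mem_cochains (f : Representation.IntertwiningMap ρ σ) (n : ℕ)
    {c : (Fin n → G) → A} (hc : c ∈ cochains k G A n) :
    cochainMap f n c ∈ cochains k G B n :=
  IsLocallyConstant.comp (f := c) hc f.toLinearMap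

lemma cochainMap_mem_cocycles (f : Representation.IntertwiningMap ρ σ) (n : ℕ)
    {c : (Fin n → G) → A} (hc : c ∈ cocycles ρ n) : cochainMap f n c ∈ cocycles σ n := by
  refine ⟨cochainMap_mem_cochains f n hc.1, ?_⟩
  have h : diff ρ n c = 0 := hc.2
  change diff σ n (cochainMap f n c) = 0
  rw [diff_cochainMap, h, map_zero]

lemma cochainMap_mem_coboundaries (f : Representation.IntertwiningMap ρ σ) (n : ℕ)
    {c : (Fin n → G) → A} (hc : c ∈ coboundaries ρ n) : cochainMap f n c ∈ coboundaries σ n := by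
  cases n with
  | zero =>
    have h : c = 0 := hc
    rw [h, map_zero]
    exact Submodule.zero_mem _
  | succ n =>
    obtain ⟨b, hb, rfl⟩ := hc
    exact ⟨cochainMap f n b, cochainMap_mem_cochains f n hb, diff_cochainMap f n b⟩

/-- The map `Hⁿ(G, A) → Hⁿ(G, B)` induced by a homomorphism `A → B` of `G`-modules. -/
def map (f : Representation.IntertwiningMap ρ σ) (n : ℕ) : H ρ n →ₗ[k] H σ n :=
  Submodule.mapQ _ _
    ((cochainMap f n).restrict fun _ hc => cochainMap_mem_cocycles f n hc)
    fun _ hc => cochainMap_mem_coboundaries f n hc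

end Functoriality

section Cup

variable {k : Type v} {G : Type u} [CommRing k] [Group G] [TopologicalSpace G]

lemma cup_mem_cocycles {χ ψ : (Fin 1 → G) → k}
    (hχ : χ ∈ cocycles (Representation.trivial k G k) 1)
    (hψ : ψ ∈ cocycles (Representation.trivial k G k) 1) :
    (fun g : Fin 2 → G => χ (fun _ => g 0) * ψ (fun _ => g 1)) ∈
      cocycles (Representation.trivial k G k) 2 := by
  have key : ∀ {φ : (Fin 1 → G) → k}, φ ∈ cocycles (Representation.trivial k G k) 1 →
      ∀ a b : G, φ (fun _ => a * b) = φ (fun _ => a) + φ (fun _ => b) := by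
    intro φ hφ a b
    have h := congrFun (show diff (Representation.trivial k G k) 1 φ = 0 from hφ.2) ![a, b]
    rw [diff_apply, Fin.sum_univ_two, Representation.trivial_apply] at h
    have e1 : (fun i : Fin 1 => (![a, b] : Fin 2 → G) i.succ) = fun _ => b := by
      ext i; fin_cases i; rfl
    have e2 : Fin.contractNth (0 : Fin 2) (· * ·) ![a, b] = fun _ => a * b := by
      ext i; fin_cases i; rfl
    have e3 : Fin.contractNth (1 : Fin 2) (· * ·) ![a, b] = fun _ => a := by
      ext i; fin_cases i; rfl
    rw [e1, e2, e3] at h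
    simp at h
    linear_combination -h
  refine ⟨?_, ?_⟩
  · have h1 : IsLocallyConstant fun g : Fin 2 → G => χ (fun _ => g 0) :=
      IsLocallyConstant.comp_continuous (f := fun g : Fin 2 → G => fun _ : Fin 1 => g 0)
        (g := χ) hχ.1 (by fun_prop)
    have h2 : IsLocallyConstant fun g : Fin 2 → G => ψ (fun _ => g 1) :=
      IsLocallyConstant.comp_continuous (f := fun g : Fin 2 → G => fun _ : Fin 1 => g 1)
        (g := ψ) hψ.1 (by fun_prop)
    exact h1.mul h2
  · change diff (Representation.trivial k G k) 2 _ = 0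
    ext g
    rw [diff_apply, Fin.sum_univ_three, Representation.trivial_apply]
    have e1 : Fin.contractNth (0 : Fin 3) (· * ·) g = ![g 0 * g 1, g 2] := by
      ext i; fin_cases i <;> rfl
    have e2 : Fin.contractNth (1 : Fin 3) (· * ·) g = ![g 0, g 1 * g 2] := by
      ext i; fin_cases i <;> rfl
    have e3 : Fin.contractNth (2 : Fin 3) (· * ·) g = ![g 0, g 1] := by
      ext i; fin_cases i <;> rfl
    rw [e1, e2, e3]
    simp [key hχ, key hψ]
    ring

/-- The cup product of `1`-cocycles with trivial coefficients in `k`: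
`(χ ∪ ψ)(g₀, g₁) = χ(g₀) ψ(g₁)`. -/
def cupCocycle : cocycles (Representation.trivial k G k) 1 →ₗ[k]
    cocycles (Representation.trivial k G k) 1 →ₗ[k]
      cocycles (Representation.trivial k G k) 2 :=
  LinearMap.mk₂ k
    (fun χ ψ => ⟨fun g => χ.1 (fun _ => g 0) * ψ.1 (fun _ => g 1), cup_mem_cocycles χ.2 ψ.2⟩)
    (fun _ _ _ => Subtype.ext (funext fun _ => add_mul _ _ _))
    (fun _ _ _ => Subtype.ext (funext fun _ => mul_assoc _ _ _))
    (fun _ _ _ => Subtype.ext (funext fun _ => mul_add _ _ _))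
    (fun _ _ _ => Subtype.ext (funext fun _ => mul_left_comm _ _ _))

lemma coboundary_one_trivial {χ : (Fin 1 → G) → k}
    (hχ : χ ∈ coboundaries (Representation.trivial k G k) 1) : χ = 0 := by
  obtain ⟨b, -, rfl⟩ := hχ
  ext g
  have e : ∀ x y : Fin 0 → G, b x = b y := fun x y => by rw [Subsingleton.elim x y]
  rw [diff_apply, Representation.trivial_apply, Fin.sum_univ_one,
    e _ (Fin.contractNth 0 (· * ·) g)]
  simp

/-- The cup product `H¹(G, k) × H¹(G, k) → H²(G, k)` for trivial coefficients in `k`. -/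
def cup : H (Representation.trivial k G k) 1 →ₗ[k] H (Representation.trivial k G k) 1 →ₗ[k]
    H (Representation.trivial k G k) 2 :=
  Submodule.liftQ _
    (LinearMap.flip <| Submodule.liftQ _
      (LinearMap.flip <| cupCocycle.compr₂ (Submodule.mkQ _))
      fun ψ hψ => by
        have h : ψ = 0 := Subtype.ext (coboundary_one_trivial hψ)
        rw [h]
        exact Submodule.zero_mem _)
    fun χ hχ => by
      have h : χ = 0 := Subtype.ext (coboundary_one_trivial hχ)
      rw [h]
      exact Submodule.zero_mem _

/-- The cup product on classes is represented by `cupCocycle`. -/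
lemma cup_mk (χ ψ : cocycles (Representation.trivial k G k) 1) :
    cup (k := k) (G := G) (Submodule.Quotient.mk χ) (Submodule.Quotient.mk ψ) =
      Submodule.Quotient.mk (cupCocycle χ ψ) := rfl

end Cup

end ContCoh

/-! ### Pro-`ℓ` groups -/

section ProP

/-- A pro-`ℓ` group: a profinite group all of whose open normal subgroups have index a power
of `ℓ`. -/
structure IsProP (ℓ : ℕ) (G : Type u) [Group G] [TopologicalSpace G] : Prop where
  compact : CompactSpace G
  t2 : T2Space G
  totallyDisconnected : TotallyDisconnectedSpace G
  index_eq_pow : ∀ U : OpenNormalSubgroup G, ∃ n : ℕ, U.toSubgroup.index = ℓ ^ n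

/-- A free pro-`ℓ` group: a pro-`ℓ` group with a basis converging to `1`, i.e. with a subset `X`
such that every neighbourhood of `1` contains all but finitely many elements of `X`, and such that
every map from `X` to a pro-`ℓ` group `P` that converges to `1` in the same sense extends uniquely
to a continuous homomorphism to `P`. -/
def IsFreeProP (ℓ : ℕ) (F : Type u) [Group F] [TopologicalSpace F] : Prop :=
  IsProP ℓ F ∧ ∃ X : Set F, Tendsto ((↑) : X → F) cofinite (𝓝 1) ∧
    ∀ (P : Type u) [Group P] [TopologicalSpace P] [IsTopologicalGroup P], IsProP ℓ P →
      ∀ f : X → P, Tendsto f cofinite (𝓝 1) → ∃! φ : F →ₜ* P, ∀ x : X, φ x = f x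

variable {ℓ : ℕ} [Fact ℓ.Prime] {G : Type u} [Group G] [TopologicalSpace G]

/-- The power `h ^ z` of an element of a pro-`ℓ` group with exponent an `ℓ`-adic integer `z`: the
limit of `h ^ zₙ`, where `zₙ` is the natural number with `zₙ ≡ z` modulo `ℓ ^ n`, `zₙ < ℓ ^ n`. -/
noncomputable def padicPow (h : G) (z : ℤ_[ℓ]) : G :=
  limUnder atTop fun n : ℕ => h ^ z.appr n

/-- In a pro-`ℓ` group the limit that defines `h ^ z` exists. -/
theorem tendsto_padicPow [IsTopologicalGroup G] (hG : IsProP ℓ G) (h : G) (z : ℤ_[ℓ]) :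
    Tendsto (fun n : ℕ => h ^ z.appr n) atTop (𝓝 (padicPow h z)) := by
  have := hG.compact
  have := hG.t2
  have := hG.totallyDisconnected
  refine tendsto_nhds_limUnder ?_
  obtain ⟨x, -, hx⟩ := isCompact_univ.exists_clusterPt
    (f := map (fun n : ℕ => h ^ z.appr n) atTop) (by simp)
  refine ⟨x, fun W hW => ?_⟩
  have hW' : (fun y => x * y) ⁻¹' W ∈ 𝓝 (1 : G) :=
    (continuous_const_mul x).continuousAt.preimage_mem_nhds (by simpa using hW)
  obtain ⟨V, hVW, hVo, hV1⟩ := mem_nhds_iff.1 hW'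
  obtain ⟨U, hU⟩ := ProfiniteGrp.exist_openNormalSubgroup_sub_open_nhds_of_one hVo hV1
  obtain ⟨N, hN⟩ := hG.index_eq_pow U
  have hpow : ∀ n, N ≤ n → (h ^ z.appr N)⁻¹ * h ^ z.appr n ∈ U.toSubgroup := by
    intro n hn
    obtain ⟨c, hc⟩ := z.dvd_appr_sub_appr N n hn
    have e : z.appr n = z.appr N + ℓ ^ N * c := by
      have := z.appr_mono hn
      omega
    rw [e, pow_add, inv_mul_cancel_left, pow_mul, ← hN]
    exact U.toSubgroup.pow_mem (U.toSubgroup.pow_index_mem h) c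
  have hxU : {y : G | x⁻¹ * y ∈ U.toSubgroup} ∈ 𝓝 x :=
    (continuous_const_mul x⁻¹).continuousAt.preimage_mem_nhds
      (by simpa using U.toOpenSubgroup.mem_nhds_one)
  obtain ⟨n₀, hn₀, hn₀U⟩ :=
    ((mapClusterPt_iff_frequently.1 hx _ hxU).and_eventually (eventually_ge_atTop N)).exists
  refine mem_map.2 (mem_of_superset (Ici_mem_atTop N) fun n hn => ?_)
  have hmem : x⁻¹ * h ^ z.appr n ∈ U.toSubgroup := by
    have h1 := U.toSubgroup.mul_mem (U.toSubgroup.mul_mem hn₀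
      (U.toSubgroup.inv_mem (hpow n₀ hn₀U))) (hpow n hn)
    convert h1 using 1
    group
  have := hVW (hU hmem)
  simpa using this

end ProP

/-! ### Oriented pro-`ℓ` groups -/

section Oriented

variable {ℓ : ℕ} [Fact ℓ.Prime] {G : Type u} [Group G] [TopologicalSpace G]

/-- For an orientation `θ : G → ℤ_ℓˣ` and a `ℤ_ℓ`-module `M`, the `G`-module `M` with the action
`g • m = θ(g) m`. For `M = ℤ_ℓ / ℓ ^ n` this is `ℤ_ℓ(1) / ℓ ^ n`. -/
noncomputable def twist (θ : G →ₜ* ℤ_[ℓ]ˣ) (M : Type*) [AddCommGroup M] [Module ℤ_[ℓ] M] :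
    Representation ℤ G M where
  toFun g := (Module.toAddMonoidEnd ℤ_[ℓ] M (θ g : ℤ_[ℓ])).toIntLinearMap
  map_one' := by
    ext m
    change ((θ 1 : ℤ_[ℓ]ˣ) : ℤ_[ℓ]) • m = m
    rw [map_one, Units.val_one, one_smul]
  map_mul' g h := by
    ext m
    change ((θ (g * h) : ℤ_[ℓ]ˣ) : ℤ_[ℓ]) • m = (θ g : ℤ_[ℓ]) • (θ h : ℤ_[ℓ]) • m
    rw [map_mul, Units.val_mul, mul_smul]

@[simp]
lemma twist_apply (θ : G →ₜ* ℤ_[ℓ]ˣ) (M : Type*) [AddCommGroup M] [Module ℤ_[ℓ] M] (g : G)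
    (m : M) : twist θ M g m = (θ g : ℤ_[ℓ]) • m := rfl

/-- A `ℤ_ℓ`-linear map is a homomorphism of the twisted `G`-modules. -/
noncomputable def twistMap (θ : G →ₜ* ℤ_[ℓ]ˣ) {M N : Type*} [AddCommGroup M] [Module ℤ_[ℓ] M]
    [AddCommGroup N] [Module ℤ_[ℓ] N] (f : M →ₗ[ℤ_[ℓ]] N) :
    Representation.IntertwiningMap (twist θ M) (twist θ N) where
  toLinearMap := f.toAddMonoidHom.toIntLinearMap
  isIntertwining' g := by
    ext m
    exact f.map_smul (θ g : ℤ_[ℓ]) m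

/-- The ring `ℤ_ℓ / ℓ ^ n`. -/
abbrev ModPow (ℓ : ℕ) [Fact ℓ.Prime] (n : ℕ) : Type :=
  ℤ_[ℓ] ⧸ Ideal.span {(ℓ : ℤ_[ℓ]) ^ n}

/-- The projection `ℤ_ℓ / ℓ ^ n → ℤ_ℓ / ℓ ^ m` for `m ≤ n`. -/
noncomputable def ModPow.proj (ℓ : ℕ) [Fact ℓ.Prime] {m n : ℕ} (h : m ≤ n) :
    ModPow ℓ n →ₗ[ℤ_[ℓ]] ModPow ℓ m :=
  Submodule.factor (Ideal.span_singleton_le_span_singleton.2 (pow_dvd_pow _ h))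

/-- The orientation `θ` is torsion-free: if `ℓ = 2`, its image lies in `1 + 4 ℤ_2`. -/
def IsTorsionFreeOrientation (θ : G →ₜ* ℤ_[ℓ]ˣ) : Prop :=
  ℓ = 2 → ∀ g : G, (4 : ℤ_[ℓ]) ∣ (θ g : ℤ_[ℓ]) - 1

/-- The oriented pro-`ℓ` group `(G, θ)` is Kummerian: `θ` is torsion-free and
`H¹(G, ℤ_ℓ(1) / ℓ ^ n) → H¹(G, ℤ_ℓ(1) / ℓ)` is surjective for all `n ≥ 1`. -/
structure IsKummerian (θ : G →ₜ* ℤ_[ℓ]ˣ) : Prop where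
  isProP : IsProP ℓ G
  torsionFree : IsTorsionFreeOrientation θ
  surjective : ∀ (n : ℕ) (hn : 1 ≤ n),
    Function.Surjective (ContCoh.map (twistMap θ (ModPow.proj ℓ hn)) 1)

/-- The subgroup `K_θ(G)`: the closed subgroup generated by the elements `h ^ (-θ(g)) g h g⁻¹`
with `g ∈ G` and `h ∈ ker θ`. -/
def Kθ [IsTopologicalGroup G] (θ : G →ₜ* ℤ_[ℓ]ˣ) : Subgroup G :=
  (Subgroup.closure
    {x : G | ∃ g h : G, θ h = 1 ∧
      x = padicPow h (-(θ g : ℤ_[ℓ])) * (g * h * g⁻¹)}).topologicalClosure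

/-- The oriented pro-`ℓ` group `(G, θ)` has the Bogomolov property: it is Kummerian and `K_θ(G)`
is a free pro-`ℓ` group. -/
def HasBogomolovProperty [IsTopologicalGroup G] (θ : G →ₜ* ℤ_[ℓ]ˣ) : Prop :=
  IsKummerian θ ∧ IsFreeProP ℓ (Kθ θ)

end Oriented

/-! ### Demushkin groups and their canonical orientation -/

section Demushkin

variable (ℓ : ℕ) [Fact ℓ.Prime] (G : Type u) [Group G] [TopologicalSpace G]

/-- `𝔽_ℓ` as a trivial `G`-module. -/
abbrev trivRep : Representation (ZMod ℓ) G (ZMod ℓ) := Representation.trivial (ZMod ℓ) G (ZMod ℓ)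

/-- A Demushkin group. The last two conditions say that the cup product
`H¹(G, 𝔽_ℓ) × H¹(G, 𝔽_ℓ) → H²(G, 𝔽_ℓ) ≅ 𝔽_ℓ` is a perfect pairing. -/
structure IsDemushkin : Prop where
  isProP : IsProP ℓ G
  finite_H1 : Module.Finite (ZMod ℓ) (ContCoh.H (trivRep ℓ G) 1)
  H2_iso : Nonempty (ContCoh.H (trivRep ℓ G) 2 ≃ₗ[ZMod ℓ] ZMod ℓ)
  H3_eq_zero : Subsingleton (ContCoh.H (trivRep ℓ G) 3)
  cup_left : Function.Bijective (ContCoh.cup (k := ZMod ℓ) (G := G))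
  cup_right : Function.Bijective (ContCoh.cup (k := ZMod ℓ) (G := G)).flip

/-- The group `ℚ_ℓ / ℤ_ℓ`. -/
abbrev PadicQuot : Type := ℚ_[ℓ] ⧸ LinearMap.range (Algebra.linearMap ℤ_[ℓ] ℚ_[ℓ])

variable {ℓ G}

/-- The `G`-module `I = ℚ_ℓ / ℤ_ℓ` with the action `g • x = θ(g) x` is a dualizing module of `G` in
dimension `2`: there is a homomorphism `i : H²(G, I) → ℚ / ℤ` such that for every finite discrete
`G`-module `A` of `ℓ`-power order the map `Hom_G(A, I) → Hom(H²(G, A), ℚ / ℤ)`, which sends `f` to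
the composition of `f_* : H²(G, A) → H²(G, I)` with `i`, is bijective. (So `I` represents the functor
`A ↦ Hom(H²(G, A), ℚ / ℤ)`; this determines the pair `(I, i)` up to a unique isomorphism, and
it determines `θ`.) -/
def IsDualizingOrientation (θ : G →ₜ* ℤ_[ℓ]ˣ) : Prop :=
  ∃ i : ContCoh.H (twist θ (PadicQuot ℓ)) 2 →+ AddCircle (1 : ℚ),
    ∀ (A : Type) [AddCommGroup A] [Finite A] (ρ : Representation ℤ G A),
      (∃ m : ℕ, Nat.card A = ℓ ^ m) → ContCoh.IsDiscreteRep ρ →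
        Function.Bijective fun f : Representation.IntertwiningMap ρ (twist θ (PadicQuot ℓ)) =>
          i.comp (ContCoh.map f 2).toAddMonoidHom

variable (ℓ G)

open Classical in
/-- The canonical orientation of a Demushkin group `G`: the character through which `G` acts on
its dualizing module, which is isomorphic to `ℚ_ℓ / ℤ_ℓ` as an abelian group. (For groups without
such a dualizing module the value is the trivial character and has no meaning.) -/
noncomputable def canonicalOrientation : G →ₜ* ℤ_[ℓ]ˣ :=
  if h : ∃ θ : G →ₜ* ℤ_[ℓ]ˣ, IsDualizingOrientation θ then h.choose else 1

end Demushkin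

/-!
# The Bogomolov property of Demushkin groups

Let `I = ℚ_ℓ / ℤ_ℓ` with the action of the Demushkin group `G` through its canonical orientation
`θ`, let `i : H²(G, I) → ℚ / ℤ` be the functional of the duality, and let `N = K_θ(G)`.

*Existence of the orientation.* As `canonicalOrientation` is defined by choice, one has to show
first that `I` exists (`IsDemushkin.exists_isDualizingOrientation`). The orientation is built
modulo `ℓ ^ n` by induction, such that every homomorphism `G → 𝔽_ℓ` lifts to a crossed
homomorphism modulo `ℓ ^ n`. In the step the obstructions to lifting define a linear form on
`H¹(G, 𝔽_ℓ)`, which by the perfectness of the cup product is `α ↦ α₀ ∪ α`, and changing the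
orientation by `1 + ℓ ^ n α₀` removes it (`IsKummerMod.exists_succ`). In the limit `H¹(G, I)` is
divisible, so `H²(G, 𝔽_ℓ)` embeds into `H²(G, I)`, and `i` is an extension of an isomorphism of
`H²(G, 𝔽_ℓ)` with the `ℓ`-torsion of `ℚ / ℤ`. Duality for a finite module `A` follows by induction
on its order with the four lemma (`IsShortExact.isDualPair`), from the case of `𝔽_ℓ`; this is
where `H³(G, 𝔽_ℓ) = 0` is used.

*Kummerian.* Homomorphisms `ℤ_ℓ(1) / ℓ ^ m → I` extend to `ℤ_ℓ(1) / ℓ ^ (m + 1)`, so by duality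
`H²(G, ℤ_ℓ(1) / ℓ ^ m)` embeds into `H²(G, ℤ_ℓ(1) / ℓ ^ (m + 1))`. The obstruction to lifting a
class in `H¹(G, ℤ_ℓ(1) / ℓ)` to `H¹(G, ℤ_ℓ(1) / ℓ ^ (m + 1))` lies in the kernel of this map
(`IsDualizingOrientation.isKummerian`).

*Freeness.* The index of `N` is infinite (`IsDemushkin.not_isOpen_Kθ`): otherwise `θ` has finite,
hence trivial, image, and then `N` lies in the kernels of lifts `G → ℤ / ℓ ^ n` of a nonzero
homomorphism `G → 𝔽_ℓ` for all `n`. For a closed subgroup `N` of infinite index, `H²(N, 𝔽_ℓ)`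
vanishes (`IsDualizingOrientation.exists_diffOne_eq_subgroup`): a class comes from an open
subgroup `U ⊇ N`, and the restriction to a smaller open subgroup `V ⊇ N` is zero, since by duality
it is dual to a map that is multiplication by the index `[U : V]`, a multiple of `ℓ`. Finally, a
closed subgroup of `G` has a countable basis of neighbourhoods of `1`, as `H¹(G, 𝔽_ℓ)` is finite
(`countable_openNormalSubgroup`). In a pro-`ℓ` group with such a basis, a subset that converges to
`1` and is dual to `H¹` is a basis of a free pro-`ℓ` group if `H²` vanishes: homomorphisms lift
along central extensions by `𝔽_ℓ` (`isFreeProP_of_H2_eq_zero`).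
-/

/-! ### Cocycles as functions of one, two and three variables -/

namespace ContCoh

section Concrete

variable {k : Type v} {G : Type u} {A : Type w} [CommRing k] [Group G] [TopologicalSpace G]
  [AddCommGroup A] [Module k A]

/-- The differential of a function of one variable. -/
def diffOne (ρ : Representation k G A) : (G → A) →+ (G × G → A) where
  toFun b p := ρ p.1 (b p.2) - b (p.1 * p.2) + b p.1
  map_zero' := by ext; simp
  map_add' b c := by ext; simp; abel

/-- The differential of a function of two variables. -/
def diffTwo (ρ : Representation k G A) : (G × G → A) →+ (G × G × G → A) where
  toFun z p := ρ p.1 (z (p.2.1, p.2.2)) - z (p.1 * p.2.1, p.2.2) + z (p.1, p.2.1 * p.2.2)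
    - z (p.1, p.2.1)
  map_zero' := by ext; simp
  map_add' b c := by ext; simp; abel

/-- The differential of a function of three variables. -/
def diffThree (ρ : Representation k G A) (w : G × G × G → A) (p : G × G × G × G) : A :=
  ρ p.1 (w (p.2.1, p.2.2.1, p.2.2.2)) - w (p.1 * p.2.1, p.2.2.1, p.2.2.2)
    + w (p.1, p.2.1 * p.2.2.1, p.2.2.2) - w (p.1, p.2.1, p.2.2.1 * p.2.2.2)
    + w (p.1, p.2.1, p.2.2.1)

lemma diffOne_apply (ρ : Representation k G A) (b : G → A) (g h : G) :
    diffOne ρ b (g, h) = ρ g (b h) - b (g * h) + b g := rfl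

lemma diffTwo_apply (ρ : Representation k G A) (z : G × G → A) (g h j : G) :
    diffTwo ρ z (g, h, j) = ρ g (z (h, j)) - z (g * h, j) + z (g, h * j) - z (g, h) := rfl

lemma diffTwo_diffOne (ρ : Representation k G A) (b : G → A) : diffTwo ρ (diffOne ρ b) = 0 := by
  ext ⟨g, h, j⟩
  simp only [diffTwo_apply, diffOne_apply, map_add, map_sub, map_mul, mul_assoc,
    Module.End.mul_apply, Pi.zero_apply]
  abel

lemma diffThree_diffTwo (ρ : Representation k G A) (z : G × G → A) :
    diffThree ρ (diffTwo ρ z) = 0 := by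
  ext ⟨g, h, j, l⟩
  simp only [diffThree, diffTwo_apply, map_add, map_sub, map_mul, mul_assoc,
    Module.End.mul_apply, Pi.zero_apply]
  abel

/-- Continuous crossed homomorphisms `G → A`. -/
def Z1 (ρ : Representation k G A) : AddSubgroup (G → A) where
  carrier := {a | IsLocallyConstant a ∧ diffOne ρ a = 0}
  zero_mem' := ⟨IsLocallyConstant.const 0, map_zero _⟩
  add_mem' ha hb := ⟨ha.1.add hb.1, by rw [map_add, ha.2, hb.2, add_zero]⟩
  neg_mem' ha := ⟨ha.1.neg, by rw [map_neg, ha.2, neg_zero]⟩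

/-- Continuous `2`-cocycles of `G` with values in `A`, as functions on `G × G`. -/
def Z2 (ρ : Representation k G A) : AddSubgroup (G × G → A) where
  carrier := {a | IsLocallyConstant a ∧ diffTwo ρ a = 0}
  zero_mem' := ⟨IsLocallyConstant.const 0, map_zero _⟩
  add_mem' ha hb := ⟨ha.1.add hb.1, by rw [map_add, ha.2, hb.2, add_zero]⟩
  neg_mem' ha := ⟨ha.1.neg, by rw [map_neg, ha.2, neg_zero]⟩

lemma Z1.map_mul {ρ : Representation k G A} {a : G → A} (ha : a ∈ Z1 ρ) (g h : G) :
    a (g * h) = a g + ρ g (a h) := by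
  have := congrFun ha.2 (g, h)
  rw [diffOne_apply, Pi.zero_apply] at this
  rw [← sub_eq_zero, ← neg_eq_zero, ← this]
  abel

lemma mem_Z1_iff {ρ : Representation k G A} {a : G → A} :
    a ∈ Z1 ρ ↔ IsLocallyConstant a ∧ ∀ g h, a (g * h) = a g + ρ g (a h) := by
  refine ⟨fun h => ⟨h.1, Z1.map_mul h⟩, fun h => ⟨h.1, ?_⟩⟩
  ext ⟨x, y⟩
  rw [diffOne_apply, h.2 x y, Pi.zero_apply]
  abel

lemma mem_Z2_iff {ρ : Representation k G A} {z : G × G → A} :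
    z ∈ Z2 ρ ↔ IsLocallyConstant z ∧
      ∀ g h j, ρ g (z (h, j)) - z (g * h, j) + z (g, h * j) - z (g, h) = 0 :=
  and_congr_right fun _ => ⟨fun h g h' j => congrFun h (g, h', j), fun h => by
    ext ⟨x, y, z⟩; exact h x y z⟩

lemma diff_one_apply (ρ : Representation k G A) (f : (Fin 1 → G) → A) (x : Fin 2 → G) :
    diff ρ 1 f x = diffOne ρ (fun g => f fun _ => g) (x 0, x 1) := by
  have e1 : (fun i : Fin 1 => x i.succ) = fun _ => x 1 := by
    ext i; fin_cases i; rfl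
  have e2 : Fin.contractNth (0 : Fin 2) (· * ·) x = fun _ => x 0 * x 1 := by
    ext i; fin_cases i; rfl
  have e3 : Fin.contractNth (1 : Fin 2) (· * ·) x = fun _ => x 0 := by
    ext i; fin_cases i; rfl
  rw [diff_apply, Fin.sum_univ_two, diffOne_apply, e1, e2, e3]
  simp
  abel

lemma diff_two_apply (ρ : Representation k G A) (f : (Fin 2 → G) → A) (x : Fin 3 → G) :
    diff ρ 2 f x = diffTwo ρ (fun p => f ![p.1, p.2]) (x 0, x 1, x 2) := by
  have e1 : (fun i : Fin 2 => x i.succ) = ![x 1, x 2] := by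
    ext i; fin_cases i <;> rfl
  have e2 : Fin.contractNth (0 : Fin 3) (· * ·) x = ![x 0 * x 1, x 2] := by
    ext i; fin_cases i <;> rfl
  have e3 : Fin.contractNth (1 : Fin 3) (· * ·) x = ![x 0, x 1 * x 2] := by
    ext i; fin_cases i <;> rfl
  have e4 : Fin.contractNth (2 : Fin 3) (· * ·) x = ![x 0, x 1] := by
    ext i; fin_cases i <;> rfl
  rw [diff_apply, Fin.sum_univ_three, diffTwo_apply, e1, e2, e3, e4]
  simp [pow_succ]
  abel

lemma diff_three_apply (ρ : Representation k G A) (f : (Fin 3 → G) → A) (x : Fin 4 → G) :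
    diff ρ 3 f x = diffThree ρ (fun p => f ![p.1, p.2.1, p.2.2]) (x 0, x 1, x 2, x 3) := by
  have e1 : (fun i : Fin 3 => x i.succ) = ![x 1, x 2, x 3] := by
    ext i; fin_cases i <;> rfl
  have e2 : Fin.contractNth (0 : Fin 4) (· * ·) x = ![x 0 * x 1, x 2, x 3] := by
    ext i; fin_cases i <;> rfl
  have e3 : Fin.contractNth (1 : Fin 4) (· * ·) x = ![x 0, x 1 * x 2, x 3] := by
    ext i; fin_cases i <;> rfl
  have e4 : Fin.contractNth (2 : Fin 4) (· * ·) x = ![x 0, x 1, x 2 * x 3] := by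
    ext i; fin_cases i <;> rfl
  have e5 : Fin.contractNth (3 : Fin 4) (· * ·) x = ![x 0, x 1, x 2] := by
    ext i; fin_cases i <;> rfl
  rw [diff_apply, Fin.sum_univ_four, e1, e2, e3, e4, e5]
  simp [pow_succ, diffThree]
  abel

/-- The class in `H¹(G, A)` of a crossed homomorphism. -/
def cls1 (ρ : Representation k G A) : Z1 ρ →+ H ρ 1 where
  toFun a := Submodule.Quotient.mk ⟨fun x => a.1 (x 0),
    IsLocallyConstant.comp_continuous (f := fun x : Fin 1 → G => x 0) a.2.1 (by fun_prop), by
      ext x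
      rw [diff_one_apply]
      exact congrFun a.2.2 _⟩
  map_zero' := rfl
  map_add' _ _ := rfl

/-- The class in `H²(G, A)` of a `2`-cocycle. -/
def cls2 (ρ : Representation k G A) : Z2 ρ →+ H ρ 2 where
  toFun a := Submodule.Quotient.mk ⟨fun x => a.1 (x 0, x 1),
    IsLocallyConstant.comp_continuous (f := fun x : Fin 2 → G => (x 0, x 1)) a.2.1
      (by fun_prop), by
      ext x
      rw [diff_two_apply]
      exact congrFun a.2.2 _⟩
  map_zero' := rfl
  map_add' _ _ := rfl

lemma cls1_surjective (ρ : Representation k G A) : Function.Surjective (cls1 ρ) := by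
  intro x
  obtain ⟨⟨f, hf⟩, rfl⟩ := Submodule.Quotient.mk_surjective _ x
  refine ⟨⟨fun g => f fun _ => g, IsLocallyConstant.comp_continuous
    (f := fun g : G => fun _ : Fin 1 => g) hf.1 (by fun_prop), ?_⟩, ?_⟩
  · ext ⟨g, h⟩
    have := congrFun (show diff ρ 1 f = 0 from hf.2) ![g, h]
    rwa [diff_one_apply] at this
  · refine congrArg Submodule.Quotient.mk (Subtype.ext (funext fun x => congrArg f ?_))
    ext i; fin_cases i; rfl

lemma cls2_surjective (ρ : Representation k G A) : Function.Surjective (cls2 ρ) := by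
  intro x
  obtain ⟨⟨f, hf⟩, rfl⟩ := Submodule.Quotient.mk_surjective _ x
  refine ⟨⟨fun p => f ![p.1, p.2], IsLocallyConstant.comp_continuous
    (f := fun p : G × G => ![p.1, p.2]) hf.1 (by fun_prop), ?_⟩, ?_⟩
  · ext ⟨g, h, j⟩
    have := congrFun (show diff ρ 2 f = 0 from hf.2) ![g, h, j]
    rwa [diff_two_apply] at this
  · refine congrArg Submodule.Quotient.mk (Subtype.ext (funext fun x => congrArg f ?_))
    ext i; fin_cases i <;> rfl

lemma cls1_eq_zero_iff (ρ : Representation k G A) (a : Z1 ρ) :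
    cls1 ρ a = 0 ↔ ∃ m : A, ∀ g, a.1 g = ρ g m - m := by
  refine (Submodule.Quotient.mk_eq_zero _).trans ⟨?_, ?_⟩
  · rintro ⟨b, -, hb⟩
    refine ⟨b ![], fun g => ?_⟩
    have := congrFun hb fun _ => g
    rw [diff_apply, Fin.sum_univ_one, Subsingleton.elim (Fin.contractNth _ _ _) ![],
      Subsingleton.elim (fun i : Fin 0 => _) ![]] at this
    simp only [Fin.val_zero, zero_add, pow_one, neg_smul, one_smul] at this
    rw [sub_eq_add_neg]
    exact this.symm
  · rintro ⟨m, hm⟩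
    refine ⟨fun _ => m, IsLocallyConstant.const m, ?_⟩
    ext x
    rw [diff_apply, Fin.sum_univ_one]
    simp only [Fin.val_zero, zero_add, pow_one, neg_smul, one_smul]
    rw [← sub_eq_add_neg]
    exact (hm _).symm

lemma cls2_eq_zero_iff (ρ : Representation k G A) (z : Z2 ρ) :
    cls2 ρ z = 0 ↔ ∃ b : G → A, IsLocallyConstant b ∧ diffOne ρ b = z.1 := by
  refine (Submodule.Quotient.mk_eq_zero _).trans ⟨?_, ?_⟩
  · rintro ⟨b, hb, hbz⟩
    refine ⟨fun g => b fun _ => g, IsLocallyConstant.comp_continuous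
      (f := fun g : G => fun _ : Fin 1 => g) hb (by fun_prop), ?_⟩
    ext ⟨g, h⟩
    have := congrFun hbz ![g, h]
    rwa [diff_one_apply] at this
  · rintro ⟨b, hb, hbz⟩
    refine ⟨fun x => b (x 0), IsLocallyConstant.comp_continuous
      (f := fun x : Fin 1 → G => x 0) hb (by fun_prop), ?_⟩
    ext x
    rw [diff_one_apply]
    exact congrFun hbz _

lemma exists_diffTwo_eq {ρ : Representation k G A} (h3 : Subsingleton (H ρ 3))
    {w : G × G × G → A} (hw : IsLocallyConstant w) (hdw : diffThree ρ w = 0) :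
    ∃ y : G × G → A, IsLocallyConstant y ∧ diffTwo ρ y = w := by
  have hmem : (fun x : Fin 3 → G => w (x 0, x 1, x 2)) ∈ cocycles ρ 3 := by
    refine ⟨IsLocallyConstant.comp_continuous (f := fun x : Fin 3 → G => (x 0, x 1, x 2)) hw
      (by fun_prop), ?_⟩
    ext x
    rw [diff_three_apply]
    exact congrFun hdw _
  have h0 : (Submodule.Quotient.mk ⟨_, hmem⟩ : H ρ 3) = 0 := Subsingleton.elim _ _
  obtain ⟨b, hb, hbz⟩ := (Submodule.Quotient.mk_eq_zero _).1 h0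
  refine ⟨fun p => b ![p.1, p.2], IsLocallyConstant.comp_continuous
      (f := fun p : G × G => ![p.1, p.2]) hb (by fun_prop), ?_⟩
  ext ⟨g, h, j⟩
  have := congrFun hbz ![g, h, j]
  rwa [diff_two_apply] at this

end Concrete

section Map

variable {k : Type v} {G : Type u} {A B : Type*} [CommRing k] [Group G] [TopologicalSpace G]
  [AddCommGroup A] [Module k A] [AddCommGroup B] [Module k B]
  {ρ : Representation k G A} {σ : Representation k G B}

lemma diffOne_comp (f : Representation.IntertwiningMap ρ σ) (b : G → A) :
    diffOne σ (f ∘ b) = f ∘ diffOne ρ b := by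
  ext ⟨g, h⟩
  simp [diffOne_apply, Representation.IntertwiningMap.isIntertwining]

lemma diffTwo_comp (f : Representation.IntertwiningMap ρ σ) (b : G × G → A) :
    diffTwo σ (f ∘ b) = f ∘ diffTwo ρ b := by
  ext ⟨g, h, j⟩
  simp [diffTwo_apply, Representation.IntertwiningMap.isIntertwining]

lemma diffThree_comp (f : Representation.IntertwiningMap ρ σ) (b : G × G × G → A) :
    diffThree σ (f ∘ b) = f ∘ diffThree ρ b := by
  ext ⟨g, h, j⟩
  simp [diffThree, Representation.IntertwiningMap.isIntertwining]

lemma comp_mem_Z1 (f : Representation.IntertwiningMap ρ σ) {a : G → A} (ha : a ∈ Z1 ρ) :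
    f ∘ a ∈ Z1 σ :=
  ⟨ha.1.comp f, by rw [diffOne_comp, ha.2]; ext; simp⟩

lemma comp_mem_Z2 (f : Representation.IntertwiningMap ρ σ) {z : G × G → A} (hz : z ∈ Z2 ρ) :
    f ∘ z ∈ Z2 σ :=
  ⟨hz.1.comp f, by rw [diffTwo_comp, hz.2]; ext; simp⟩

lemma map_cls1 (f : Representation.IntertwiningMap ρ σ) (a : Z1 ρ) :
    map f 1 (cls1 ρ a) = cls1 σ ⟨f ∘ a.1, comp_mem_Z1 f a.2⟩ := rfl

lemma map_cls2 (f : Representation.IntertwiningMap ρ σ) (z : Z2 ρ) :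
    map f 2 (cls2 ρ z) = cls2 σ ⟨f ∘ z.1, comp_mem_Z2 f z.2⟩ := rfl

end Map

/-- The translate of a locally constant function by a discrete representation is locally
constant. -/
lemma isLocallyConstant_action {k : Type v} {G : Type u} {A : Type w} [CommRing k] [Group G]
    [TopologicalSpace G] [IsTopologicalGroup G] [AddCommGroup A] [Module k A]
    {ρ : Representation k G A} (hρ : IsDiscreteRep ρ) {X : Type*} [TopologicalSpace X]
    {b : X → A} (hb : IsLocallyConstant b) :
    IsLocallyConstant fun p : G × X => ρ p.1 (b p.2) := by
  rw [IsLocallyConstant.iff_eventually_eq]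
  rintro ⟨g, h⟩
  have h1 : ∀ᶠ p : G × X in 𝓝 (g, h), b p.2 = b h :=
    (continuous_snd.tendsto (g, h)).eventually
      ((IsLocallyConstant.iff_eventually_eq b).1 hb h)
  have h2 : ∀ᶠ p : G × X in 𝓝 (g, h), ρ (g⁻¹ * p.1) (b h) = b h := by
    have hc : Continuous fun p : G × X => g⁻¹ * p.1 := by fun_prop
    refine hc.continuousAt.eventually ((hρ (b h)).mem_nhds ?_)
    simp
  filter_upwards [h1, h2] with p hp1 hp2
  rw [hp1]
  conv_rhs => rw [← hp2]
  rw [← Module.End.mul_apply, ← map_mul, mul_inv_cancel_left]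

lemma diffOne_mem_Z2 {k : Type v} {G : Type u} {A : Type w} [CommRing k] [Group G]
    [TopologicalSpace G] [IsTopologicalGroup G] [AddCommGroup A] [Module k A]
    {ρ : Representation k G A} (hρ : IsDiscreteRep ρ) {b : G → A} (hb : IsLocallyConstant b) :
    diffOne ρ b ∈ Z2 ρ := by
  refine ⟨?_, diffTwo_diffOne ρ b⟩
  have h1 : IsLocallyConstant fun p : G × G => b p.1 := hb.comp_continuous continuous_fst
  have h2 : IsLocallyConstant fun p : G × G => b (p.1 * p.2) :=
    hb.comp_continuous continuous_mul
  exact ((isLocallyConstant_action hρ hb).sub h2).add h1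

end ContCoh

/-! ### The hypotheses on a Demushkin group in terms of cocycles -/

namespace ContCoh

section Trivial

variable (ℓ : ℕ) [Fact ℓ.Prime] (G : Type u) [Group G] [TopologicalSpace G]

/-- `𝔽_ℓ` as a trivial `G`-module over `ℤ`. -/
abbrev trivInt : Representation ℤ G (ZMod ℓ) := Representation.trivial ℤ G (ZMod ℓ)

variable {ℓ G}

lemma mem_Z1_trivInt {χ : G → ZMod ℓ} :
    χ ∈ Z1 (trivInt ℓ G) ↔ IsLocallyConstant χ ∧ ∀ g h, χ (g * h) = χ g + χ h := by
  rw [mem_Z1_iff]; simp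

lemma mem_Z2_trivInt {z : G × G → ZMod ℓ} :
    z ∈ Z2 (trivInt ℓ G) ↔ IsLocallyConstant z ∧
      ∀ g h j, z (h, j) - z (g * h, j) + z (g, h * j) - z (g, h) = 0 := by
  rw [mem_Z2_iff]; simp

lemma diffOne_trivInt (b : G → ZMod ℓ) (g h : G) :
    diffOne (trivInt ℓ G) b (g, h) = b h - b (g * h) + b g := by
  rw [diffOne_apply]; simp

/-- The cup product of two homomorphisms to `𝔽_ℓ`. -/
def cup11 (χ ψ : Z1 (trivInt ℓ G)) : Z2 (trivInt ℓ G) :=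
  ⟨fun p => χ.1 p.1 * ψ.1 p.2, mem_Z2_trivInt.2
    ⟨(χ.2.1.comp_continuous continuous_fst).mul (ψ.2.1.comp_continuous continuous_snd),
      fun g h j => by
        simp only [(mem_Z1_trivInt.1 χ.2).2, (mem_Z1_trivInt.1 ψ.2).2]
        ring⟩⟩

/-- The class in `H¹(G, 𝔽_ℓ)` of a homomorphism. -/
def clsTriv1 : Z1 (trivInt ℓ G) →+ H (trivRep ℓ G) 1 := cls1 (trivRep ℓ G)

/-- The class in `H²(G, 𝔽_ℓ)` of a `2`-cocycle. -/
def clsTriv2 : Z2 (trivInt ℓ G) →+ H (trivRep ℓ G) 2 := cls2 (trivRep ℓ G)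

lemma clsTriv1_bijective : Function.Bijective (clsTriv1 (ℓ := ℓ) (G := G)) := by
  refine ⟨?_, cls1_surjective (trivRep ℓ G)⟩
  rw [injective_iff_map_eq_zero]
  intro a ha
  obtain ⟨m, hm⟩ := (cls1_eq_zero_iff (trivRep ℓ G) a).1 ha
  ext g
  simpa using hm g

lemma cup_clsTriv1 (χ ψ : Z1 (trivInt ℓ G)) :
    cup (k := ZMod ℓ) (G := G) (clsTriv1 χ) (clsTriv1 ψ) = clsTriv2 (cup11 χ ψ) := rfl

end Trivial

end ContCoh

open ContCoh

namespace IsDemushkin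

variable {ℓ : ℕ} [Fact ℓ.Prime] {G : Type u} [Group G] [TopologicalSpace G]

/-- A functional on `2`-cocycles that identifies `H²(G, 𝔽_ℓ)` with `𝔽_ℓ`, and the
nondegeneracy of the cup product with respect to it. -/
lemma exists_functional (hG : IsDemushkin ℓ G) :
    ∃ τ : Z2 (trivInt ℓ G) →+ ZMod ℓ, Function.Surjective τ ∧
      (∀ z, τ z = 0 ↔ ∃ b : G → ZMod ℓ, IsLocallyConstant b ∧ diffOne (trivInt ℓ G) b = z.1) ∧
      (∀ χ, (∀ ψ, τ (cup11 χ ψ) = 0) → χ = 0) ∧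
      ∀ e : Z1 (trivInt ℓ G) →+ ZMod ℓ, ∃ α, ∀ χ, τ (cup11 α χ) = e χ := by
  obtain ⟨κ⟩ := hG.H2_iso
  refine ⟨κ.toLinearMap.toAddMonoidHom.comp clsTriv2, ?_, ?_, ?_, ?_⟩
  · exact κ.surjective.comp (cls2_surjective (trivRep ℓ G))
  · intro z
    change κ (clsTriv2 z) = 0 ↔ _
    rw [LinearEquiv.map_eq_zero_iff]
    exact cls2_eq_zero_iff (trivRep ℓ G) z
  · intro χ hχ
    apply clsTriv1_bijective.1
    rw [map_zero]
    apply hG.cup_left.1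
    rw [map_zero]
    refine LinearMap.ext fun x => ?_
    obtain ⟨ψ, rfl⟩ := clsTriv1_bijective.2 x
    exact κ.injective ((hχ ψ).trans (map_zero κ).symm)
  · intro e
    let E : Z1 (trivInt ℓ G) ≃+ H (trivRep ℓ G) 1 :=
      AddEquiv.ofBijective clsTriv1 clsTriv1_bijective
    obtain ⟨x, hx⟩ := hG.cup_left.2 (κ.symm.toLinearMap ∘ₗ
      (AddMonoidHom.toZModLinearMap ℓ (e.comp E.symm.toAddMonoidHom)))
    obtain ⟨α, rfl⟩ := clsTriv1_bijective.2 x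
    refine ⟨α, fun χ => ?_⟩
    have h1 : e (E.symm (E χ)) = e χ := by rw [E.symm_apply_apply]
    rw [← h1]
    have h2 := congrArg κ (LinearMap.congr_fun hx (clsTriv1 χ))
    rw [cup_clsTriv1] at h2
    exact h2.trans (κ.apply_symm_apply _)

lemma finite_Z1 (hG : IsDemushkin ℓ G) : Finite (Z1 (trivInt ℓ G)) := by
  have := hG.finite_H1
  have : Finite (H (trivRep ℓ G) 1) := Module.finite_of_finite (ZMod ℓ)
  exact Finite.of_injective _ clsTriv1_bijective.1

lemma exists_diffTwo_eq (hG : IsDemushkin ℓ G) {w : G × G × G → ZMod ℓ}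
    (hw : IsLocallyConstant w) (hdw : diffThree (trivInt ℓ G) w = 0) :
    ∃ y : G × G → ZMod ℓ, IsLocallyConstant y ∧ diffTwo (trivInt ℓ G) y = w :=
  ContCoh.exists_diffTwo_eq (ρ := trivRep ℓ G) hG.H3_eq_zero hw hdw

end IsDemushkin

/-! ### Approximations of the canonical orientation -/

section Divisibility

variable {ℓ : ℕ} [Fact ℓ.Prime]

lemma PadicInt.toZMod_eq_zero_iff_dvd (x : ℤ_[ℓ]) :
    PadicInt.toZMod x = 0 ↔ (ℓ : ℤ_[ℓ]) ∣ x := by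
  rw [← RingHom.mem_ker, PadicInt.ker_toZMod, PadicInt.maximalIdeal_eq_span_p,
    Ideal.mem_span_singleton]

lemma PadicInt.prime_ne_zero : (ℓ : ℤ_[ℓ]) ≠ 0 :=
  Nat.cast_ne_zero.2 (Fact.out : ℓ.Prime).ne_zero

lemma PadicInt.pow_prime_ne_zero (n : ℕ) : (ℓ : ℤ_[ℓ]) ^ n ≠ 0 :=
  pow_ne_zero _ PadicInt.prime_ne_zero

/-- The quotient of `x` by `ℓ ^ n`, if `ℓ ^ n` divides `x`. -/
noncomputable def divPow (n : ℕ) (x : ℤ_[ℓ]) : ℤ_[ℓ] :=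
  open Classical in if h : (ℓ : ℤ_[ℓ]) ^ n ∣ x then h.choose else 0

lemma pow_mul_divPow {n : ℕ} {x : ℤ_[ℓ]} (h : (ℓ : ℤ_[ℓ]) ^ n ∣ x) :
    (ℓ : ℤ_[ℓ]) ^ n * divPow n x = x := by
  rw [divPow, dif_pos h]
  exact h.choose_spec.symm

lemma divPow_pow_mul (n : ℕ) (x : ℤ_[ℓ]) : divPow n ((ℓ : ℤ_[ℓ]) ^ n * x) = x :=
  mul_left_cancel₀ (PadicInt.pow_prime_ne_zero n) (pow_mul_divPow (dvd_mul_right _ _))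

/-- The lift of an element of `𝔽_ℓ` to `ℤ_ℓ`. -/
noncomputable def liftZMod (ℓ : ℕ) [Fact ℓ.Prime] (x : ZMod ℓ) : ℤ_[ℓ] := (x.val : ℤ_[ℓ])

@[simp] lemma toZMod_liftZMod (x : ZMod ℓ) : PadicInt.toZMod (liftZMod ℓ x) = x := by
  simp [liftZMod]

end Divisibility

section Approx

variable {ℓ : ℕ} [Fact ℓ.Prime] {G : Type u} [Group G] [TopologicalSpace G]

/-- A locally constant function `c : G → ℤ_ℓ` that is a crossed homomorphism modulo `ℓ ^ n` with
respect to the action through `θ`. -/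
def IsCrossedMod (θ : G → ℤ_[ℓ]) (n : ℕ) (c : G → ℤ_[ℓ]) : Prop :=
  IsLocallyConstant c ∧ ∀ g h, (ℓ : ℤ_[ℓ]) ^ n ∣ c g + θ g * c h - c (g * h)

/-- Every homomorphism `G → 𝔽_ℓ` lifts to a crossed homomorphism to `ℤ_ℓ / ℓ ^ n`, on which `G`
acts through `θ`. -/
def LiftsMod (θ : G → ℤ_[ℓ]) (n : ℕ) : Prop :=
  ∀ χ ∈ Z1 (trivInt ℓ G), ∃ c, IsCrossedMod θ n c ∧ ∀ g, PadicInt.toZMod (c g) = χ g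

lemma IsCrossedMod.sub {θ : G → ℤ_[ℓ]} {n : ℕ} {c d : G → ℤ_[ℓ]} (hc : IsCrossedMod θ n c)
    (hd : IsCrossedMod θ n d) : IsCrossedMod θ n (c - d) :=
  ⟨hc.1.sub hd.1, fun g h => by
    have := dvd_sub (hc.2 g h) (hd.2 g h)
    simp only [Pi.sub_apply]
    convert this using 1
    ring⟩

lemma IsCrossedMod.add {θ : G → ℤ_[ℓ]} {n : ℕ} {c d : G → ℤ_[ℓ]} (hc : IsCrossedMod θ n c)
    (hd : IsCrossedMod θ n d) : IsCrossedMod θ n (c + d) :=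
  ⟨hc.1.add hd.1, fun g h => by
    have := dvd_add (hc.2 g h) (hd.2 g h)
    simp only [Pi.add_apply]
    convert this using 1
    ring⟩

lemma IsCrossedMod.congr {θ θ' : G → ℤ_[ℓ]} {n : ℕ} {c : G → ℤ_[ℓ]} (hc : IsCrossedMod θ n c)
    (h : ∀ g, (ℓ : ℤ_[ℓ]) ^ n ∣ θ' g - θ g) : IsCrossedMod θ' n c :=
  ⟨hc.1, fun g h' => by
    have := dvd_add (hc.2 g h') ((h g).mul_right (c h'))
    convert this using 1
    ring⟩

lemma IsCrossedMod.exists_eq_mul {θ : G → ℤ_[ℓ]} {m : ℕ} {c : G → ℤ_[ℓ]}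
    (hc : IsCrossedMod θ (m + 1) c) (h : ∀ g, (ℓ : ℤ_[ℓ]) ∣ c g) :
    ∃ d, IsCrossedMod θ m d ∧ ∀ g, c g = ℓ * d g := by
  have hd : ∀ g, c g = ℓ * divPow 1 (c g) := fun g => by
    have := pow_mul_divPow (n := 1) (x := c g) (by simpa using h g)
    rw [pow_one] at this
    exact this.symm
  refine ⟨fun g => divPow 1 (c g), ⟨hc.1.comp (divPow 1), fun g h' => ?_⟩, hd⟩
  have := hc.2 g h'
  rw [hd g, hd h', hd (g * h'), pow_succ'] at this
  refine (mul_dvd_mul_iff_left (PadicInt.prime_ne_zero (ℓ := ℓ))).1 ?_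
  convert this using 1
  ring

/-- If every homomorphism to `𝔽_ℓ` lifts to `ℤ_ℓ / ℓ ^ n`, then so does every crossed homomorphism
to `ℤ_ℓ / ℓ ^ m`. -/
lemma LiftsMod.exists_lift {θ : G → ℤ_[ℓ]} {n : ℕ} (hθ : LiftsMod θ n)
    (h1 : ∀ g, (ℓ : ℤ_[ℓ]) ∣ θ g - 1) {m : ℕ} (hmn : m ≤ n) {c : G → ℤ_[ℓ]}
    (hc : IsCrossedMod θ m c) :
    ∃ c', IsCrossedMod θ n c' ∧ ∀ g, (ℓ : ℤ_[ℓ]) ^ m ∣ c' g - c g := by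
  induction m generalizing c with
  | zero => exact ⟨0, ⟨IsLocallyConstant.const 0, by simp⟩, by simp⟩
  | succ m ih =>
    have hχ : (fun g => PadicInt.toZMod (c g)) ∈ Z1 (trivInt ℓ G) := by
      refine mem_Z1_trivInt.2 ⟨hc.1.comp _, fun g h => ?_⟩
      have h2 : (ℓ : ℤ_[ℓ]) ∣ c g + c h - c (g * h) := by
        have h3 := (dvd_pow_self (ℓ : ℤ_[ℓ]) m.succ_ne_zero).trans (hc.2 g h)
        have h4 := dvd_sub h3 ((h1 g).mul_right (c h))
        convert h4 using 1
        ring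
      rw [← PadicInt.toZMod_eq_zero_iff_dvd, map_sub, map_add, sub_eq_zero] at h2
      exact h2.symm
    obtain ⟨c₁, hc₁, hc₁χ⟩ := hθ _ hχ
    have hc₁' : IsCrossedMod θ (m + 1) c₁ :=
      ⟨hc₁.1, fun g h => (pow_dvd_pow _ hmn).trans (hc₁.2 g h)⟩
    obtain ⟨d, hd, hcd⟩ := (hc.sub hc₁').exists_eq_mul fun g => by
      rw [← PadicInt.toZMod_eq_zero_iff_dvd, Pi.sub_apply, map_sub, hc₁χ, sub_self]
    obtain ⟨d', hd', hdd⟩ := ih (by omega) hd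
    refine ⟨fun g => c₁ g + ℓ * d' g, ⟨hc₁.1.add ((IsLocallyConstant.const _).mul hd'.1),
      fun g h => ?_⟩,
        fun g => ?_⟩
    · have := dvd_add (hc₁.2 g h) ((hd'.2 g h).mul_left ℓ)
      convert this using 1
      ring
    · have h2 : c g = c₁ g + ℓ * d g := by
        rw [← hcd g, Pi.sub_apply]; ring
      rw [h2, pow_succ']
      convert mul_dvd_mul_left (ℓ : ℤ_[ℓ]) (hdd g) using 1
      ring

/-- `θ` is a homomorphism modulo `ℓ ^ n`, trivial modulo `ℓ`, and every homomorphism `G → 𝔽_ℓ`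
lifts to `ℤ_ℓ / ℓ ^ n` with `G` acting through `θ`. -/
structure IsKummerMod (θ : G → ℤ_[ℓ]) (n : ℕ) : Prop where
  locConst : IsLocallyConstant θ
  mul : ∀ g h, (ℓ : ℤ_[ℓ]) ^ n ∣ θ g * θ h - θ (g * h)
  one : ∀ g, (ℓ : ℤ_[ℓ]) ∣ θ g - 1
  lifts : LiftsMod θ n

lemma IsKummerMod.of_one : IsKummerMod (fun _ : G => (1 : ℤ_[ℓ])) 1 where
  locConst := IsLocallyConstant.const 1
  mul := by simp
  one := by simp
  lifts χ hχ := by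
    refine ⟨fun g => liftZMod ℓ (χ g), ⟨hχ.1.comp (liftZMod ℓ), fun g h => ?_⟩, by simp⟩
    rw [pow_one, ← PadicInt.toZMod_eq_zero_iff_dvd]
    simp [(mem_Z1_trivInt.1 hχ).2]

lemma IsKummerMod.congr {θ θ' : G → ℤ_[ℓ]} {n : ℕ} (hn : 1 ≤ n) (hθ : IsKummerMod θ n)
    (hθ' : IsLocallyConstant θ') (h : ∀ g, (ℓ : ℤ_[ℓ]) ^ n ∣ θ' g - θ g) : IsKummerMod θ' n where
  locConst := hθ'
  mul g j := by
    have := dvd_sub (dvd_add (dvd_add (hθ.mul g j) ((h g).mul_right (θ' j)))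
      ((h j).mul_left (θ g))) (h (g * j))
    convert this using 1
    ring
  one g := by
    have := dvd_add ((dvd_pow_self (ℓ : ℤ_[ℓ]) (by omega)).trans (h g)) (hθ.one g)
    convert this using 1
    ring
  lifts χ hχ := by
    obtain ⟨c, hc, hcχ⟩ := hθ.lifts χ hχ
    exact ⟨c, hc.congr h, hcχ⟩

/-- The crossed homomorphism `θ - 1` is divisible by `ℓ`; lifting `(θ - 1) / ℓ` gives a lift
of `θ` to a homomorphism modulo `ℓ ^ (n + 1)`. -/
lemma IsKummerMod.exists_mul_succ {θ : G → ℤ_[ℓ]} {n : ℕ} (hn : 1 ≤ n) (hθ : IsKummerMod θ n) :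
    ∃ θ' : G → ℤ_[ℓ], IsLocallyConstant θ' ∧
      (∀ g h, (ℓ : ℤ_[ℓ]) ^ (n + 1) ∣ θ' g * θ' h - θ' (g * h)) ∧
      ∀ g, (ℓ : ℤ_[ℓ]) ^ n ∣ θ' g - θ g := by
  obtain ⟨m, rfl⟩ : ∃ m, n = m + 1 := ⟨n - 1, by omega⟩
  have hc : IsCrossedMod θ (m + 1) fun g => θ g - 1 :=
    ⟨hθ.locConst.sub (IsLocallyConstant.const 1), fun g h => by
      convert hθ.mul g h using 1
      ring⟩
  obtain ⟨d, hd, hcd⟩ := hc.exists_eq_mul hθ.one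
  obtain ⟨d', hd', hdd⟩ := hθ.lifts.exists_lift hθ.one (Nat.le_succ m) hd
  have hcongr : ∀ g, (ℓ : ℤ_[ℓ]) ^ (m + 1) ∣ (1 + ℓ * d' g) - θ g := fun g => by
    rw [pow_succ']
    convert mul_dvd_mul_left (ℓ : ℤ_[ℓ]) (hdd g) using 1
    rw [mul_sub, ← hcd]
    ring
  refine ⟨fun g => 1 + ℓ * d' g,
    (IsLocallyConstant.const 1).add ((IsLocallyConstant.const _).mul hd'.1), fun g h => ?_, hcongr⟩
  have h2 := (hd'.congr hcongr).2 g h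
  rw [pow_succ']
  convert mul_dvd_mul_left (ℓ : ℤ_[ℓ]) h2 using 1
  ring

/-- The obstruction to lifting a crossed homomorphism modulo `ℓ ^ n` to one modulo
`ℓ ^ (n + 1)`. -/
noncomputable def liftObstruction (θ : G → ℤ_[ℓ]) (n : ℕ) (c : G → ℤ_[ℓ]) (p : G × G) : ZMod ℓ :=
  PadicInt.toZMod (divPow n (c p.1 + θ p.1 * c p.2 - c (p.1 * p.2)))

lemma liftObstruction_eq {θ : G → ℤ_[ℓ]} {n : ℕ} {c : G → ℤ_[ℓ]} {g h : G} {y : ℤ_[ℓ]}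
    (hy : c g + θ g * c h - c (g * h) = (ℓ : ℤ_[ℓ]) ^ n * y) :
    liftObstruction θ n c (g, h) = PadicInt.toZMod y := by
  rw [liftObstruction]
  simp only [hy, divPow_pow_mul]

lemma toZMod_eq_one {x : ℤ_[ℓ]} (h : (ℓ : ℤ_[ℓ]) ∣ x - 1) : PadicInt.toZMod x = 1 := by
  rwa [← PadicInt.toZMod_eq_zero_iff_dvd, map_sub, map_one, sub_eq_zero] at h

variable [IsTopologicalGroup G]

lemma liftObstruction_mem {θ : G → ℤ_[ℓ]} {n : ℕ} (hθ : IsKummerMod θ n)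
    (hmul : ∀ g h, (ℓ : ℤ_[ℓ]) ^ (n + 1) ∣ θ g * θ h - θ (g * h)) {c : G → ℤ_[ℓ]}
    (hc : IsCrossedMod θ n c) : liftObstruction θ n c ∈ Z2 (trivInt ℓ G) := by
  refine mem_Z2_trivInt.2 ⟨?_, fun g h j => ?_⟩
  · have h1 : IsLocallyConstant fun p : G × G => c p.1 + θ p.1 * c p.2 - c (p.1 * p.2) :=
      ((hc.1.comp_continuous continuous_fst).add
        ((hθ.locConst.comp_continuous continuous_fst).mul
          (hc.1.comp_continuous continuous_snd))).sub
        (hc.1.comp_continuous continuous_mul)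
    exact h1.comp fun x => PadicInt.toZMod (divPow n x)
  · obtain ⟨e₁, he₁⟩ := hc.2 h j
    obtain ⟨e₂, he₂⟩ := hc.2 (g * h) j
    obtain ⟨e₃, he₃⟩ := hc.2 g (h * j)
    obtain ⟨e₄, he₄⟩ := hc.2 g h
    rw [liftObstruction_eq he₁, liftObstruction_eq he₂, liftObstruction_eq he₃,
      liftObstruction_eq he₄]
    have h1 : PadicInt.toZMod (θ g) = 1 := toZMod_eq_one (hθ.one g)
    have h2 : (ℓ : ℤ_[ℓ]) ∣ θ g * e₁ - e₂ + e₃ - e₄ := by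
      refine (mul_dvd_mul_iff_left (PadicInt.pow_prime_ne_zero (ℓ := ℓ) n)).1 ?_
      rw [← pow_succ]
      convert (hmul g h).mul_right (c j) using 1
      rw [mul_assoc] at he₂
      linear_combination -θ g * he₁ + he₂ - he₃ + he₄
    rw [← PadicInt.toZMod_eq_zero_iff_dvd] at h2
    simpa [h1] using h2

lemma liftObstruction_sub {θ : G → ℤ_[ℓ]} {n : ℕ} {c d : G → ℤ_[ℓ]} (hc : IsCrossedMod θ n c)
    (hd : IsCrossedMod θ n d) :
    liftObstruction θ n (c - d) = liftObstruction θ n c - liftObstruction θ n d := by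
  ext ⟨g, h⟩
  obtain ⟨e₁, he₁⟩ := hc.2 g h
  obtain ⟨e₂, he₂⟩ := hd.2 g h
  rw [Pi.sub_apply, liftObstruction_eq he₁, liftObstruction_eq he₂, ← map_sub]
  apply liftObstruction_eq
  simp only [Pi.sub_apply]
  linear_combination he₁ - he₂

lemma liftObstruction_add {θ : G → ℤ_[ℓ]} {n : ℕ} {c d : G → ℤ_[ℓ]} (hc : IsCrossedMod θ n c)
    (hd : IsCrossedMod θ n d) :
    liftObstruction θ n (c + d) = liftObstruction θ n c + liftObstruction θ n d := by
  ext ⟨g, h⟩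
  obtain ⟨e₁, he₁⟩ := hc.2 g h
  obtain ⟨e₂, he₂⟩ := hd.2 g h
  rw [Pi.add_apply, liftObstruction_eq he₁, liftObstruction_eq he₂, ← map_add]
  apply liftObstruction_eq
  simp only [Pi.add_apply]
  linear_combination he₁ + he₂

/-- The obstruction class of a crossed homomorphism that vanishes modulo `ℓ` is trivial. -/
lemma exists_diffOne_eq_liftObstruction {θ : G → ℤ_[ℓ]} {n : ℕ} (hn : 1 ≤ n)
    (hθ : IsKummerMod θ n) {c : G → ℤ_[ℓ]} (hc : IsCrossedMod θ n c)
    (h0 : ∀ g, (ℓ : ℤ_[ℓ]) ∣ c g) :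
    ∃ b : G → ZMod ℓ, IsLocallyConstant b ∧
      diffOne (trivInt ℓ G) b = liftObstruction θ n c := by
  obtain ⟨m, rfl⟩ : ∃ m, n = m + 1 := ⟨n - 1, by omega⟩
  obtain ⟨d, hd, hcd⟩ := hc.exists_eq_mul h0
  obtain ⟨d', hd', hdd⟩ := hθ.lifts.exists_lift hθ.one (Nat.le_succ m) hd
  set y : G → ℤ_[ℓ] := fun g => divPow m (d' g - d g) with hy
  have hy' : ∀ g, d g = d' g - (ℓ : ℤ_[ℓ]) ^ m * y g := fun g => by
    rw [hy, pow_mul_divPow (hdd g)]; ring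
  have hylc : IsLocallyConstant y := (hd'.1.sub hd.1).comp (divPow m)
  refine ⟨fun g => -PadicInt.toZMod (y g), hylc.comp fun x => -PadicInt.toZMod x, ?_⟩
  ext ⟨g, h⟩
  obtain ⟨e, he⟩ := hd'.2 g h
  rw [liftObstruction_eq (y := (ℓ : ℤ_[ℓ]) * e - (y g + θ g * y h - y (g * h)))]
  · have h1 : PadicInt.toZMod (θ g) = 1 := toZMod_eq_one (hθ.one g)
    rw [diffOne_trivInt]
    simp [h1]
    ring
  · rw [hcd, hcd, hcd, hy', hy', hy']
    linear_combination ℓ * he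

/-- Passage from `ℓ ^ n` to `ℓ ^ (n + 1)`: the obstructions to lifting the homomorphisms
`χ : G → 𝔽_ℓ` define a functional on `H¹(G, 𝔽_ℓ)`. Replacing `θ` by `θ (1 + ℓ ^ n α)` changes it
by `χ ↦ α ∪ χ`, so a suitable `α` kills it. -/
lemma IsKummerMod.exists_succ {τ : Z2 (trivInt ℓ G) →+ ZMod ℓ}
    (hτ : ∀ z, τ z = 0 ↔
      ∃ b : G → ZMod ℓ, IsLocallyConstant b ∧ diffOne (trivInt ℓ G) b = z.1)
    (hcup : ∀ e : Z1 (trivInt ℓ G) →+ ZMod ℓ, ∃ α, ∀ χ, τ (cup11 α χ) = e χ)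
    {θ : G → ℤ_[ℓ]} {n : ℕ} (hn : 1 ≤ n) (hθ : IsKummerMod θ n) :
    ∃ θ' : G → ℤ_[ℓ], IsKummerMod θ' (n + 1) ∧ ∀ g, (ℓ : ℤ_[ℓ]) ^ n ∣ θ' g - θ g := by
  obtain ⟨θ₁, hlc₁, hmul, hθθ₁⟩ := hθ.exists_mul_succ hn
  have hθ₁ : IsKummerMod θ₁ n := hθ.congr hn hlc₁ hθθ₁
  choose c hc hcχ using fun χ : Z1 (trivInt ℓ G) => hθ₁.lifts χ.1 χ.2
  let o (χ : Z1 (trivInt ℓ G)) : Z2 (trivInt ℓ G) :=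
    ⟨liftObstruction θ₁ n (c χ), liftObstruction_mem hθ₁ hmul (hc χ)⟩
  have hadd : ∀ χ ψ, τ (o (χ + ψ)) = τ (o χ) + τ (o ψ) := fun χ ψ => by
    rw [← map_add, ← sub_eq_zero, ← map_sub, hτ]
    have hd := (hc (χ + ψ)).sub ((hc χ).add (hc ψ))
    obtain ⟨b, hb, hbd⟩ := exists_diffOne_eq_liftObstruction hn hθ₁ hd fun g => by
      rw [← PadicInt.toZMod_eq_zero_iff_dvd]
      simp [hcχ]
    refine ⟨b, hb, hbd.trans ?_⟩
    rw [liftObstruction_sub (hc _) ((hc _).add (hc _)), liftObstruction_add (hc _) (hc _)]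
    rfl
  obtain ⟨α, hα⟩ := hcup (-AddMonoidHom.mk' (fun χ => τ (o χ)) hadd)
  have hα' : ∀ χ, τ (o χ + cup11 α χ) = 0 := fun χ => by
    rw [map_add, hα]
    simp
  let a : G → ℤ_[ℓ] := fun g => liftZMod ℓ (α.1 g)
  have hlca : IsLocallyConstant a := α.2.1.comp (liftZMod ℓ)
  have haz : ∀ g, PadicInt.toZMod (a g) = α.1 g := fun g => toZMod_liftZMod _
  let θ₂ : G → ℤ_[ℓ] := fun g => θ₁ g * (1 + (ℓ : ℤ_[ℓ]) ^ n * a g)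
  have hθ₂θ₁ : ∀ g, (ℓ : ℤ_[ℓ]) ^ n ∣ θ₂ g - θ₁ g := fun g => ⟨θ₁ g * a g, by
    simp only [θ₂]; ring⟩
  have hlc₂ : IsLocallyConstant θ₂ := hθ₁.locConst.mul
    ((IsLocallyConstant.const 1).add ((IsLocallyConstant.const _).mul hlca))
  have hθ₂ : IsKummerMod θ₂ n := hθ₁.congr hn hlc₂ hθ₂θ₁
  refine ⟨θ₂, ⟨hlc₂, fun g h => ?_, hθ₂.one, fun χ hχ => ?_⟩, fun g => ?_⟩
  · have h1 : (ℓ : ℤ_[ℓ]) ∣ a g + a h - a (g * h) := by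
      rw [← PadicInt.toZMod_eq_zero_iff_dvd]
      simp [haz, (mem_Z1_trivInt.1 α.2).2]
    have h2 : (ℓ : ℤ_[ℓ]) ^ (n + 1) ∣ (ℓ : ℤ_[ℓ]) ^ n * (a g + a h - a (g * h)) := by
      rw [pow_succ]
      exact mul_dvd_mul_left _ h1
    have h3 : (ℓ : ℤ_[ℓ]) ^ (n + 1) ∣ (ℓ : ℤ_[ℓ]) ^ n * (ℓ : ℤ_[ℓ]) ^ n := by
      rw [← pow_add]
      exact pow_dvd_pow _ (by omega)
    have h4 := dvd_add ((dvd_add h2 (h3.mul_right (a g * a h))).mul_left (θ₁ g * θ₁ h))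
      ((hmul g h).mul_right (1 + (ℓ : ℤ_[ℓ]) ^ n * a (g * h)))
    convert h4 using 1
    simp only [θ₂]
    ring
  · obtain ⟨b, hb, hbo⟩ := (hτ _).1 (hα' ⟨χ, hχ⟩)
    set c₀ := c ⟨χ, hχ⟩ with hc₀
    refine ⟨fun g => c₀ g - (ℓ : ℤ_[ℓ]) ^ n * liftZMod ℓ (b g),
      ⟨(hc _).1.sub ((IsLocallyConstant.const _).mul (hb.comp (liftZMod ℓ))), fun g h => ?_⟩, fun g => ?_⟩
    · obtain ⟨e, he⟩ := (hc ⟨χ, hχ⟩).2 g h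
      have h1 : liftObstruction θ₁ n c₀ (g, h) = PadicInt.toZMod e := liftObstruction_eq he
      have h2 : b h - b (g * h) + b g = PadicInt.toZMod e + α.1 g * χ h := by
        rw [← h1, ← diffOne_trivInt]
        exact congrFun hbo (g, h)
      have h3 : (ℓ : ℤ_[ℓ]) ∣ e + θ₁ g * a g * c₀ h -
          (liftZMod ℓ (b g) + θ₂ g * liftZMod ℓ (b h) - liftZMod ℓ (b (g * h))) := by
        rw [← PadicInt.toZMod_eq_zero_iff_dvd]
        simp only [map_sub, map_add, map_mul, toZMod_liftZMod, haz, toZMod_eq_one (hθ₂.one g),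
          toZMod_eq_one (hθ₁.one g), hc₀, hcχ]
        linear_combination -h2
      rw [pow_succ]
      convert mul_dvd_mul_left ((ℓ : ℤ_[ℓ]) ^ n) h3 using 1
      simp only [θ₂]
      linear_combination he
    · have : (PadicInt.toZMod : ℤ_[ℓ] →+* ZMod ℓ) ((ℓ : ℤ_[ℓ]) ^ n) = 0 := by
        rw [PadicInt.toZMod_eq_zero_iff_dvd]
        exact dvd_pow_self _ (by omega)
      rw [map_sub, map_mul, this, zero_mul, sub_zero, hcχ]
  · have := dvd_add (hθ₂θ₁ g) (hθθ₁ g)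
    convert this using 1
    ring

end Approx

/-! ### The limit of the approximations -/

section Limit

variable {ℓ : ℕ} [Fact ℓ.Prime]

lemma PadicInt.eq_zero_of_forall_pow_dvd {x : ℤ_[ℓ]} (h : ∀ n : ℕ, (ℓ : ℤ_[ℓ]) ^ n ∣ x) :
    x = 0 := by
  refine PadicInt.ext_of_toZModPow.1 fun n => ?_
  rw [map_zero, ← RingHom.mem_ker, PadicInt.ker_toZModPow, Ideal.mem_span_singleton]
  exact h n

lemma PadicInt.exists_forall_pow_dvd_sub (x : ℕ → ℤ_[ℓ])
    (hx : ∀ n, (ℓ : ℤ_[ℓ]) ^ n ∣ x (n + 1) - x n) : ∃ y, ∀ n, (ℓ : ℤ_[ℓ]) ^ n ∣ y - x n := by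
  have h1 : ∀ m k, (ℓ : ℤ_[ℓ]) ^ m ∣ x (m + k) - x m := by
    intro m k
    induction k with
    | zero => simp
    | succ k ih =>
      have := dvd_add ((pow_dvd_pow _ (Nat.le_add_right m k)).trans (hx (m + k))) ih
      rwa [sub_add_sub_cancel] at this
  obtain ⟨y, hy⟩ := IsPrecomplete.prec' (I := IsLocalRing.maximalIdeal ℤ_[ℓ]) (M := ℤ_[ℓ]) x
    (by
      intro m n hmn
      obtain ⟨k, rfl⟩ := Nat.exists_eq_add_of_le hmn
      simp only [← Ideal.one_eq_top, smul_eq_mul, mul_one, SModEq.sub_mem,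
        PadicInt.maximalIdeal_eq_span_p, Ideal.span_singleton_pow, Ideal.mem_span_singleton]
      rw [← dvd_neg, neg_sub]
      exact h1 m k)
  refine ⟨y, fun n => ?_⟩
  have := hy n
  simp only [← Ideal.one_eq_top, smul_eq_mul, mul_one, SModEq.sub_mem,
        PadicInt.maximalIdeal_eq_span_p, Ideal.span_singleton_pow, Ideal.mem_span_singleton] at this
  rwa [← dvd_neg, neg_sub]

lemma PadicInt.isOpen_setOf_pow_dvd (n : ℕ) : IsOpen {y : ℤ_[ℓ] | (ℓ : ℤ_[ℓ]) ^ n ∣ y} := by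
  have : {y : ℤ_[ℓ] | (ℓ : ℤ_[ℓ]) ^ n ∣ y} =
      {y : ℤ_[ℓ] | ‖y‖ < (ℓ : ℝ) ^ (-n + 1 : ℤ)} := by
    ext y
    rw [Set.mem_ofPred_eq, Set.mem_ofPred_eq, ← PadicInt.norm_le_pow_iff_norm_lt_pow_add_one,
      PadicInt.norm_le_pow_iff_mem_span_pow, Ideal.mem_span_singleton]
  rw [this]
  exact isOpen_lt continuous_norm continuous_const

/-- A map to `ℤ_ℓ` that is locally constant modulo every power of `ℓ` is continuous. -/
lemma PadicInt.continuous_of_forall {X : Type*} [TopologicalSpace X] {f : X → ℤ_[ℓ]}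
    (h : ∀ (n : ℕ) (x : X), ∀ᶠ y in 𝓝 x, (ℓ : ℤ_[ℓ]) ^ n ∣ f y - f x) : Continuous f := by
  rw [continuous_iff_continuousAt]
  intro x
  rw [ContinuousAt, Metric.tendsto_nhds]
  intro ε hε
  obtain ⟨n, hn⟩ := PadicInt.exists_pow_neg_lt ℓ hε
  filter_upwards [h n x] with y hy
  rw [dist_eq_norm]
  refine lt_of_le_of_lt ?_ hn
  rwa [PadicInt.norm_le_pow_iff_mem_span_pow, Ideal.mem_span_singleton]

variable {G : Type u} [Group G] [TopologicalSpace G] [IsTopologicalGroup G]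

/-- A Demushkin group has an orientation for which all homomorphisms to `𝔽_ℓ` lift to crossed
homomorphisms modulo all powers of `ℓ`. -/
lemma IsDemushkin.exists_liftsMod (hG : IsDemushkin ℓ G) :
    ∃ θ : G →ₜ* ℤ_[ℓ]ˣ, (∀ g, (ℓ : ℤ_[ℓ]) ∣ (θ g : ℤ_[ℓ]) - 1) ∧
      ∀ n, LiftsMod (fun g => (θ g : ℤ_[ℓ])) n := by
  obtain ⟨τ, -, hτ, -, hcup⟩ := hG.exists_functional
  let step (n : ℕ) (θ : {θ : G → ℤ_[ℓ] // IsKummerMod θ (n + 1)}) :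
      {θ : G → ℤ_[ℓ] // IsKummerMod θ (n + 1 + 1)} :=
    ⟨(θ.2.exists_succ hτ hcup (by omega)).choose,
      (θ.2.exists_succ hτ hcup (by omega)).choose_spec.1⟩
  let t (n : ℕ) : {θ : G → ℤ_[ℓ] // IsKummerMod θ (n + 1)} :=
    Nat.rec ⟨fun _ => 1, IsKummerMod.of_one⟩ step n
  have ht : ∀ n g, (ℓ : ℤ_[ℓ]) ^ n ∣ (t (n + 1)).1 g - (t n).1 g := fun n g =>
    (pow_dvd_pow _ n.le_succ).trans
      (((t n).2.exists_succ hτ hcup (by omega)).choose_spec.2 g)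
  choose f hf using fun g => PadicInt.exists_forall_pow_dvd_sub (fun n => (t n).1 g)
    fun n => ht n g
  have hone : ∀ g, (ℓ : ℤ_[ℓ]) ∣ f g - 1 := fun g => by
    have h1 := hf g 1
    rw [pow_one] at h1
    have := dvd_add h1 ((t 1).2.one g)
    rwa [sub_add_sub_cancel] at this
  have hmul : ∀ g h, f (g * h) = f g * f h := fun g h => by
    rw [← sub_eq_zero, ← neg_eq_zero, neg_sub]
    refine PadicInt.eq_zero_of_forall_pow_dvd fun n => ?_
    have h1 := (pow_dvd_pow _ n.le_succ).trans ((t n).2.mul g h)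
    have := dvd_add (dvd_add ((hf g n).mul_right (f h)) ((hf h n).mul_left ((t n).1 g)))
      (dvd_sub h1 (hf (g * h) n))
    convert this using 1
    ring
  have h1 : f 1 = 1 := by
    have h2 := hmul 1 1
    rw [mul_one] at h2
    have h3 : IsUnit (f 1) := by
      by_contra h4
      have h5 : f 1 ∈ nonunits ℤ_[ℓ] := h4
      rw [PadicInt.mem_nonunits, PadicInt.norm_lt_one_iff_dvd] at h5
      have h6 := dvd_sub h5 (hone 1)
      rw [sub_sub_cancel] at h6
      exact PadicInt.prime_p.not_isUnit (isUnit_of_dvd_one h6)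
    exact (h3.mul_eq_left.1 h2.symm)
  have hcont : Continuous f := PadicInt.continuous_of_forall fun n x => by
    filter_upwards [(IsLocallyConstant.iff_eventually_eq _).1 (t n).2.locConst x] with y hy
    have := dvd_sub (hf y n) (hf x n)
    rw [hy] at this
    convert this using 1
    ring
  let F : G →* ℤ_[ℓ] := ⟨⟨f, h1⟩, hmul⟩
  refine ⟨⟨F.toHomUnits, Units.continuous_iff.2 ⟨hcont, ?_⟩⟩, hone, fun n χ hχ => ?_⟩
  · exact hcont.comp continuous_inv
  · obtain ⟨c, hc, hcχ⟩ := (t n).2.lifts χ hχ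
    refine ⟨c, ?_, hcχ⟩
    have h2 : IsCrossedMod (t n).1 n c :=
      ⟨hc.1, fun g h => (pow_dvd_pow _ n.le_succ).trans (hc.2 g h)⟩
    exact h2.congr fun g => hf g n

end Limit

/-! ### The group `ℚ_ℓ / ℤ_ℓ` -/

namespace PadicQuot

variable {ℓ : ℕ} [Fact ℓ.Prime]

/-- The class of `x / ℓ ^ n` in `ℚ_ℓ / ℤ_ℓ`. -/
noncomputable def frac (n : ℕ) : ℤ_[ℓ] →+ PadicQuot ℓ where
  toFun x := Submodule.Quotient.mk ((x : ℚ_[ℓ]) / (ℓ : ℚ_[ℓ]) ^ n)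
  map_zero' := by simp
  map_add' x y := by
    rw [← Submodule.Quotient.mk_add, PadicInt.coe_add, add_div]

lemma frac_apply (n : ℕ) (x : ℤ_[ℓ]) :
    frac n x = Submodule.Quotient.mk ((x : ℚ_[ℓ]) / (ℓ : ℚ_[ℓ]) ^ n) := rfl

lemma cast_pow_ne_zero (n : ℕ) : (ℓ : ℚ_[ℓ]) ^ n ≠ 0 :=
  pow_ne_zero _ (Nat.cast_ne_zero.2 (Fact.out : ℓ.Prime).ne_zero)

lemma frac_eq_zero_iff {n : ℕ} {x : ℤ_[ℓ]} : frac n x = 0 ↔ (ℓ : ℤ_[ℓ]) ^ n ∣ x := by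
  rw [frac_apply, Submodule.Quotient.mk_eq_zero, LinearMap.mem_range]
  refine exists_congr fun y => ?_
  rw [Algebra.linearMap_apply, eq_div_iff (cast_pow_ne_zero n), eq_comm, mul_comm]
  refine Iff.trans ?_ (Subtype.ext_iff (a1 := x) (a2 := (ℓ : ℤ_[ℓ]) ^ n * y)).symm
  rw [PadicInt.coe_mul, PadicInt.coe_pow, PadicInt.coe_natCast]
  exact Iff.rfl

lemma frac_add_mul (n m : ℕ) (x : ℤ_[ℓ]) : frac (n + m) ((ℓ : ℤ_[ℓ]) ^ m * x) = frac n x := by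
  rw [frac_apply, frac_apply]
  congr 1
  push_cast
  rw [pow_add]
  field_simp [cast_pow_ne_zero (ℓ := ℓ) n, cast_pow_ne_zero (ℓ := ℓ) m]

lemma smul_frac (n : ℕ) (u x : ℤ_[ℓ]) : u • frac n x = frac n (u * x) := by
  rw [frac_apply, frac_apply, ← Submodule.Quotient.mk_smul, Algebra.smul_def]
  congr 1
  push_cast
  rw [mul_div_assoc]
  rfl

lemma exists_eq_frac (a : PadicQuot ℓ) : ∃ (n : ℕ) (x : ℤ_[ℓ]), frac n x = a := by
  obtain ⟨y, rfl⟩ := Submodule.Quotient.mk_surjective _ a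
  obtain ⟨n, hn⟩ := PadicInt.exists_pow_neg_lt ℓ (ε := (‖y‖ + 1)⁻¹) (by positivity)
  have hy : ‖y * (ℓ : ℚ_[ℓ]) ^ n‖ ≤ 1 := by
    rw [norm_mul, Padic.norm_p_pow]
    calc ‖y‖ * (ℓ : ℝ) ^ (-n : ℤ) ≤ (‖y‖ + 1) * (‖y‖ + 1)⁻¹ := by
          gcongr
          linarith
      _ = 1 := mul_inv_cancel₀ (by positivity)
  let x : ℤ_[ℓ] := ⟨_, hy⟩
  refine ⟨n, x, congrArg Submodule.Quotient.mk ?_⟩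
  exact mul_div_cancel_right₀ _ (cast_pow_ne_zero n)

lemma exists_eq_frac_of_pow_nsmul {n : ℕ} {a : PadicQuot ℓ} (ha : ℓ ^ n • a = 0) :
    ∃ x, frac n x = a := by
  obtain ⟨m, x, rfl⟩ := exists_eq_frac a
  rw [← map_nsmul, frac_eq_zero_iff, nsmul_eq_mul, Nat.cast_pow] at ha
  refine ⟨divPow m ((ℓ : ℤ_[ℓ]) ^ n * x), ?_⟩
  rw [← frac_add_mul n m, pow_mul_divPow ha, add_comm, frac_add_mul]

lemma pow_nsmul_frac (n : ℕ) (x : ℤ_[ℓ]) : ℓ ^ n • frac n x = 0 := by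
  rw [← map_nsmul, frac_eq_zero_iff, nsmul_eq_mul, Nat.cast_pow]
  exact dvd_mul_right _ _

lemma exists_pow_nsmul_eq_zero (a : PadicQuot ℓ) : ∃ n : ℕ, ℓ ^ n • a = 0 := by
  obtain ⟨n, x, rfl⟩ := exists_eq_frac a
  exact ⟨n, pow_nsmul_frac n x⟩

/-- The embedding of `𝔽_ℓ` into `ℚ_ℓ / ℤ_ℓ`. -/
noncomputable def ofZMod (ℓ : ℕ) [Fact ℓ.Prime] : ZMod ℓ →+ PadicQuot ℓ where
  toFun x := frac 1 (liftZMod ℓ x)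
  map_zero' := by simp [liftZMod]
  map_add' x y := by
    rw [← map_add, ← sub_eq_zero, ← map_sub, frac_eq_zero_iff, pow_one,
      ← PadicInt.toZMod_eq_zero_iff_dvd]
    simp

lemma ofZMod_toZMod (x : ℤ_[ℓ]) : ofZMod ℓ (PadicInt.toZMod x) = frac 1 x := by
  change frac 1 _ = _
  rw [← sub_eq_zero, ← map_sub, frac_eq_zero_iff, pow_one,
      ← PadicInt.toZMod_eq_zero_iff_dvd]
  simp

lemma ofZMod_injective : Function.Injective (ofZMod ℓ) := by
  rw [injective_iff_map_eq_zero]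
  intro x hx
  rw [← toZMod_liftZMod x, ofZMod_toZMod, frac_eq_zero_iff, pow_one,
    ← PadicInt.toZMod_eq_zero_iff_dvd, toZMod_liftZMod] at hx
  exact hx

lemma exists_ofZMod_eq {a : PadicQuot ℓ} (ha : ℓ • a = 0) : ∃ x, ofZMod ℓ x = a := by
  obtain ⟨x, rfl⟩ := exists_eq_frac_of_pow_nsmul (n := 1) (by simpa using ha)
  exact ⟨_, ofZMod_toZMod x⟩

lemma nsmul_ofZMod (x : ZMod ℓ) : ℓ • ofZMod ℓ x = 0 := by
  rw [← map_nsmul]; simp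

/-- `ℓ`-adic integers that are congruent to `1` modulo `ℓ` act trivially on elements of
order `ℓ`. -/
lemma smul_eq_self {u : ℤ_[ℓ]} (hu : (ℓ : ℤ_[ℓ]) ∣ u - 1) {a : PadicQuot ℓ} (ha : ℓ • a = 0) :
    u • a = a := by
  obtain ⟨v, hv⟩ := hu
  have : u = 1 + v * (ℓ : ℕ) := by linear_combination hv
  rw [this, add_smul, one_smul, mul_smul, Nat.cast_smul_eq_nsmul, ha, smul_zero, add_zero]

/-- `ℚ_ℓ / ℤ_ℓ` is divisible, so homomorphisms to it extend. -/
lemma exists_extend {A B : Type*} [AddCommGroup A] [AddCommGroup B] (j : A →+ B)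
    (hj : Function.Injective j) (f : A →+ PadicQuot ℓ) : ∃ F : B →+ PadicQuot ℓ, F.comp j = f := by
  let : DivisibleBy (PadicQuot ℓ) ℤ := Function.Surjective.divisibleBy
    (Submodule.Quotient.mk : ℚ_[ℓ] → PadicQuot ℓ) (Submodule.Quotient.mk_surjective _)
    fun _ _ => rfl
  exact (Module.Baer.of_divisible (PadicQuot ℓ)).extension_property_addMonoidHom j hj f

variable {G : Type u} [Group G] [TopologicalSpace G]

lemma isDiscreteRep (θ : G →ₜ* ℤ_[ℓ]ˣ) : IsDiscreteRep (twist θ (PadicQuot ℓ)) := by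
  intro a
  obtain ⟨n, x, rfl⟩ := exists_eq_frac a
  have : {g : G | twist θ (PadicQuot ℓ) g (frac n x) = frac n x} =
      (fun g => ((θ g : ℤ_[ℓ]) - 1) * x) ⁻¹' {y | (ℓ : ℤ_[ℓ]) ^ n ∣ y} := by
    ext g
    rw [Set.mem_ofPred_eq, Set.mem_preimage, Set.mem_ofPred_eq, twist_apply, smul_frac,
      ← sub_eq_zero, ← map_sub, frac_eq_zero_iff, sub_mul, one_mul]
  rw [this]
  refine (PadicInt.isOpen_setOf_pow_dvd n).preimage ?_
  have : Continuous fun g => (θ g : ℤ_[ℓ]) := Units.continuous_val.comp θ.continuous_toFun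
  fun_prop

end PadicQuot

/-! ### Duality for finite modules -/

section Extension

/-- `ℚ / ℤ` is divisible: a character of `M` that vanishes on the kernel of `f : M → N` factors
through `f`. -/
lemma AddCircle.exists_comp_eq {M N : Type*} [AddCommGroup M] [AddCommGroup N] (f : M →+ N)
    (g : M →+ AddCircle (1 : ℚ)) (hfg : ∀ m, f m = 0 → g m = 0) :
    ∃ h : N →+ AddCircle (1 : ℚ), ∀ m, h (f m) = g m := by
  let g' : M ⧸ f.ker →+ AddCircle (1 : ℚ) := QuotientAddGroup.lift f.ker g hfg
  obtain ⟨h, hh⟩ := (Module.Baer.of_divisible (AddCircle (1 : ℚ))).extension_property_addMonoidHom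
    (QuotientAddGroup.kerLift f) (QuotientAddGroup.kerLift_injective f) g'
  exact ⟨h, fun m => DFunLike.congr_fun hh (m : M ⧸ f.ker)⟩

lemma AddMonoidHom.exists_lift_of_surjective {A B C : Type*} [AddCommGroup A] [AddCommGroup B]
    [AddCommGroup C] (p : A →+ B) (hp : Function.Surjective p) (f : A →+ C)
    (hf : ∀ a, p a = 0 → f a = 0) : ∃ h : B →+ C, ∀ a, h (p a) = f a :=
  ⟨p.liftOfSurjective hp ⟨f, hf⟩, fun a => AddMonoidHom.liftOfRightInverse_comp_apply _ _ _ _ a⟩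

end Extension

namespace ContCoh

section Discrete

variable {k : Type v} {G : Type u} {A : Type w} [CommRing k] [Group G] [TopologicalSpace G]
  [IsTopologicalGroup G] [AddCommGroup A] [Module k A] {ρ : Representation k G A}

lemma IsDiscreteRep.isLocallyConstant (hρ : IsDiscreteRep ρ) (a : A) :
    IsLocallyConstant fun g => ρ g a :=
  (isLocallyConstant_action hρ (X := Unit) (b := fun _ => a)
    (IsLocallyConstant.const a)).comp_continuous (f := fun g : G => (g, ())) (by fun_prop)

lemma IsDiscreteRep.of_surjective {B : Type*} [AddCommGroup B] [Module k B]
    {σ : Representation k G B} (hρ : IsDiscreteRep ρ) (p : Representation.IntertwiningMap ρ σ)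
    (hp : Function.Surjective p) : IsDiscreteRep σ := by
  intro b
  obtain ⟨a, rfl⟩ := hp b
  have := (hρ.isLocallyConstant a).comp p
  convert this.isOpen_fiber (p a) using 1
  ext g
  rw [Set.mem_ofPred_eq, Set.mem_ofPred_eq, ← p.isIntertwining]
  rfl

end Discrete

section Pairing

variable {ℓ : ℕ} [Fact ℓ.Prime] {G : Type u} [Group G] [TopologicalSpace G]

/-- Duality between the cohomology of the `G`-module `A` and that of `Hom(A, I)`, where
`I = ℚ_ℓ / ℤ_ℓ` with the action through `θ`, with respect to a functional `J` on functions
`G × G → I`: every functional on `H²(G, A)` comes from a unique `G`-homomorphism `A → I`, and a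
class in `H¹(G, Hom(A, I))` whose cup product with `H¹(G, A)` is killed by `J` is trivial. A crossed
homomorphism `c` with values in `Hom(A, I)` is represented by `γ(g) = c(g) ∘ g`. -/
structure IsDualPair (θ : G →ₜ* ℤ_[ℓ]ˣ) (J : (G × G → PadicQuot ℓ) →+ AddCircle (1 : ℚ))
    {A : Type w} [AddCommGroup A] (ρ : Representation ℤ G A) : Prop where
  surj : ∀ Ψ : (G × G → A) →+ AddCircle (1 : ℚ),
    (∀ b, IsLocallyConstant b → Ψ (diffOne ρ b) = 0) →
    ∃ f : A →+ PadicQuot ℓ, (∀ g a, f (ρ g a) = (θ g : ℤ_[ℓ]) • f a) ∧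
      ∀ z ∈ Z2 ρ, Ψ z = J (f ∘ z)
  inj : ∀ f : A →+ PadicQuot ℓ, (∀ g a, f (ρ g a) = (θ g : ℤ_[ℓ]) • f a) →
    (∀ z ∈ Z2 ρ, J (f ∘ z) = 0) → f = 0
  one : ∀ γ : G → A →+ PadicQuot ℓ, (∀ a, IsLocallyConstant fun g => γ g a) →
    (∀ g h a, γ (g * h) a = γ g (ρ h a) + (θ g : ℤ_[ℓ]) • γ h a) →
    (∀ b ∈ Z1 ρ, J (fun p => γ p.1 (b p.2)) = 0) →
    ∃ f : A →+ PadicQuot ℓ, ∀ g a, γ g a = (θ g : ℤ_[ℓ]) • f a - f (ρ g a)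

/-- The coboundary of `f ∈ Hom(A, I)`. -/
noncomputable def homDiff (θ : G →ₜ* ℤ_[ℓ]ˣ) {A : Type w} [AddCommGroup A]
    (ρ : Representation ℤ G A) (f : A →+ PadicQuot ℓ) (g : G) : A →+ PadicQuot ℓ :=
  (twist θ (PadicQuot ℓ) g).toAddMonoidHom.comp f - f.comp (ρ g).toAddMonoidHom

section

variable {θ : G →ₜ* ℤ_[ℓ]ˣ} {A : Type w} [AddCommGroup A] {ρ : Representation ℤ G A}

lemma homDiff_apply (f : A →+ PadicQuot ℓ) (g : G) (a : A) :
    homDiff θ ρ f g a = (θ g : ℤ_[ℓ]) • f a - f (ρ g a) := rfl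

lemma homDiff_mul (f : A →+ PadicQuot ℓ) (g h : G) (a : A) :
    homDiff θ ρ f (g * h) a = homDiff θ ρ f g (ρ h a) + (θ g : ℤ_[ℓ]) • homDiff θ ρ f h a := by
  simp only [homDiff_apply, map_mul, Units.val_mul, mul_smul, smul_sub, Module.End.mul_apply]
  abel

/-- The Leibniz rule for the pairing of `Hom(A, I)` and `A`. -/
lemma homDiff_cup (f : A →+ PadicQuot ℓ) (b : G → A) :
    (fun p : G × G => homDiff θ ρ f p.1 (b p.2)) =
      diffOne (twist θ (PadicQuot ℓ)) (f ∘ b) - f ∘ diffOne ρ b := by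
  ext ⟨g, h⟩
  simp [homDiff_apply, diffOne_apply]

lemma homDiff_isLocallyConstant [IsTopologicalGroup G] (hρ : IsDiscreteRep ρ)
    (f : A →+ PadicQuot ℓ) (a : A) : IsLocallyConstant fun g => homDiff θ ρ f g a :=
  ((PadicQuot.isDiscreteRep θ).isLocallyConstant (f a)).sub
    ((hρ.isLocallyConstant a).comp f)

end

variable [IsTopologicalGroup G]
  {θ : G →ₜ* ℤ_[ℓ]ˣ} {J : (G × G → PadicQuot ℓ) →+ AddCircle (1 : ℚ)}
  {A B : Type w} [AddCommGroup A] [AddCommGroup B]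
  {ρ : Representation ℤ G A} {σ : Representation ℤ G B}
  (j : Representation.IntertwiningMap (trivInt ℓ G) ρ) (p : Representation.IntertwiningMap ρ σ)

/-- The data of an extension of a discrete `G`-module `B` by `𝔽_ℓ`. -/
structure IsShortExact : Prop where
  inj : Function.Injective j
  surj : Function.Surjective p
  zero : ∀ x, p (j x) = 0
  exact : ∀ a, p a = 0 → ∃ x, j x = a

variable {j p}

namespace IsShortExact

/-- A locally constant function that vanishes in `B` comes from `𝔽_ℓ`. -/
lemma exists_comp_eq (e : IsShortExact j p) {X : Type*} [TopologicalSpace X] {b : X → A}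
    (hb : IsLocallyConstant b) (h : ∀ x, p (b x) = 0) :
    ∃ y : X → ZMod ℓ, IsLocallyConstant y ∧ j ∘ y = b := by
  refine ⟨Function.invFun j ∘ b, hb.comp _, ?_⟩
  ext x
  exact Function.invFun_eq (e.exact _ (h x))

lemma exists_lift (e : IsShortExact j p) {X : Type*} [TopologicalSpace X] {b : X → B}
    (hb : IsLocallyConstant b) : ∃ y : X → A, IsLocallyConstant y ∧ p ∘ y = b :=
  ⟨Function.surjInv e.surj ∘ b, hb.comp _, by ext x; exact Function.surjInv_eq e.surj _⟩

/-- The connecting homomorphism `H¹(G, B) → H²(G, 𝔽_ℓ)`. -/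
lemma exists_connecting (e : IsShortExact j p) (hρ : IsDiscreteRep ρ) {b : G → A}
    (hb : IsLocallyConstant b) (hpb : p ∘ b ∈ Z1 σ) :
    ∃ z ∈ Z2 (trivInt ℓ G), j ∘ z = diffOne ρ b := by
  have hd := diffOne_mem_Z2 hρ hb
  obtain ⟨z, hz, hzb⟩ := e.exists_comp_eq hd.1 fun x => by
    rw [← Function.comp_apply (f := p), ← diffOne_comp, hpb.2, Pi.zero_apply]
  refine ⟨z, ⟨hz, ?_⟩, hzb⟩
  have h1 : j ∘ diffTwo (trivInt ℓ G) z = 0 := by rw [← diffTwo_comp, hzb, hd.2]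
  ext x
  exact e.inj ((congrFun h1 x).trans (map_zero j).symm)

/-- As `H³(G, 𝔽_ℓ) = 0`, classes in `H²(G, B)` lift to `H²(G, A)`. -/
lemma exists_Z2_lift (e : IsShortExact j p) (hρ : IsDiscreteRep ρ)
    (h3 : ∀ w : G × G × G → ZMod ℓ, IsLocallyConstant w → diffThree (trivInt ℓ G) w = 0 →
      ∃ y : G × G → ZMod ℓ, IsLocallyConstant y ∧ diffTwo (trivInt ℓ G) y = w)
    {z : G × G → B} (hz : z ∈ Z2 σ) : ∃ y ∈ Z2 ρ, p ∘ y = z := by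
  obtain ⟨y, hy, hyz⟩ := e.exists_lift hz.1
  have hd : IsLocallyConstant (diffTwo ρ y) :=
    (((isLocallyConstant_action hρ hy).sub
      (hy.comp_continuous (f := fun q : G × G × G => (q.1 * q.2.1, q.2.2)) (by fun_prop))).add
      (hy.comp_continuous (f := fun q : G × G × G => (q.1, q.2.1 * q.2.2)) (by fun_prop))).sub
      (hy.comp_continuous (f := fun q : G × G × G => (q.1, q.2.1)) (by fun_prop))
  obtain ⟨w, hw, hwy⟩ := e.exists_comp_eq hd fun x => by
    rw [← Function.comp_apply (f := p), ← diffTwo_comp, hyz, hz.2, Pi.zero_apply]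
  have hw3 : diffThree (trivInt ℓ G) w = 0 := by
    have h1 : j ∘ diffThree (trivInt ℓ G) w = 0 := by
      rw [← diffThree_comp, hwy, diffThree_diffTwo]
    ext x
    exact e.inj ((congrFun h1 x).trans (map_zero j).symm)
  obtain ⟨v, hv, hvw⟩ := h3 w hw hw3
  refine ⟨y - j ∘ v, ⟨hy.sub (hv.comp j), ?_⟩, ?_⟩
  · rw [map_sub, diffTwo_comp, hvw, hwy, sub_self]
  · ext x
    simp [← hyz, e.zero]

/-- A crossed homomorphism with values in `Hom(A, I)` that vanishes on `𝔽_ℓ` and is orthogonal to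
all lifts of crossed homomorphisms `G → B` is a coboundary. -/
lemma exists_homDiff_eq (e : IsShortExact j p) (dB : IsDualPair θ J σ) (γ : G → A →+ PadicQuot ℓ)
    (hlc : ∀ a, IsLocallyConstant fun g => γ g a)
    (hγ : ∀ g h a, γ (g * h) a = γ g (ρ h a) + (θ g : ℤ_[ℓ]) • γ h a)
    (h0 : ∀ g x, γ g (j x) = 0)
    (hJ : ∀ b : G → A, IsLocallyConstant b → p ∘ b ∈ Z1 σ →
      J (fun q => γ q.1 (b q.2)) = 0) :
    ∃ f : B →+ PadicQuot ℓ,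
      ∀ g a, γ g a = homDiff θ ρ (f.comp p.toLinearMap.toAddMonoidHom) g a := by
  choose γ' hγ' using fun g => AddMonoidHom.exists_lift_of_surjective
    p.toLinearMap.toAddMonoidHom e.surj (γ g) fun a ha => by
      obtain ⟨x, rfl⟩ := e.exact a ha
      exact h0 g x
  have hγ'' : ∀ g a, γ' g (p a) = γ g a := hγ'
  obtain ⟨f, hf⟩ := dB.one γ' (fun b => by
      obtain ⟨a, rfl⟩ := e.surj b
      simpa only [hγ''] using hlc a) (fun g h b => by
      obtain ⟨a, rfl⟩ := e.surj b
      rw [← p.isIntertwining, hγ'', hγ'', hγ'', hγ]) (fun b hb => by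
      obtain ⟨y, hy, hyb⟩ := e.exists_lift hb.1
      rw [← hJ y hy (hyb ▸ hb), ← hyb]
      simp only [Function.comp_apply, hγ''])
  refine ⟨f, fun g a => ?_⟩
  rw [← hγ'', hf, homDiff_apply, ← p.isIntertwining]
  rfl

/-- Duality passes from `𝔽_ℓ` and `B` to an extension of `B` by `𝔽_ℓ`, by the arguments of the
four lemma. -/
theorem isDualPair (e : IsShortExact j p) (hρ : IsDiscreteRep ρ)
    (hJ : ∀ b, IsLocallyConstant b → J (diffOne (twist θ (PadicQuot ℓ)) b) = 0)
    (h3 : ∀ w : G × G × G → ZMod ℓ, IsLocallyConstant w → diffThree (trivInt ℓ G) w = 0 →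
      ∃ y : G × G → ZMod ℓ, IsLocallyConstant y ∧ diffTwo (trivInt ℓ G) y = w)
    (dF : IsDualPair θ J (trivInt ℓ G)) (dB : IsDualPair θ J σ) : IsDualPair θ J ρ := by
  have hjT : ∀ g x, ρ g (j x) = j x := fun g x => by
    rw [← j.isIntertwining, Representation.trivial_apply]
  refine ⟨fun Ψ hΨ => ?_, fun f hf hfJ => ?_, fun γ hlc hγ hγJ => ?_⟩
  · -- The restriction of `Ψ` to `𝔽_ℓ` is given by `f₀`; the obstruction to extending `f₀` to a
    -- `G`-homomorphism on `A` is orthogonal to `H¹(G, B)`.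
    let jL : (G × G → ZMod ℓ) →+ (G × G → A) := (j.toLinearMap.compLeft (G × G)).toAddMonoidHom
    obtain ⟨f₀, hf₀, hf₀Ψ⟩ := dF.surj (Ψ.comp jL) fun b hb => by
      refine Eq.trans (congrArg Ψ ?_) (hΨ (j ∘ b) (hb.comp j))
      exact (diffOne_comp j b).symm
    have hf₀Ψ' : ∀ z ∈ Z2 (trivInt ℓ G), Ψ (j ∘ z) = J (f₀ ∘ z) := hf₀Ψ
    obtain ⟨f₁, hf₁⟩ := PadicQuot.exists_extend j.toLinearMap.toAddMonoidHom e.inj f₀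
    have hf₁' : ∀ x, f₁ (j x) = f₀ x := fun x => DFunLike.congr_fun hf₁ x
    obtain ⟨f₂, hf₂⟩ := e.exists_homDiff_eq dB (homDiff θ ρ f₁)
      (homDiff_isLocallyConstant hρ f₁) (homDiff_mul f₁) (fun g x => by
        rw [homDiff_apply, hjT, hf₁', ← hf₀, Representation.trivial_apply, sub_self])
      (fun b hb hpb => by
        obtain ⟨z, hz, hzb⟩ := e.exists_connecting hρ hb hpb
        rw [homDiff_cup, map_sub, hJ _ (hb.comp f₁), ← hzb, zero_sub, neg_eq_zero]
        refine Eq.trans ?_ ((hf₀Ψ' z hz).symm.trans (hzb ▸ hΨ b hb))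
        exact congrArg J (funext fun x => hf₁' _))
    set f₃ : A →+ PadicQuot ℓ := f₁ - f₂.comp p.toLinearMap.toAddMonoidHom with hf₃
    have hf₃e : ∀ g a, f₃ (ρ g a) = (θ g : ℤ_[ℓ]) • f₃ a := fun g a => by
      have h1 := hf₂ g a
      rw [homDiff_apply, homDiff_apply, sub_eq_sub_iff_add_eq_add] at h1
      rw [hf₃, AddMonoidHom.sub_apply, AddMonoidHom.sub_apply, smul_sub,
        sub_eq_sub_iff_add_eq_add, h1]
      exact add_comm _ _
    have hf₃j : ∀ x, f₃ (j x) = f₀ x := fun x => by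
      rw [hf₃, AddMonoidHom.sub_apply, hf₁']
      change f₀ x - f₂ (p (j x)) = _
      rw [e.zero, map_zero, sub_zero]
    -- The remaining functional vanishes on the image of `H²(G, 𝔽_ℓ)`, so it comes from `H²(G, B)`.
    let Ψ' : (G × G → A) →+ AddCircle (1 : ℚ) :=
      Ψ - J.comp (f₃.toIntLinearMap.compLeft (G × G)).toAddMonoidHom
    have hΨ' : ∀ z, Ψ' z = Ψ z - J (f₃ ∘ z) := fun z => rfl
    let pL : (G × G → A) →+ (G × G → B) := (p.toLinearMap.compLeft (G × G)).toAddMonoidHom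
    obtain ⟨Ψ₂, hΨ₂⟩ := AddCircle.exists_comp_eq (pL.comp (Z2 ρ).subtype)
      (Ψ'.comp (Z2 ρ).subtype) fun z hz => by
        obtain ⟨y, hy, hyz⟩ := e.exists_comp_eq z.2.1 fun x => congrFun hz x
        have hy2 : y ∈ Z2 (trivInt ℓ G) := by
          refine ⟨hy, ?_⟩
          have h1 : j ∘ diffTwo (trivInt ℓ G) y = 0 := by rw [← diffTwo_comp, hyz, z.2.2]
          ext x
          exact e.inj ((congrFun h1 x).trans (map_zero j).symm)
        change Ψ' z.1 = 0
        rw [hΨ', ← hyz, hf₀Ψ' y hy2, sub_eq_zero]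
        exact congrArg J (funext fun x => (hf₃j _).symm)
    have hΨ₂' : ∀ z ∈ Z2 ρ, Ψ₂ (p ∘ z) = Ψ z - J (f₃ ∘ z) := fun z hz => hΨ₂ ⟨z, hz⟩
    obtain ⟨f₄, hf₄, hf₄Ψ⟩ := dB.surj Ψ₂ fun b hb => by
      obtain ⟨y, hy, rfl⟩ := e.exists_lift hb
      rw [diffOne_comp, hΨ₂' _ (diffOne_mem_Z2 hρ hy), hΨ y hy, zero_sub, neg_eq_zero]
      refine Eq.trans (congrArg J ?_) (hJ (f₃ ∘ y) (hy.comp f₃))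
      ext ⟨g, h⟩
      simp [diffOne_apply, hf₃e]
    refine ⟨f₃ + f₄.comp p.toLinearMap.toAddMonoidHom, fun g a => ?_, fun z hz => ?_⟩
    · have h1 : f₄ (p (ρ g a)) = (θ g : ℤ_[ℓ]) • f₄ (p a) := by rw [p.isIntertwining, hf₄]
      change f₃ (ρ g a) + f₄ (p (ρ g a)) = (θ g : ℤ_[ℓ]) • (f₃ a + f₄ (p a))
      rw [h1, hf₃e, smul_add]
    · have h1 := hf₄Ψ (p ∘ z) (comp_mem_Z2 p hz)
      rw [hΨ₂' z hz, sub_eq_iff_eq_add', ← map_add] at h1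
      exact h1
  · have hfj : f.comp j.toLinearMap.toAddMonoidHom = 0 :=
      dF.inj _ (fun g x => by
        have := hf g (j x)
        rw [← j.isIntertwining] at this
        exact this) fun z hz => hfJ (j ∘ z) (comp_mem_Z2 j hz)
    obtain ⟨f₁, hf₁⟩ := AddMonoidHom.exists_lift_of_surjective p.toLinearMap.toAddMonoidHom e.surj
      f fun a ha => by
        obtain ⟨x, rfl⟩ := e.exact a ha
        exact DFunLike.congr_fun hfj x
    have hf₁' : ∀ a, f₁ (p a) = f a := hf₁
    have : f₁ = 0 := dB.inj f₁ (fun g b => by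
        obtain ⟨a, rfl⟩ := e.surj b
        rw [← p.isIntertwining, hf₁', hf₁', hf]) fun z hz => by
        obtain ⟨y, hy, rfl⟩ := e.exists_Z2_lift hρ h3 hz
        rw [← hfJ y hy]
        exact congrArg J (funext fun x => hf₁' _)
    ext a
    rw [← hf₁', this]
    rfl
  · obtain ⟨f₀, hf₀⟩ := dF.one (fun g => (γ g).comp j.toLinearMap.toAddMonoidHom)
      (fun x => hlc (j x)) (fun g h x => by
        have := hγ g h (j x)
        rw [← j.isIntertwining] at this
        exact this) fun b hb => hγJ (j ∘ b) (comp_mem_Z1 j hb)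
    obtain ⟨f₁, hf₁⟩ := PadicQuot.exists_extend j.toLinearMap.toAddMonoidHom e.inj f₀
    have hf₁' : ∀ x, f₁ (j x) = f₀ x := fun x => DFunLike.congr_fun hf₁ x
    -- `γ - df₁` vanishes on `𝔽_ℓ`; as it is orthogonal to `H¹(G, A)`, its pairing with `H¹(G, B)`
    -- factors through the connecting homomorphism to `H²(G, 𝔽_ℓ)`.
    let M : AddSubgroup (G → A) :=
      { carrier := {b | IsLocallyConstant b ∧ p ∘ b ∈ Z1 σ}
        zero_mem' := ⟨IsLocallyConstant.const 0, by
          convert (Z1 σ).zero_mem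
          ext; simp⟩
        add_mem' := fun {a b} ha hb => ⟨ha.1.add hb.1, by
          convert (Z1 σ).add_mem ha.2 hb.2
          ext; simp⟩
        neg_mem' := fun {a} ha => ⟨ha.1.neg, by
          convert (Z1 σ).neg_mem ha.2
          ext; simp⟩ }
    let P : M →+ AddCircle (1 : ℚ) := J.comp
      { toFun := fun b q => γ q.1 (b.1 q.2) - homDiff θ ρ f₁ q.1 (b.1 q.2)
        map_zero' := by ext; simp
        map_add' := fun a b => by
          ext q
          simp only [AddSubgroup.coe_add, Pi.add_apply, map_add]
          abel }
    have hP : ∀ b : M, P b = J (fun q => γ q.1 (b.1 q.2)) -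
        J (fun q => homDiff θ ρ f₁ q.1 (b.1 q.2)) := fun b => J.map_sub _ _
    obtain ⟨Φ, hΦ⟩ := AddCircle.exists_comp_eq ((diffOne ρ).comp M.subtype) P fun b hb => by
      rw [hP, hγJ b.1 ⟨b.2.1, hb⟩, homDiff_cup, map_sub, hJ _ (b.2.1.comp f₁)]
      have hb' : diffOne ρ b.1 = 0 := hb
      have h1 : f₁ ∘ (0 : G × G → A) = 0 := by ext; simp
      rw [hb', h1, map_zero, sub_zero, sub_zero]
    let jL : (G × G → ZMod ℓ) →+ (G × G → A) := (j.toLinearMap.compLeft (G × G)).toAddMonoidHom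
    have hγj : ∀ g x, γ g (j x) = homDiff θ ρ f₁ g (j x) := fun g x => by
      have h1 : γ g (j x) = _ := hf₀ g x
      rw [h1, homDiff_apply, hf₁', hjT, hf₁', Representation.trivial_apply]
    obtain ⟨f₂, hf₂, hf₂Φ⟩ := dF.surj (Φ.comp jL) fun b hb => by
      have hjb : j ∘ b ∈ M := ⟨hb.comp j, by
        convert (Z1 σ).zero_mem
        ext g
        exact e.zero _⟩
      have h1 := hΦ ⟨j ∘ b, hjb⟩
      have h2 : Φ (diffOne ρ (j ∘ b)) = P ⟨j ∘ b, hjb⟩ := h1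
      change Φ (j ∘ diffOne (trivInt ℓ G) b) = 0
      rw [← diffOne_comp, h2, hP, ← map_sub]
      refine Eq.trans (congrArg J ?_) J.map_zero
      ext q
      exact sub_eq_zero.2 (hγj _ _)
    have hf₂Φ' : ∀ z ∈ Z2 (trivInt ℓ G), Φ (j ∘ z) = J (f₂ ∘ z) := hf₂Φ
    obtain ⟨f₃, hf₃⟩ := PadicQuot.exists_extend j.toLinearMap.toAddMonoidHom e.inj f₂
    have hf₃' : ∀ x, f₃ (j x) = f₂ x := fun x => DFunLike.congr_fun hf₃ x
    obtain ⟨f₄, hf₄⟩ := e.exists_homDiff_eq dB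
      (fun g => γ g - homDiff θ ρ f₁ g + homDiff θ ρ f₃ g)
      (fun a => ((hlc a).sub (homDiff_isLocallyConstant hρ f₁ a)).add
        (homDiff_isLocallyConstant hρ f₃ a))
      (fun g h a => by
        simp only [AddMonoidHom.add_apply, AddMonoidHom.sub_apply, hγ, homDiff_mul, smul_add,
          smul_sub]
        abel)
      (fun g x => by
        rw [AddMonoidHom.add_apply, AddMonoidHom.sub_apply, hγj, sub_self, zero_add,
          homDiff_apply, hjT, hf₃', ← hf₂, Representation.trivial_apply, sub_self])
      (fun b hb hpb => by
        obtain ⟨z, hz, hzb⟩ := e.exists_connecting hρ hb hpb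
        have h1 : Φ (diffOne ρ b) = P ⟨b, hb, hpb⟩ := hΦ ⟨b, hb, hpb⟩
        have h2 : J (fun q => homDiff θ ρ f₃ q.1 (b q.2)) = - J (f₃ ∘ diffOne ρ b) := by
          rw [homDiff_cup, map_sub, hJ _ (hb.comp f₃), zero_sub]
        have h3 : f₃ ∘ diffOne ρ b = f₂ ∘ z := by
          rw [← hzb]
          exact funext fun x => hf₃' _
        rw [h3, ← hf₂Φ' z hz, hzb, h1, hP] at h2
        have h4 : (fun q : G × G => (γ q.1 - homDiff θ ρ f₁ q.1 + homDiff θ ρ f₃ q.1) (b q.2)) =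
            (fun q => γ q.1 (b q.2)) - (fun q => homDiff θ ρ f₁ q.1 (b q.2)) +
              fun q => homDiff θ ρ f₃ q.1 (b q.2) := rfl
        rw [h4, map_add, map_sub, h2, add_neg_cancel])
    refine ⟨f₁ - f₃ + f₄.comp p.toLinearMap.toAddMonoidHom, fun g a => ?_⟩
    have h1 := hf₄ g a
    rw [AddMonoidHom.add_apply, AddMonoidHom.sub_apply] at h1
    have h2 : γ g a = homDiff θ ρ f₁ g a - homDiff θ ρ f₃ g a +
        homDiff θ ρ (f₄.comp p.toLinearMap.toAddMonoidHom) g a := by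
      rw [← h1]; abel
    rw [h2]
    simp only [homDiff_apply, AddMonoidHom.add_apply, AddMonoidHom.sub_apply, smul_add, smul_sub]
    abel

end IsShortExact

end Pairing

end ContCoh

/-! ### Existence of the dualizing orientation -/

section Dualizing

variable {ℓ : ℕ} [Fact ℓ.Prime] {G : Type u} [Group G] [TopologicalSpace G] [IsTopologicalGroup G]

/-- The embedding of `𝔽_ℓ` into `ℚ_ℓ / ℤ_ℓ`, as a homomorphism of `G`-modules. -/
noncomputable def PadicQuot.ofZModMap {θ : G →ₜ* ℤ_[ℓ]ˣ}
    (h1 : ∀ g, (ℓ : ℤ_[ℓ]) ∣ (θ g : ℤ_[ℓ]) - 1) :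
    Representation.IntertwiningMap (trivInt ℓ G) (twist θ (PadicQuot ℓ)) where
  toLinearMap := (PadicQuot.ofZMod ℓ).toIntLinearMap
  isIntertwining' g := by
    ext
    exact (PadicQuot.smul_eq_self (h1 g) (PadicQuot.nsmul_ofZMod _)).symm

lemma PadicQuot.exists_eq_ofZMod_mul (f : ZMod ℓ →+ PadicQuot ℓ) :
    ∃ x, ∀ y, f y = PadicQuot.ofZMod ℓ (x * y) := by
  obtain ⟨x, hx⟩ := PadicQuot.exists_ofZMod_eq (a := f 1) (by rw [← map_nsmul]; simp)
  refine ⟨x, fun y => ?_⟩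
  obtain ⟨n, rfl⟩ := ZMod.natCast_zmod_surjective y
  rw [mul_comm, ← nsmul_eq_mul, map_nsmul, hx, ← nsmul_one, map_nsmul]

/-- Crossed homomorphisms `G → ℚ_ℓ / ℤ_ℓ` are divisible by `ℓ` if all homomorphisms `G → 𝔽_ℓ`
lift. -/
lemma exists_nsmul_eq_of_mem_Z1 [CompactSpace G] {θ : G →ₜ* ℤ_[ℓ]ˣ}
    (h1 : ∀ g, (ℓ : ℤ_[ℓ]) ∣ (θ g : ℤ_[ℓ]) - 1)
    (hl : ∀ n, LiftsMod (fun g => (θ g : ℤ_[ℓ])) n) {a : G → PadicQuot ℓ}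
    (ha : a ∈ Z1 (twist θ (PadicQuot ℓ))) :
    ∃ c ∈ Z1 (twist θ (PadicQuot ℓ)), ∀ g, ℓ • c g = a g := by
  obtain ⟨m, hm⟩ : ∃ m : ℕ, ∀ g, ℓ ^ m • a g = 0 := by
    choose n hn using PadicQuot.exists_pow_nsmul_eq_zero (ℓ := ℓ)
    have hfin : (Set.range a).Finite := ha.1.range_finite
    obtain ⟨m, hm⟩ := (hfin.image n).bddAbove
    refine ⟨m, fun g => ?_⟩
    obtain ⟨k, hk⟩ := Nat.exists_eq_add_of_le (hm ⟨a g, ⟨g, rfl⟩, rfl⟩)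
    rw [hk, pow_add, mul_comm, mul_nsmul', hn, smul_zero]
  have hex : ∀ x : PadicQuot ℓ, ∃ y : ℤ_[ℓ], ℓ ^ m • x = 0 → PadicQuot.frac m y = x := fun x => by
    by_cases hx : ℓ ^ m • x = 0
    · obtain ⟨y, hy⟩ := PadicQuot.exists_eq_frac_of_pow_nsmul hx
      exact ⟨y, fun _ => hy⟩
    · exact ⟨0, fun h => absurd h hx⟩
  choose r hr using hex
  have hra : ∀ g, PadicQuot.frac m (r (a g)) = a g := fun g => hr _ (hm g)
  have hc : IsCrossedMod (fun g => (θ g : ℤ_[ℓ])) m fun g => r (a g) := by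
    refine ⟨ha.1.comp r, fun g h => ?_⟩
    rw [← PadicQuot.frac_eq_zero_iff, map_sub, map_add, ← PadicQuot.smul_frac, hra, hra, hra,
      Z1.map_mul ha, twist_apply, sub_self]
  obtain ⟨c, hc', hcc⟩ := (hl (m + 1)).exists_lift h1 m.le_succ hc
  refine ⟨fun g => PadicQuot.frac (m + 1) (c g), mem_Z1_iff.2 ⟨hc'.1.comp _, fun g h => ?_⟩,
    fun g => ?_⟩
  · rw [twist_apply, PadicQuot.smul_frac, ← map_add, eq_comm, ← sub_eq_zero, ← map_sub,
      PadicQuot.frac_eq_zero_iff]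
    exact hc'.2 g h
  · have h2 := PadicQuot.frac_add_mul m 1 (c g)
    rw [pow_one] at h2
    rw [← map_nsmul, nsmul_eq_mul, h2, ← hra, ← sub_eq_zero, ← map_sub,
      PadicQuot.frac_eq_zero_iff]
    exact hcc g

/-- The map `H²(G, 𝔽_ℓ) → H²(G, ℚ_ℓ / ℤ_ℓ)` is injective if all homomorphisms `G → 𝔽_ℓ` lift. -/
lemma exists_diffOne_eq_of_ofZMod [CompactSpace G] {θ : G →ₜ* ℤ_[ℓ]ˣ}
    (h1 : ∀ g, (ℓ : ℤ_[ℓ]) ∣ (θ g : ℤ_[ℓ]) - 1)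
    (hl : ∀ n, LiftsMod (fun g => (θ g : ℤ_[ℓ])) n) {z : G × G → ZMod ℓ} {b : G → PadicQuot ℓ}
    (hb : IsLocallyConstant b)
    (hbz : diffOne (twist θ (PadicQuot ℓ)) b = PadicQuot.ofZMod ℓ ∘ z) :
    ∃ y : G → ZMod ℓ, IsLocallyConstant y ∧ diffOne (trivInt ℓ G) y = z := by
  obtain ⟨c, hc, hcb⟩ := exists_nsmul_eq_of_mem_Z1 h1 hl (a := ℓ • b)
    ⟨hb.comp (ℓ • ·), by
      rw [map_nsmul, hbz]
      ext x
      exact PadicQuot.nsmul_ofZMod _⟩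
  have h2 : ∀ g, ℓ • (b g - c g) = 0 := fun g => by
    rw [smul_sub, hcb, Pi.smul_apply, sub_self]
  have hy : ∀ g, PadicQuot.ofZMod ℓ (Function.invFun (PadicQuot.ofZMod ℓ) (b g - c g)) =
      b g - c g := fun g => Function.invFun_eq (PadicQuot.exists_ofZMod_eq (h2 g))
  refine ⟨fun g => Function.invFun (PadicQuot.ofZMod ℓ) (b g - c g),
    (hb.sub hc.1).comp (Function.invFun (PadicQuot.ofZMod ℓ)), ?_⟩
  have h3 := diffOne_comp (PadicQuot.ofZModMap h1)
    fun g => Function.invFun (PadicQuot.ofZMod ℓ) (b g - c g)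
  have h4 : (PadicQuot.ofZModMap h1 ∘
    fun g => Function.invFun (PadicQuot.ofZMod ℓ) (b g - c g)) = b - c := funext hy
  rw [h4, map_sub, hc.2, hbz, sub_zero] at h3
  ext x
  exact (PadicQuot.ofZMod_injective (congrFun h3 x)).symm

lemma AddCircle.exists_nsmul_eq {u v : AddCircle (1 : ℚ)} (hu : ℓ • u = 0) (hu0 : u ≠ 0)
    (hv : ℓ • v = 0) : ∃ n : ℕ, v = n • u := by
  have hpos : 0 < ℓ := (Fact.out : ℓ.Prime).pos
  have key : ∀ x : AddCircle (1 : ℚ), ℓ • x = 0 →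
      ∃ m : ℕ, x = m • ((1 / ℓ : ℚ) : AddCircle (1 : ℚ)) := fun x hx => by
    obtain ⟨m, -, rfl⟩ := (AddCircle.nsmul_eq_zero_iff hpos).1 hx
    refine ⟨m, ?_⟩
    rw [← AddCircle.coe_nsmul]
    congr 1
    rw [nsmul_eq_mul]
    ring
  have h0 : ℓ • ((1 / ℓ : ℚ) : AddCircle (1 : ℚ)) = 0 := by
    rw [← AddCircle.coe_nsmul, nsmul_eq_mul, mul_one_div_cancel (by positivity)]
    exact AddCircle.coe_period _
  obtain ⟨a, rfl⟩ := key u hu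
  obtain ⟨b, rfl⟩ := key v hv
  have ha : ((a : ℕ) : ZMod ℓ) ≠ 0 := fun h => hu0 (by
    obtain ⟨c, rfl⟩ := (ZMod.natCast_eq_zero_iff _ _).1 h
    rw [mul_nsmul, h0, smul_zero])
  refine ⟨((b : ZMod ℓ) * (a : ZMod ℓ)⁻¹).val, ?_⟩
  set n := ((b : ZMod ℓ) * (a : ZMod ℓ)⁻¹).val with hn
  have h2 : ((n * a : ℕ) : ZMod ℓ) = (b : ℕ) := by
    rw [Nat.cast_mul, hn, ZMod.natCast_val, ZMod.cast_id, inv_mul_cancel_right₀ ha]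
  rw [← mul_nsmul']
  rw [ZMod.natCast_eq_natCast_iff] at h2
  have h5 : ∀ k : ℕ, k • ((1 / ℓ : ℚ) : AddCircle (1 : ℚ)) =
      (k % ℓ) • ((1 / ℓ : ℚ) : AddCircle (1 : ℚ)) := fun k => by
    conv_lhs => rw [← Nat.mod_add_div k ℓ, add_nsmul, mul_nsmul, h0, smul_zero, add_zero]
  rw [h5 b, h5 (n * a), h2]

/-- The duality for the module `𝔽_ℓ`, which expresses the hypotheses on a Demushkin group. -/
lemma isDualPair_trivInt {θ : G →ₜ* ℤ_[ℓ]ˣ} (h1 : ∀ g, (ℓ : ℤ_[ℓ]) ∣ (θ g : ℤ_[ℓ]) - 1)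
    {τ : Z2 (trivInt ℓ G) →+ ZMod ℓ} (hτs : Function.Surjective τ)
    (hτ : ∀ z, τ z = 0 ↔
      ∃ b : G → ZMod ℓ, IsLocallyConstant b ∧ diffOne (trivInt ℓ G) b = z.1)
    (hcup : ∀ χ, (∀ ψ, τ (cup11 χ ψ) = 0) → χ = 0)
    {J : (G × G → PadicQuot ℓ) →+ AddCircle (1 : ℚ)}
    (hJ : ∀ b, IsLocallyConstant b → J (diffOne (twist θ (PadicQuot ℓ)) b) = 0)
    (hJτ : ∀ z : Z2 (trivInt ℓ G), J (PadicQuot.ofZMod ℓ ∘ z.1) = 0 → τ z = 0) :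
    IsDualPair θ J (trivInt ℓ G) := by
  obtain ⟨z₀, hz₀⟩ := hτs 1
  have hJc : ∀ b : G → ZMod ℓ, IsLocallyConstant b →
      J (PadicQuot.ofZMod ℓ ∘ diffOne (trivInt ℓ G) b) = 0 := fun b hb => by
    rw [← hJ (PadicQuot.ofZMod ℓ ∘ b) (hb.comp _)]
    exact congrArg J (diffOne_comp (PadicQuot.ofZModMap h1) b).symm
  -- Every cocycle is a multiple of `z₀` up to a coboundary.
  have hz : ∀ z : Z2 (trivInt ℓ G), ∃ (n : ℕ) (b : G → ZMod ℓ), IsLocallyConstant b ∧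
      z.1 = diffOne (trivInt ℓ G) b + n • z₀.1 := fun z => by
    have h2 : τ (z - (τ z).val • z₀) = 0 := by
      rw [map_sub, map_nsmul, hz₀]; simp
    obtain ⟨b, hb, hbz⟩ := (hτ _).1 h2
    refine ⟨(τ z).val, b, hb, ?_⟩
    rw [hbz, AddSubgroup.coe_sub, AddSubgroup.coe_nsmul]
    exact (sub_add_cancel _ _).symm
  have hof : ∀ (n : ℕ) (z : G × G → ZMod ℓ),
      PadicQuot.ofZMod ℓ ∘ (n • z) = n • (PadicQuot.ofZMod ℓ ∘ z) := fun n z => by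
    ext x
    exact map_nsmul _ n (z x)
  have hoa : ∀ (z z' : G × G → ZMod ℓ), PadicQuot.ofZMod ℓ ∘ (z + z') =
      PadicQuot.ofZMod ℓ ∘ z + PadicQuot.ofZMod ℓ ∘ z' := fun z z' => by
    ext x; simp
  refine ⟨fun Ψ hΨ => ?_, fun f hf hfJ => ?_, fun γ hlc hγ hγJ => ?_⟩
  · have hℓz : ℓ • z₀.1 = 0 := by ext x; simp
    obtain ⟨n, hn⟩ := AddCircle.exists_nsmul_eq (ℓ := ℓ) (u := J (PadicQuot.ofZMod ℓ ∘ z₀.1))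
      (v := Ψ z₀.1) (by
        rw [← map_nsmul, ← hof, hℓz]
        refine Eq.trans (congrArg J ?_) J.map_zero
        ext x
        exact map_zero _) (fun h => by
        have := hJτ z₀ h
        rw [hz₀] at this
        exact one_ne_zero this) (by rw [← map_nsmul, hℓz, map_zero])
    refine ⟨n • PadicQuot.ofZMod ℓ, fun g a => ?_, fun z hzz => ?_⟩
    · rw [Representation.trivial_apply, AddMonoidHom.nsmul_apply, PadicQuot.smul_eq_self (h1 g)]
      rw [smul_comm, PadicQuot.nsmul_ofZMod, smul_zero]
    · obtain ⟨m, b, hb, hzb⟩ := hz ⟨z, hzz⟩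
      have h3 : z = diffOne (trivInt ℓ G) b + m • z₀.1 := hzb
      have h4 : ⇑(n • PadicQuot.ofZMod ℓ) ∘ z = n • (PadicQuot.ofZMod ℓ ∘ z) := rfl
      rw [h4, h3, map_add, hΨ b hb, map_nsmul, map_nsmul, hoa, map_add, hJc b hb, hof, map_nsmul,
        hn, zero_add, zero_add, smul_comm]
  · obtain ⟨x, hx⟩ := PadicQuot.exists_eq_ofZMod_mul f
    have h2 : J (PadicQuot.ofZMod ℓ ∘ (x.val • z₀).1) = 0 := by
      rw [← hfJ z₀.1 z₀.2]
      refine congrArg J (funext fun p => ?_)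
      change PadicQuot.ofZMod ℓ (x.val • z₀.1 p) = f (z₀.1 p)
      rw [hx, nsmul_eq_mul, ZMod.natCast_val, ZMod.cast_id]
    have h3 := hJτ _ h2
    rw [map_nsmul, hz₀] at h3
    simp only [nsmul_eq_mul, ZMod.natCast_val, ZMod.cast_id, mul_one] at h3
    ext
    simp [hx, h3]
  · choose χ hχ using fun g => PadicQuot.exists_eq_ofZMod_mul (γ g)
    have hχ1 : ∀ g, PadicQuot.ofZMod ℓ (χ g) = γ g 1 := fun g => by rw [hχ, mul_one]
    have hχZ : χ ∈ Z1 (trivInt ℓ G) := by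
      refine mem_Z1_trivInt.2 ⟨?_, fun g h => PadicQuot.ofZMod_injective ?_⟩
      · have h2 : χ = fun g => Function.invFun (PadicQuot.ofZMod ℓ) (γ g 1) := funext fun g => by
          rw [← hχ1, Function.leftInverse_invFun PadicQuot.ofZMod_injective]
        rw [h2]
        exact (hlc 1).comp (Function.invFun (PadicQuot.ofZMod ℓ))
      · rw [map_add, hχ1, hχ1, hχ1, hγ, Representation.trivial_apply,
          PadicQuot.smul_eq_self (h1 g)]
        rw [← hχ1, PadicQuot.nsmul_ofZMod]
    have h2 := hcup ⟨χ, hχZ⟩ fun ψ => hJτ _ (by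
      rw [← hγJ ψ.1 ψ.2]
      exact congrArg J (funext fun p => (hχ _ _).symm))
    have h3 : χ = 0 := congrArg Subtype.val h2
    refine ⟨0, fun g a => ?_⟩
    simp [hχ, h3]

lemma isDualPair_of_subsingleton (θ : G →ₜ* ℤ_[ℓ]ˣ)
    (J : (G × G → PadicQuot ℓ) →+ AddCircle (1 : ℚ)) {A : Type w} [AddCommGroup A]
    [Subsingleton A] (ρ : Representation ℤ G A) : IsDualPair θ J ρ := by
  have hz : ∀ (f : A →+ PadicQuot ℓ) a, f a = 0 := fun f a => by
    rw [Subsingleton.elim a 0, map_zero]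
  refine ⟨fun Ψ hΨ => ⟨0, by simp, fun z _ => ?_⟩, fun f _ _ => ?_, fun γ _ _ _ => ⟨0, ?_⟩⟩
  · have h1 : z = 0 := Subsingleton.elim _ _
    have h2 : (⇑(0 : A →+ PadicQuot ℓ) ∘ (0 : G × G → A)) = 0 := rfl
    rw [h1, h2, map_zero, map_zero]
  · ext a; simp [hz]
  · intro g a
    simp [hz (γ g)]

/-- A pro-`ℓ` group acting on a nontrivial finite `ℓ`-group has a fixed point of order `ℓ`. -/
lemma exists_fixed_of_card_eq_pow (hG : IsProP ℓ G) {A : Type w} [AddCommGroup A] [Finite A]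
    {ρ : Representation ℤ G A} (hρ : IsDiscreteRep ρ) {m : ℕ} (hm : Nat.card A = ℓ ^ (m + 1)) :
    ∃ x : A, addOrderOf x = ℓ ∧ ∀ g, ρ g x = x := by
  let f : G →* (Module.End ℤ A)ˣ := MonoidHom.toHomUnits ρ
  have hopen : IsOpen (f.ker : Set G) := by
    have h1 : (f.ker : Set G) = ⋂ a : A, {g : G | ρ g a = a} := by
      ext g
      rw [SetLike.mem_coe, MonoidHom.mem_ker, Set.mem_iInter, Units.ext_iff]
      refine ⟨fun h a => ?_, fun h => LinearMap.ext h⟩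
      have h2 : ρ g = 1 := h
      rw [Set.mem_ofPred_eq, h2]
      rfl
    rw [h1]
    exact isOpen_iInter_of_finite hρ
  obtain ⟨n, hn⟩ := hG.index_eq_pow
    { toSubgroup := f.ker, isOpen' := hopen, isNormal' := inferInstance }
  rw [Subgroup.index_ker] at hn
  have hP : IsPGroup ℓ f.range := IsPGroup.of_card hn
  have hfix : ∀ a : A, a ∈ MulAction.fixedPoints f.range A ↔
      a ∈ ρ.invariants.toAddSubgroup := fun a => by
    rw [MulAction.mem_fixedPoints]
    refine ⟨fun h g => h ⟨f g, g, rfl⟩, ?_⟩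
    rintro h ⟨_, g, rfl⟩
    exact h g
  have hcard := hP.card_modEq_card_fixedPoints A
  rw [Nat.card_congr (Equiv.subtypeEquivRight hfix)] at hcard
  have hdvd : ℓ ∣ Nat.card ρ.invariants.toAddSubgroup := by
    refine (Nat.ModEq.dvd_iff hcard dvd_rfl).1 ?_
    rw [hm]
    exact dvd_pow_self ℓ m.succ_ne_zero
  obtain ⟨x, hx⟩ := exists_prime_addOrderOf_dvd_card' ℓ hdvd
  exact ⟨x.1, by rw [← hx]; exact AddSubgroup.addOrderOf_coe x, x.2⟩

/-- The duality for all finite modules of `ℓ`-power order, by induction on the order: every nonzero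
module contains the trivial module `𝔽_ℓ`. -/
lemma isDualPair_of_card_eq_pow (hG : IsDemushkin ℓ G) {θ : G →ₜ* ℤ_[ℓ]ˣ}
    {J : (G × G → PadicQuot ℓ) →+ AddCircle (1 : ℚ)}
    (hJ : ∀ b, IsLocallyConstant b → J (diffOne (twist θ (PadicQuot ℓ)) b) = 0)
    (dF : IsDualPair θ J (trivInt ℓ G)) (m : ℕ) {A : Type w} [AddCommGroup A] [Finite A]
    {ρ : Representation ℤ G A} (hρ : IsDiscreteRep ρ) (hm : Nat.card A = ℓ ^ m) :
    IsDualPair θ J ρ := by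
  induction m generalizing A with
  | zero =>
    have : Subsingleton A := (Nat.card_eq_one_iff_unique.1 (by simpa using hm)).1
    exact isDualPair_of_subsingleton θ J ρ
  | succ m ih =>
    obtain ⟨x, hx, hfix⟩ := exists_fixed_of_card_eq_pow hG.isProP hρ hm
    let j₀ : ZMod ℓ →+ A := ZMod.lift ℓ ⟨zmultiplesHom A x, by
      rw [zmultiplesHom_apply, natCast_zsmul, ← hx, addOrderOf_nsmul_eq_zero]⟩
    have hj₀ : ∀ n : ℤ, j₀ n = n • x := fun n => ZMod.lift_coe _ _ _
    let j : Representation.IntertwiningMap (trivInt ℓ G) ρ :=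
      { toLinearMap := j₀.toIntLinearMap
        isIntertwining' := fun g => LinearMap.ext fun y => by
          obtain ⟨n, rfl⟩ := ZMod.intCast_surjective y
          change j₀ n = ρ g (j₀ n)
          rw [hj₀, map_zsmul, hfix] }
    have hj : Function.Injective j := by
      change Function.Injective j₀
      rw [injective_iff_map_eq_zero]
      intro y hy
      obtain ⟨n, rfl⟩ := ZMod.intCast_surjective y
      rw [hj₀, ← addOrderOf_dvd_iff_zsmul_eq_zero, hx] at hy
      exact (ZMod.intCast_zmod_eq_zero_iff_dvd _ _).2 hy
    let W : Submodule ℤ A := LinearMap.range j.toLinearMap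
    have hW : ∀ g, W ≤ W.comap (ρ g) := by
      rintro g _ ⟨y, rfl⟩
      exact ⟨y, (Representation.IntertwiningMap.isIntertwining (trivInt ℓ G) ρ j g y)⟩
    let p : Representation.IntertwiningMap ρ (ρ.quotient W hW) :=
      { toLinearMap := W.mkQ
        isIntertwining' := fun g => rfl }
    have hp : Function.Surjective p := W.mkQ_surjective
    have e : IsShortExact j p :=
      { inj := hj
        surj := hp
        zero := fun y => (Submodule.Quotient.mk_eq_zero W).2 ⟨y, rfl⟩
        exact := fun a ha => (Submodule.Quotient.mk_eq_zero W).1 ha }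
    have hcW : Nat.card W = ℓ := by
      rw [← Nat.card_zmod ℓ]
      exact (Nat.card_congr (LinearEquiv.ofInjective j.toLinearMap hj).toEquiv).symm
    have hcard := Submodule.card_eq_card_quotient_mul_card W
    rw [hcW, hm, pow_succ'] at hcard
    have : Finite (A ⧸ W) := Finite.of_surjective _ W.mkQ_surjective
    exact e.isDualPair hρ hJ (fun w => hG.exists_diffTwo_eq) dF
      (ih (hρ.of_surjective p hp)
        (Nat.eq_of_mul_eq_mul_left (Fact.out : ℓ.Prime).pos hcard).symm)

/-- A Demushkin group has a dualizing orientation. -/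
theorem IsDemushkin.exists_isDualizingOrientation (hG : IsDemushkin ℓ G) :
    ∃ θ : G →ₜ* ℤ_[ℓ]ˣ, IsDualizingOrientation θ := by
  have := hG.isProP.compact
  obtain ⟨θ, h1, hl⟩ := hG.exists_liftsMod
  obtain ⟨τ, hτs, hτ, hcup, -⟩ := hG.exists_functional
  -- The functional on `H²(G, 𝔽_ℓ)` extends along the injection `H²(G, 𝔽_ℓ) → H²(G, I)`.
  obtain ⟨χ₀, hχ₀⟩ : ∃ χ₀ : ZMod ℓ →+ AddCircle (1 : ℚ), χ₀ 1 ≠ 0 :=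
    CharacterModule.exists_character_apply_ne_zero_of_ne_zero
    (one_ne_zero : (1 : ZMod ℓ) ≠ 0)
  have hχ₀i : ∀ x : ZMod ℓ, χ₀ x = 0 → x = 0 := fun x hx => by
    by_contra h
    apply hχ₀
    have h2 : (1 : ZMod ℓ) = (x⁻¹).val • x := by simp [h]
    rw [h2, map_nsmul, hx, smul_zero]
  let ι := PadicQuot.ofZModMap h1
  let ι' : Z2 (trivInt ℓ G) →+ H (twist θ (PadicQuot ℓ)) 2 :=
    (map ι 2).toAddMonoidHom.comp (cls2 _)
  have hι' : ∀ z, ι' z = cls2 (twist θ (PadicQuot ℓ)) ⟨ι ∘ z.1, comp_mem_Z2 ι z.2⟩ :=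
    fun z => rfl
  obtain ⟨i, hi⟩ := AddCircle.exists_comp_eq ι' (χ₀.comp τ) fun z hz => by
    rw [hι', cls2_eq_zero_iff] at hz
    obtain ⟨b, hb, hbz⟩ := hz
    rw [AddMonoidHom.comp_apply, (hτ z).2 (exists_diffOne_eq_of_ofZMod h1 hl hb hbz), map_zero]
  obtain ⟨J, hJi⟩ := AddCircle.exists_comp_eq (Z2 (twist θ (PadicQuot ℓ))).subtype
    (i.comp (cls2 _)) fun z hz => by
      have : z = 0 := Subtype.ext hz
      rw [this, map_zero]
  have hJi' : ∀ z (hz : z ∈ Z2 (twist θ (PadicQuot ℓ))), J z = i (cls2 _ ⟨z, hz⟩) :=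
    fun z hz => hJi ⟨z, hz⟩
  have hJ : ∀ b, IsLocallyConstant b → J (diffOne (twist θ (PadicQuot ℓ)) b) = 0 := fun b hb => by
    rw [hJi' _ (diffOne_mem_Z2 (PadicQuot.isDiscreteRep θ) hb),
      (cls2_eq_zero_iff _ _).2 ⟨b, hb, rfl⟩, map_zero]
  have dF : IsDualPair θ J (trivInt ℓ G) := isDualPair_trivInt h1 hτs hτ hcup hJ fun z hz => by
    apply hχ₀i
    have h2 : i (ι' z) = χ₀ (τ z) := hi z
    rw [← h2, hι', ← hJi' _ (comp_mem_Z2 ι z.2)]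
    exact hz
  refine ⟨θ, i, fun A _ _ ρ ⟨m, hm⟩ hρ => ?_⟩
  have d := isDualPair_of_card_eq_pow hG hJ dF m hρ hm
  have hfJ : ∀ (f : Representation.IntertwiningMap ρ (twist θ (PadicQuot ℓ))) (z : Z2 ρ),
      i (map f 2 (cls2 ρ z)) = J (f ∘ z.1) := fun f z => by
    rw [map_cls2, ← hJi']
  refine ⟨fun f f' hff => ?_, fun ψ => ?_⟩
  · have h2 := d.inj (f.toLinearMap.toAddMonoidHom - f'.toLinearMap.toAddMonoidHom)
      (fun g a => by
        have h3 : f (ρ g a) = (θ g : ℤ_[ℓ]) • f a :=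
          Representation.IntertwiningMap.isIntertwining _ _ f g a
        have h4 : f' (ρ g a) = (θ g : ℤ_[ℓ]) • f' a :=
          Representation.IntertwiningMap.isIntertwining _ _ f' g a
        change f (ρ g a) - f' (ρ g a) = (θ g : ℤ_[ℓ]) • (f a - f' a)
        rw [h3, h4, smul_sub]) fun z hz => by
        have h3 : J (f ∘ z) = J (f' ∘ z) := by
          rw [← hfJ f ⟨z, hz⟩, ← hfJ f' ⟨z, hz⟩]
          exact DFunLike.congr_fun hff (cls2 ρ ⟨z, hz⟩)
        rw [← sub_eq_zero, ← map_sub] at h3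
        exact h3
    ext a
    exact sub_eq_zero.1 (DFunLike.congr_fun h2 a)
  · obtain ⟨Ψ, hΨ⟩ := AddCircle.exists_comp_eq (Z2 ρ).subtype (ψ.comp (cls2 ρ)) fun z hz => by
      have : z = 0 := Subtype.ext hz
      rw [this, map_zero]
    have hΨ' : ∀ z (hz : z ∈ Z2 ρ), Ψ z = ψ (cls2 ρ ⟨z, hz⟩) := fun z hz => hΨ ⟨z, hz⟩
    obtain ⟨f, hf, hfΨ⟩ := d.surj Ψ fun b hb => by
      rw [hΨ' _ (diffOne_mem_Z2 hρ hb), (cls2_eq_zero_iff _ _).2 ⟨b, hb, rfl⟩, map_zero]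
    let F : Representation.IntertwiningMap ρ (twist θ (PadicQuot ℓ)) :=
      { toLinearMap := f.toIntLinearMap
        isIntertwining' := fun g => LinearMap.ext fun a => hf g a }
    refine ⟨F, ?_⟩
    ext x
    obtain ⟨z, rfl⟩ := cls2_surjective ρ x
    change i (map F 2 (cls2 ρ z)) = ψ (cls2 ρ z)
    rw [hfJ, ← hΨ' z.1 z.2, hfΨ z.1 z.2]
    rfl

end Dualizing

/-! ### Homomorphisms to finite `ℓ`-groups -/

/-- A central subgroup of order `ℓ` of a nontrivial finite `ℓ`-group. -/
lemma exists_central_of_card_eq_pow {ℓ : ℕ} [Fact ℓ.Prime] {P : Type w} [Group P] [Finite P]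
    {m : ℕ} (hm : Nat.card P = ℓ ^ (m + 1)) :
    ∃ (E : ZMod ℓ → P) (Z : Subgroup P), Z.Normal ∧ Nat.card (P ⧸ Z) = ℓ ^ m ∧
      (∀ a b, E (a + b) = E a * E b) ∧ Function.Injective E ∧ (∀ a p, E a * p = p * E a) ∧
      ∀ p, p ∈ Z ↔ ∃ a, E a = p := by
  have hP : IsPGroup ℓ P := IsPGroup.of_card hm
  have : Nontrivial P := by
    rw [← Finite.one_lt_card_iff_nontrivial, hm]
    exact Nat.one_lt_pow m.succ_ne_zero (Fact.out : ℓ.Prime).one_lt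
  have hc := hP.center_nontrivial
  obtain ⟨n, hn⟩ := IsPGroup.iff_card.1 (hP.to_subgroup (Subgroup.center P))
  have hdvd : ℓ ∣ Nat.card (Subgroup.center P) := by
    rw [hn]
    refine dvd_pow_self ℓ ?_
    rintro rfl
    rw [← Finite.one_lt_card_iff_nontrivial, hn, pow_zero] at hc
    exact lt_irrefl _ hc
  obtain ⟨⟨c, hcc⟩, hc⟩ := exists_prime_orderOf_dvd_card' ℓ hdvd
  have hc' : orderOf c = ℓ := by rw [← hc]; exact Subgroup.orderOf_coe ⟨c, hcc⟩
  have hcm : ∀ (g : P) (k : ℤ), g * c ^ k = c ^ k * g := fun g k =>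
    Commute.zpow_right (Subgroup.mem_center_iff.1 hcc g) k
  let e : ZMod ℓ →+ Additive P := ZMod.lift ℓ ⟨zmultiplesHom (Additive P) (Additive.ofMul c), by
    rw [zmultiplesHom_apply, natCast_zsmul, ← hc', ← ofMul_pow, pow_orderOf_eq_one, ofMul_one]⟩
  have he : ∀ k : ℤ, (e k).toMul = c ^ k := fun k => congrArg Additive.toMul (ZMod.lift_coe _ _ _)
  refine ⟨fun a => (e a).toMul, Subgroup.zpowers c, ?_, ?_, fun a b => ?_, ?_, fun a p => ?_,
    fun p => ?_⟩
  · refine ⟨fun x hx g => ?_⟩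
    obtain ⟨k, rfl⟩ := Subgroup.mem_zpowers_iff.1 hx
    have : g * c ^ k * g⁻¹ = c ^ k := by
      rw [hcm, mul_inv_cancel_right]
    rw [this]
    exact hx
  · have h := Subgroup.card_eq_card_quotient_mul_card_subgroup (Subgroup.zpowers c)
    rw [hm, Nat.card_zpowers, hc', pow_succ] at h
    exact (Nat.eq_of_mul_eq_mul_right (Fact.out : ℓ.Prime).pos h).symm
  · exact congrArg Additive.toMul (map_add e a b)
  · intro a b hab
    have h : e a = e b := hab
    rw [← sub_eq_zero, ← map_sub] at h
    rw [← sub_eq_zero]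
    obtain ⟨k, hk⟩ := ZMod.intCast_surjective (a - b)
    rw [← hk] at h ⊢
    have h2 := he k
    rw [h] at h2
    rw [ZMod.intCast_zmod_eq_zero_iff_dvd, ← hc', orderOf_dvd_iff_zpow_eq_one]
    exact h2.symm
  · obtain ⟨k, rfl⟩ := ZMod.intCast_surjective a
    change (e k).toMul * p = p * (e k).toMul
    rw [he, hcm]
  · rw [Subgroup.mem_zpowers_iff]
    refine ⟨fun ⟨k, hk⟩ => ⟨k, (he k).trans hk⟩, fun ⟨a, ha⟩ => ?_⟩
    obtain ⟨k, rfl⟩ := ZMod.intCast_surjective a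
    exact ⟨k, (he k).symm.trans ha⟩

section Homs

variable {ℓ : ℕ} [Fact ℓ.Prime] {G : Type u} [Group G] [TopologicalSpace G]

/-- Two lifts of a homomorphism along a central extension differ by a homomorphism. -/
lemma exists_mem_Z1_of_mk_eq {P : Type w} [Group P] {E : ZMod ℓ → P} {Z : Subgroup P}
    (hE : ∀ a b, E (a + b) = E a * E b) (hEi : Function.Injective E)
    (hEc : ∀ a p, E a * p = p * E a) (hEZ : ∀ p, p ∈ Z ↔ ∃ a, E a = p) {φ ψ : G →* P}
    (hφ : IsLocallyConstant φ) (hψ : IsLocallyConstant ψ)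
    (h : ∀ g, (φ g : P ⧸ Z) = ψ g) : ∃ χ ∈ Z1 (trivInt ℓ G), ∀ g, ψ g = φ g * E (χ g) := by
  choose χ hχ using fun g => (hEZ _).1 (QuotientGroup.eq.1 (h g))
  have hχ' : ∀ g, ψ g = φ g * E (χ g) := fun g => by rw [hχ, mul_inv_cancel_left]
  refine ⟨χ, mem_Z1_trivInt.2 ⟨?_, fun g k => hEi ?_⟩, hχ'⟩
  · have h1 : IsLocallyConstant fun g => (φ g)⁻¹ * ψ g := hφ.inv.mul hψ
    rw [IsLocallyConstant.iff_eventually_eq] at h1 ⊢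
    intro g
    filter_upwards [h1 g] with k hk
    exact hEi (by rw [hχ, hχ, hk])
  · have h1 := hχ' (g * k)
    rw [map_mul, map_mul, hχ' g, hχ' k, mul_assoc, mul_assoc, mul_right_inj, ← mul_assoc, hEc,
      mul_assoc, mul_right_inj, ← hE] at h1
    exact h1.symm

/-- A subset on which no nonzero homomorphism to `𝔽_ℓ` vanishes determines homomorphisms to finite
`ℓ`-groups. -/
lemma eq_of_eqOn_of_card_eq_pow {X : Set G}
    (hX : ∀ χ ∈ Z1 (trivInt ℓ G), (∀ x ∈ X, χ x = 0) → χ = 0) (m : ℕ) {P : Type w} [Group P]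
    [Finite P] (hm : Nat.card P = ℓ ^ m) {φ ψ : G →* P} (hφ : IsLocallyConstant φ)
    (hψ : IsLocallyConstant ψ) (h : ∀ x ∈ X, φ x = ψ x) : φ = ψ := by
  induction m generalizing P with
  | zero =>
    have : Subsingleton P := (Nat.card_eq_one_iff_unique.1 (by simpa using hm)).1
    ext g
    exact Subsingleton.elim _ _
  | succ m ih =>
    obtain ⟨E, Z, hZ, hcard, hE, hEi, hEc, hEZ⟩ := exists_central_of_card_eq_pow hm
    have h1 := ih hcard (φ := (QuotientGroup.mk' Z).comp φ) (ψ := (QuotientGroup.mk' Z).comp ψ)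
      (hφ.comp _) (hψ.comp _) fun x hx => congrArg _ (h x hx)
    obtain ⟨χ, hχ, hχφ⟩ := exists_mem_Z1_of_mk_eq hE hEi hEc hEZ hφ hψ fun g =>
      DFunLike.congr_fun h1 g
    have hE0 : E 0 = 1 := by
      have := hE 0 0
      rwa [add_zero, left_eq_mul] at this
    have h2 : χ = 0 := hX χ hχ fun x hx => hEi (by
      have := hχφ x
      rw [h x hx, left_eq_mul] at this
      rw [this, hE0])
    ext g
    rw [hχφ, h2, Pi.zero_apply, hE0, mul_one]

open Classical in
/-- If there are only finitely many homomorphisms to `𝔽_ℓ`, then there are only finitely many to any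
finite `ℓ`-group. -/
lemma finite_setOf_isLocallyConstant [Finite (Z1 (trivInt ℓ G))] (m : ℕ) {P : Type w} [Group P]
    [Finite P] (hm : Nat.card P = ℓ ^ m) : {φ : G →* P | IsLocallyConstant φ}.Finite := by
  induction m generalizing P with
  | zero =>
    have : Subsingleton P := (Nat.card_eq_one_iff_unique.1 (by simpa using hm)).1
    exact Set.Subsingleton.finite fun φ _ ψ _ => by ext g; exact Subsingleton.elim _ _
  | succ m ih =>
    obtain ⟨E, Z, hZ, hcard, hE, hEi, hEc, hEZ⟩ := exists_central_of_card_eq_pow hm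
    have hmaps : Set.MapsTo (fun φ : G →* P => (QuotientGroup.mk' Z).comp φ)
        {φ | IsLocallyConstant φ} {φ | IsLocallyConstant φ} := fun φ hφ =>
      IsLocallyConstant.comp (f := φ) hφ (QuotientGroup.mk' Z)
    refine Set.Finite.of_finite_fibers (f := fun φ : G →* P => (QuotientGroup.mk' Z).comp φ)
      ((ih hcard).subset hmaps.image_subset) ?_
    intro φ' hφ'
    rw [Set.mem_image] at hφ'
    obtain ⟨φ, hφ, rfl⟩ := hφ'
    refine Set.Finite.subset (Set.finite_range fun χ : Z1 (trivInt ℓ G) =>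
      if h : ∃ ψ : G →* P, ∀ g, ψ g = φ g * E (χ.1 g) then h.choose else 1) ?_
    rintro ψ ⟨hψ, hψφ⟩
    obtain ⟨χ, hχ, hχφ⟩ := exists_mem_Z1_of_mk_eq hE hEi hEc hEZ hφ hψ fun g =>
      (DFunLike.congr_fun hψφ g).symm
    refine ⟨⟨χ, hχ⟩, ?_⟩
    have h : ∃ ψ : G →* P, ∀ g, ψ g = φ g * E (χ g) := ⟨ψ, hχφ⟩
    simp only [dif_pos h]
    ext g
    rw [h.choose_spec, hχφ]

variable [IsTopologicalGroup G]

/-- If `H²(G, 𝔽_ℓ) = 0`, then homomorphisms lift along central extensions by `𝔽_ℓ`. -/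
lemma exists_hom_lift (h2 : ∀ z ∈ Z2 (trivInt ℓ G), ∃ b : G → ZMod ℓ,
      IsLocallyConstant b ∧ diffOne (trivInt ℓ G) b = z) {P : Type w} [Group P]
    {E : ZMod ℓ → P} {Z : Subgroup P} [Z.Normal]
    (hE : ∀ a b, E (a + b) = E a * E b) (hEi : Function.Injective E)
    (hEc : ∀ a p, E a * p = p * E a) (hEZ : ∀ p, p ∈ Z ↔ ∃ a, E a = p) {φ : G →* P ⧸ Z}
    (hφ : IsLocallyConstant φ) :
    ∃ ψ : G →* P, IsLocallyConstant ψ ∧ ∀ g, (ψ g : P ⧸ Z) = φ g := by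
  let t : G → P := fun g => (φ g).out
  have ht : ∀ g, (t g : P ⧸ Z) = φ g := fun g => (φ g).out_eq'
  have htlc : IsLocallyConstant t := hφ.comp Quotient.out
  have hex : ∀ p : G × G, ∃ a, E a = t p.1 * t p.2 * (t (p.1 * p.2))⁻¹ := fun p => by
    rw [← hEZ, ← QuotientGroup.eq_one_iff]
    simp [ht]
  choose z hz using hex
  have hzt : ∀ g h, t g * t h = E (z (g, h)) * t (g * h) := fun g h => by
    rw [hz, inv_mul_cancel_right]
  have hzZ : z ∈ Z2 (trivInt ℓ G) := by
    refine mem_Z2_trivInt.2 ⟨?_, fun g h j => ?_⟩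
    · have h1 : IsLocallyConstant fun p : G × G => t p.1 * t p.2 * (t (p.1 * p.2))⁻¹ :=
        ((htlc.comp_continuous continuous_fst).mul (htlc.comp_continuous continuous_snd)).mul
          (htlc.comp_continuous continuous_mul).inv
      rw [IsLocallyConstant.iff_eventually_eq] at h1 ⊢
      intro p
      filter_upwards [h1 p] with q hq
      exact hEi (by rw [hz, hz, hq])
    · have e1 : t g * t h * t j = E (z (g, h) + z (g * h, j)) * t (g * h * j) := by
        rw [hzt, mul_assoc, hzt, ← mul_assoc, ← hE]
      have e2 : t g * (t h * t j) = E (z (h, j) + z (g, h * j)) * t (g * h * j) := by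
        rw [hzt h j, ← mul_assoc, ← hEc _ (t g), mul_assoc, hzt, ← mul_assoc, ← hE, mul_assoc g]
      have h2 := hEi (mul_right_cancel (e1.symm.trans ((mul_assoc _ _ _).trans e2)))
      linear_combination -h2
  obtain ⟨b, hb, hbz⟩ := h2 z hzZ
  have hbz' : ∀ g h, z (g, h) = b h - b (g * h) + b g := fun g h => by
    rw [← hbz, diffOne_trivInt]
  refine ⟨MonoidHom.mk' (fun g => E (-b g) * t g) fun g h => ?_, ?_, fun g => ?_⟩
  · rw [mul_assoc, ← mul_assoc (t g), ← hEc, mul_assoc (E _), hzt, ← mul_assoc, ← mul_assoc, ← hE,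
      ← hE, hbz']
    congr 2
    ring
  · exact (hb.comp fun x => E (-x)).mul htlc
  · have h1 : ((E (-b g) : P) : P ⧸ Z) = 1 := (QuotientGroup.eq_one_iff _).2 ((hEZ _).2 ⟨_, rfl⟩)
    change ((E (-b g) * t g : P) : P ⧸ Z) = φ g
    rw [QuotientGroup.mk_mul, h1, one_mul, ht]

/-- If `H²(G, 𝔽_ℓ) = 0` and `X` is a subset converging to `1` such that all finitely supported
functions `X → 𝔽_ℓ` come from homomorphisms `G → 𝔽_ℓ`, then the same holds for all finite
`ℓ`-groups. -/
lemma exists_hom_of_card_eq_pow (h2 : ∀ z ∈ Z2 (trivInt ℓ G), ∃ b : G → ZMod ℓ,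
      IsLocallyConstant b ∧ diffOne (trivInt ℓ G) b = z) {X : Set G}
    (hX1 : Tendsto ((↑) : X → G) cofinite (𝓝 1))
    (hX : ∀ f : X → ZMod ℓ, {x | f x ≠ 0}.Finite → ∃ χ ∈ Z1 (trivInt ℓ G), ∀ x : X, χ x = f x)
    (m : ℕ) {P : Type w} [Group P] [Finite P] (hm : Nat.card P = ℓ ^ m) (f : X → P)
    (hf : {x | f x ≠ 1}.Finite) : ∃ φ : G →* P, IsLocallyConstant φ ∧ ∀ x : X, φ x = f x := by
  induction m generalizing P with
  | zero =>
    have : Subsingleton P := (Nat.card_eq_one_iff_unique.1 (by simpa using hm)).1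
    exact ⟨1, IsLocallyConstant.const 1, fun x => Subsingleton.elim _ _⟩
  | succ m ih =>
    obtain ⟨E, Z, hZ, hcard, hE, hEi, hEc, hEZ⟩ := exists_central_of_card_eq_pow hm
    obtain ⟨φ, hφ, hφf⟩ := ih hcard (fun x => (f x : P ⧸ Z)) (hf.subset fun x hx h => hx (by
      simp only [h, QuotientGroup.mk_one]))
    obtain ⟨ψ, hψ, hψφ⟩ := exists_hom_lift h2 hE hEi hEc hEZ hφ
    have hE0 : E 0 = 1 := by
      have := hE 0 0
      rwa [add_zero, left_eq_mul] at this
    have hex : ∀ x : X, ∃ a, E a = (ψ x)⁻¹ * f x := fun x => by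
      rw [← hEZ, ← QuotientGroup.eq, hψφ, hφf]
    choose a ha using hex
    obtain ⟨χ, hχ, hχa⟩ := hX a (by
      have h3 : ∀ᶠ x : X in cofinite, ψ x = 1 := by
        have h4 := hX1.eventually ((IsLocallyConstant.iff_eventually_eq _).1 hψ 1)
        simpa using h4
      refine (hf.union h3).subset fun x hx => ?_
      by_contra h4
      simp only [Set.mem_union, not_or, Set.mem_compl_iff, Set.mem_ofPred_eq, not_not] at h4
      refine hx (hEi ?_)
      rw [ha, h4.1, h4.2, hE0]
      simp)
    refine ⟨MonoidHom.mk' (fun g => ψ g * E (χ g)) fun g h => ?_,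
      hψ.mul (hχ.1.comp E), fun x => ?_⟩
    · rw [map_mul, (mem_Z1_trivInt.1 hχ).2, hE]
      rw [mul_assoc, mul_assoc, ← mul_assoc (E _) (ψ h), hEc _ (ψ h), mul_assoc]
    · change ψ x * E (χ x) = f x
      rw [hχa, ha, mul_inv_cancel_left]

end Homs

/-! ### A criterion for freeness -/

lemma eventually_inv_mul_mem {T : Type*} {P : Type*} [TopologicalSpace T] [Group P]
    [TopologicalSpace P] [IsTopologicalGroup P] {f : T → P} (hf : Continuous f) {O : Subgroup P}
    (hO : IsOpen (O : Set P)) (a : T) : ∀ᶠ b in 𝓝 a, (f a)⁻¹ * f b ∈ O := by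
  have hc : Continuous fun b => (f a)⁻¹ * f b := by fun_prop
  refine hc.continuousAt.preimage_mem_nhds (hO.mem_nhds ?_)
  rw [inv_mul_cancel]
  exact O.one_mem

section Free

variable {ℓ : ℕ} [Fact ℓ.Prime] {N : Type u} [Group N] [TopologicalSpace N] [IsTopologicalGroup N]

/-- The homomorphisms to `𝔽_ℓ` that vanish on a subgroup. -/
def homsVanishing (ℓ : ℕ) [Fact ℓ.Prime] (U : Subgroup N) : AddSubgroup (N → ZMod ℓ) where
  carrier := {χ | χ ∈ Z1 (trivInt ℓ N) ∧ ∀ u ∈ U, χ u = 0}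
  zero_mem' := ⟨(Z1 _).zero_mem, fun _ _ => rfl⟩
  add_mem' ha hb := ⟨(Z1 _).add_mem ha.1 hb.1, fun u hu => by
    rw [Pi.add_apply, ha.2 u hu, hb.2 u hu, add_zero]⟩
  neg_mem' ha := ⟨(Z1 _).neg_mem ha.1, fun u hu => by
    rw [Pi.neg_apply, ha.2 u hu, neg_zero]⟩

lemma finite_homsVanishing [CompactSpace N] {U : Subgroup N} (hU : IsOpen (U : Set N)) :
    (homsVanishing ℓ U : Set (N → ZMod ℓ)).Finite := by
  have := U.quotient_finite_of_isOpen hU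
  refine Set.Finite.of_injOn (f := fun χ (q : N ⧸ U) => χ q.out) (t := Set.univ)
    (fun _ _ => Set.mem_univ _) ?_ Set.finite_univ
  intro χ hχ ψ hψ h
  have key : ∀ χ ∈ homsVanishing ℓ U, ∀ x : N, χ x = χ (x : N ⧸ U).out := by
    intro χ hχ x
    obtain ⟨u, hu⟩ := QuotientGroup.mk_out_eq_mul U x
    rw [hu, (mem_Z1_trivInt.1 hχ.1).2, hχ.2 u u.2, add_zero]
  ext x
  rw [key χ hχ, key ψ hψ]
  exact congrFun h _

lemma homsVanishing_mono {U V : Subgroup N} (h : U ≤ V) : homsVanishing ℓ V ≤ homsVanishing ℓ U :=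
  fun _ hχ => ⟨hχ.1, fun u hu => hχ.2 u (h hu)⟩

/-- A finite set of elements of `U` that is dual to the homomorphisms vanishing on `U'` modulo
those vanishing on `U`. It is a minimal set that detects these homomorphisms. -/
lemma exists_dual_finset [CompactSpace N] {U U' : Subgroup N} (hU' : IsOpen (U' : Set N)) :
    ∃ S : Finset N, (∀ x ∈ S, x ∈ U) ∧
      (∀ χ ∈ homsVanishing ℓ U', (∀ x ∈ S, χ x = 0) → χ ∈ homsVanishing ℓ U) ∧
      ∀ x ∈ S, ∃ χ ∈ homsVanishing ℓ U', χ x ≠ 0 ∧ ∀ y ∈ S, y ≠ x → χ y = 0 := by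
  classical
  let Q : Set (Finset N) := {S | (∀ x ∈ S, x ∈ U) ∧
    ∀ χ ∈ homsVanishing ℓ U', (∀ x ∈ S, χ x = 0) → χ ∈ homsVanishing ℓ U}
  have hQ : Q.Nonempty := by
    have hex : ∀ χ : N → ZMod ℓ, ∃ x ∈ U, χ ∈ homsVanishing ℓ U' → χ x = 0 →
        χ ∈ homsVanishing ℓ U := fun χ => by
      by_contra! h
      exact (h 1 U.one_mem).2.2 ⟨(h 1 U.one_mem).1.1, fun u hu => (h u hu).2.1⟩
    choose x hx hxχ using hex
    refine ⟨(finite_homsVanishing hU').toFinset.image x, fun y hy => ?_, fun χ hχ h => ?_⟩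
    · obtain ⟨χ, -, rfl⟩ := Finset.mem_image.1 hy
      exact hx χ
    · exact hxχ χ hχ (h _ (Finset.mem_image_of_mem x
        ((finite_homsVanishing hU').mem_toFinset.2 hχ)))
  obtain ⟨S, hS, hmin⟩ := wellFounded_lt.has_min Q hQ
  refine ⟨S, hS.1, hS.2, fun x hx => ?_⟩
  have h1 : S.erase x ∉ Q := fun h => hmin _ h (Finset.erase_ssubset hx)
  have h2 : ∃ χ ∈ homsVanishing ℓ U', (∀ y ∈ S.erase x, χ y = 0) ∧ χ ∉ homsVanishing ℓ U := by
    by_contra! h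
    exact h1 ⟨fun y hy => hS.1 y (Finset.mem_of_mem_erase hy), h⟩
  obtain ⟨χ, hχ, hχ0, hχU⟩ := h2
  refine ⟨χ, hχ, fun h => hχU (hS.2 χ hχ fun y hy => ?_), fun y hy hyx =>
    hχ0 y (Finset.mem_erase.2 ⟨hyx, hy⟩)⟩
  by_cases hyx : y = x
  · rw [hyx, h]
  · exact hχ0 y (Finset.mem_erase.2 ⟨hyx, hy⟩)

/-- A profinite group with a countable basis of neighbourhoods of `1` has a subset that converges
to `1` and is dual to a basis of the group of homomorphisms to `𝔽_ℓ`. -/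
lemma exists_dual_set [CompactSpace N] {U : ℕ → Subgroup N} (hU0 : U 0 = ⊤) (hU : Antitone U)
    (hopen : ∀ n, IsOpen (U n : Set N)) (hbasis : ∀ W ∈ 𝓝 (1 : N), ∃ n, (U n : Set N) ⊆ W) :
    ∃ X : Set N, Tendsto ((↑) : X → N) cofinite (𝓝 1) ∧
      (∀ χ ∈ Z1 (trivInt ℓ N), (∀ x ∈ X, χ x = 0) → χ = 0) ∧
      ∀ f : X → ZMod ℓ, {x | f x ≠ 0}.Finite → ∃ χ ∈ Z1 (trivInt ℓ N), ∀ x : X, χ x = f x := by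
  classical
  choose S hSU hSdet hSdual using fun n =>
    exists_dual_finset (ℓ := ℓ) (U := U n) (hopen (n + 1))
  have hfin : ∀ n, {x : (⋃ n, (S n : Set N) : Set N) | ∃ k < n, (x : N) ∈ S k}.Finite := fun n => by
    refine Set.Finite.of_finite_image (f := Subtype.val) ?_ Subtype.val_injective.injOn
    refine ((Finset.range n).biUnion S).finite_toSet.subset ?_
    rintro _ ⟨x, ⟨k, hk, hx⟩, rfl⟩
    exact Finset.mem_coe.2 (Finset.mem_biUnion.2 ⟨k, Finset.mem_range.2 hk, hx⟩)
  have hmem : ∀ (n : ℕ) (x : (⋃ n, (S n : Set N) : Set N)), (∃ k < n, (x : N) ∈ S k) ∨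
      (x : N) ∈ U n := fun n x => by
    obtain ⟨k, hk⟩ := Set.mem_iUnion.1 x.2
    rcases lt_or_ge k n with h | h
    · exact Or.inl ⟨k, h, hk⟩
    · exact Or.inr (hU h (hSU k x hk))
  refine ⟨⋃ n, (S n : Set N), fun W hW => ?_, fun χ hχ h => ?_, fun f hf => ?_⟩
  · obtain ⟨n, hn⟩ := hbasis W hW
    refine (hfin n).subset fun x hx => (hmem n x).resolve_right fun h => hx (hn h)
  · have h1 : ∃ n, χ ∈ homsVanishing ℓ (U n) := by
      have hχ1 : χ 1 = 0 := by
        have := (mem_Z1_trivInt.1 hχ).2 1 1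
        rwa [mul_one, left_eq_add] at this
      obtain ⟨n, hn⟩ := hbasis (χ ⁻¹' {0}) ((hχ.1.isOpen_fiber 0).mem_nhds hχ1)
      exact ⟨n, hχ, fun u hu => hn hu⟩
    obtain ⟨n, hn⟩ := h1
    induction n with
    | zero =>
      ext x
      exact hn.2 x (by rw [hU0]; trivial)
    | succ n ih =>
      exact ih (hSdet n χ hn fun x hx => h x (Set.mem_iUnion.2 ⟨n, hx⟩))
  · -- Prescribed values on finitely many of the sets `S k` are attained.
    have key : ∀ (n : ℕ) (F : N → ZMod ℓ), ∃ χ ∈ homsVanishing ℓ (U n),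
        ∀ k < n, ∀ x ∈ S k, χ x = F x := by
      intro n
      induction n with
      | zero => exact fun F => ⟨0, AddSubgroup.zero_mem _, fun k hk => absurd hk k.not_lt_zero⟩
      | succ n ih =>
        intro F
        choose! d hd hdx hdy using hSdual n
        let χ₁ : N → ZMod ℓ := ∑ x ∈ S n, (F x * (d x x)⁻¹).val • d x
        have hχ₁ : χ₁ ∈ homsVanishing ℓ (U (n + 1)) :=
          AddSubgroup.sum_mem _ fun x hx => AddSubgroup.nsmul_mem _ (hd x hx) _
        have hχ₁S : ∀ x ∈ S n, χ₁ x = F x := fun x hx => by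
          simp only [χ₁]
          rw [Finset.sum_apply, Finset.sum_eq_single x]
          · simp [hdx x hx]
          · intro y hy hyx
            rw [Pi.smul_apply, hdy y hy x hx hyx.symm, smul_zero]
          · exact fun h => absurd hx h
        obtain ⟨χ₂, hχ₂, hχ₂S⟩ := ih (F - χ₁)
        refine ⟨χ₁ + χ₂, AddSubgroup.add_mem _ hχ₁
          (homsVanishing_mono (hU n.le_succ) hχ₂), fun k hk x hx => ?_⟩
        rcases Nat.lt_succ_iff_lt_or_eq.1 hk with h | rfl
        · rw [Pi.add_apply, hχ₂S k h x hx, Pi.sub_apply, add_sub_cancel]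
        · rw [Pi.add_apply, hχ₁S x hx, hχ₂.2 x (hSU k x hx), add_zero]
    obtain ⟨n, hn⟩ : ∃ n, ∀ x : (⋃ n, (S n : Set N) : Set N), f x ≠ 0 → ∃ k < n, (x : N) ∈ S k := by
      choose k hk using fun x : (⋃ n, (S n : Set N) : Set N) => Set.mem_iUnion.1 x.2
      obtain ⟨n, hn⟩ := (hf.image k).bddAbove
      exact ⟨n + 1, fun x hx => ⟨k x, Nat.lt_succ_of_le (hn ⟨x, hx, rfl⟩), hk x⟩⟩
    obtain ⟨χ, hχ, hχS⟩ := key n fun x => if h : x ∈ ⋃ n, (S n : Set N) then f ⟨x, h⟩ else 0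
    refine ⟨χ, hχ.1, fun x => ?_⟩
    rcases hmem n x with ⟨k, hk, hx⟩ | h
    · rw [hχS k hk x hx, dif_pos x.2]
    · by_cases hx : ∃ k < n, (x : N) ∈ S k
      · obtain ⟨k, hk, hx⟩ := hx
        rw [hχS k hk x hx, dif_pos x.2]
      · rw [hχ.2 x h]
        by_contra h0
        exact hx (hn x fun h => h0 h.symm)

/-- A pro-`ℓ` group `N` with a countable basis of neighbourhoods of `1` and with `H²(N, 𝔽_ℓ) = 0`
is free. -/
theorem isFreeProP_of_H2_eq_zero (hN : IsProP ℓ N)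
    (h2 : ∀ z ∈ Z2 (trivInt ℓ N), ∃ b : N → ZMod ℓ,
      IsLocallyConstant b ∧ diffOne (trivInt ℓ N) b = z)
    {U : ℕ → Subgroup N} (hU0 : U 0 = ⊤) (hU : Antitone U)
    (hopen : ∀ n, IsOpen (U n : Set N)) (hbasis : ∀ W ∈ 𝓝 (1 : N), ∃ n, (U n : Set N) ⊆ W) :
    IsFreeProP ℓ N := by
  have := hN.compact
  obtain ⟨X, hX1, hXdet, hXex⟩ := exists_dual_set (ℓ := ℓ) hU0 hU hopen hbasis
  refine ⟨hN, X, hX1, fun P _ _ _ hP f hf => ?_⟩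
  have := hP.compact
  have := hP.t2
  have := hP.totallyDisconnected
  have hfinq : ∀ O : OpenNormalSubgroup P, Finite (P ⧸ O.toSubgroup) := fun O =>
    O.toSubgroup.quotient_finite_of_isOpen O.isOpen'
  have : Nonempty (OpenNormalSubgroup P) :=
    ⟨{ toSubgroup := ⊤, isOpen' := isOpen_univ, isNormal' := inferInstance }⟩
  have hcard : ∀ O : OpenNormalSubgroup P, ∃ n, Nat.card (P ⧸ O.toSubgroup) = ℓ ^ n :=
    hP.index_eq_pow
  have hsep : ∀ p : P, (∀ O : OpenNormalSubgroup P, p ∈ O.toSubgroup) → p = 1 := fun p hp => by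
    by_contra h
    obtain ⟨O, hO⟩ := ProfiniteGrp.exist_openNormalSubgroup_sub_open_nhds_of_one
      (isOpen_compl_singleton (x := p)) (Set.mem_compl_singleton_iff.2 (Ne.symm h))
    exact hO (hp O) rfl
  have hφ : ∀ O : OpenNormalSubgroup P, ∃ φ : N →* P ⧸ O.toSubgroup, IsLocallyConstant φ ∧
      ∀ x : X, φ x = (f x : P ⧸ O.toSubgroup) := fun O => by
    obtain ⟨n, hn⟩ := hcard O
    refine exists_hom_of_card_eq_pow h2 hX1 hXex n hn _ ?_
    have h3 : ∀ᶠ x in cofinite, f x ∈ O.toSubgroup :=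
      hf.eventually (O.toOpenSubgroup.mem_nhds_one)
    refine Set.Finite.subset h3 fun x hx h => hx ?_
    exact (QuotientGroup.eq_one_iff _).2 h
  choose φ hφlc hφX using hφ
  have huniq : ∀ (O : OpenNormalSubgroup P) (ψ : N →* P ⧸ O.toSubgroup), IsLocallyConstant ψ →
      (∀ x : X, ψ x = (f x : P ⧸ O.toSubgroup)) → ψ = φ O := fun O ψ hψ hψX => by
    obtain ⟨n, hn⟩ := hcard O
    exact eq_of_eqOn_of_card_eq_pow hXdet n hn hψ (hφlc O) fun x hx =>
      (hψX ⟨x, hx⟩).trans (hφX O ⟨x, hx⟩).symm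
  have hcompat : ∀ (O O' : OpenNormalSubgroup P) (h : O.toSubgroup ≤ O'.toSubgroup) (n : N) (p : P),
      (p : P ⧸ O.toSubgroup) = φ O n → (p : P ⧸ O'.toSubgroup) = φ O' n := fun O O' h n p hp => by
    let r : P ⧸ O.toSubgroup →* P ⧸ O'.toSubgroup :=
      QuotientGroup.map _ _ (MonoidHom.id P) h
    have h3 := huniq O' (r.comp (φ O)) ((hφlc O).comp r) fun x => by
      rw [MonoidHom.comp_apply, hφX]
      rfl
    rw [← h3, MonoidHom.comp_apply, ← hp]
    rfl
  have hex : ∀ n : N, ∃ p : P, ∀ O : OpenNormalSubgroup P,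
      (p : P ⧸ O.toSubgroup) = φ O n := fun n => by
    have hcl : ∀ O : OpenNormalSubgroup P,
        IsClosed {p : P | (p : P ⧸ O.toSubgroup) = φ O n} := fun O => by
      have : IsLocallyConstant fun p : P => (p : P ⧸ O.toSubgroup) := by
        rw [IsLocallyConstant.iff_eventually_eq]
        intro p
        filter_upwards [eventually_inv_mul_mem continuous_id O.isOpen' p] with q hq
        exact (QuotientGroup.eq.2 hq).symm
      exact (this.isClopen_fiber (φ O n)).1
    have h5 := IsCompact.nonempty_iInter_of_directed_nonempty_isCompact_isClosed
      (fun O : OpenNormalSubgroup P => {p : P | (p : P ⧸ O.toSubgroup) = φ O n})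
      (fun O O' => ⟨O ⊓ O', fun p hp => hcompat (O ⊓ O') O inf_le_left n p hp,
        fun p hp => hcompat (O ⊓ O') O' inf_le_right n p hp⟩)
      (fun O => QuotientGroup.mk_surjective (φ O n)) (fun O => (hcl O).isCompact) hcl
    obtain ⟨p, hp⟩ := h5
    exact ⟨p, fun O => Set.mem_iInter.1 hp O⟩
  choose F hF using hex
  have hext : ∀ p q : P, (∀ O : OpenNormalSubgroup P, (p : P ⧸ O.toSubgroup) = q) → p = q :=
    fun p q h => (inv_mul_eq_one.1 (hsep _ fun O => QuotientGroup.eq.1 (h O)))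
  let Φ : N →* P := MonoidHom.mk' F fun a b => hext _ _ fun O => by
    rw [hF, map_mul, QuotientGroup.mk_mul, hF, hF]
  have hΦ : Continuous Φ := by
    refine continuous_of_continuousAt_one Φ ?_
    rw [ContinuousAt, map_one]
    intro W hW
    obtain ⟨V, hVW, hVo, hV1⟩ := mem_nhds_iff.1 hW
    obtain ⟨O, hO⟩ := ProfiniteGrp.exist_openNormalSubgroup_sub_open_nhds_of_one hVo hV1
    have h6 : ∀ᶠ n in 𝓝 (1 : N), φ O n = φ O 1 :=
      (IsLocallyConstant.iff_eventually_eq _).1 (hφlc O) 1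
    refine mem_map.2 (mem_of_superset h6 fun n hn => hVW (hO ?_))
    refine (QuotientGroup.eq_one_iff _).1 ((hF n O).trans ?_)
    rw [← map_one (φ O)]
    exact hn
  refine ⟨⟨Φ, hΦ⟩, fun x => hext _ _ fun O => (hF x O).trans (hφX O x), fun ψ hψ => ?_⟩
  ext n
  refine hext _ _ fun O => ?_
  have h7 := huniq O ((QuotientGroup.mk' O.toSubgroup).comp ψ.toMonoidHom) (by
    rw [IsLocallyConstant.iff_eventually_eq]
    intro a
    filter_upwards [eventually_inv_mul_mem (map_continuous ψ) O.isOpen' a] with b hb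
    exact (QuotientGroup.eq.2 hb).symm) fun x => congrArg _ (hψ x)
  exact (DFunLike.congr_fun h7 n).trans (hF n O).symm

end Free

/-! ### Countability of the set of open normal subgroups -/

section Countable

variable {ℓ : ℕ} [Fact ℓ.Prime] {G : Type u} [Group G] [TopologicalSpace G] [IsTopologicalGroup G]

/-- A pro-`ℓ` group with only finitely many homomorphisms to `𝔽_ℓ` has only countably many open
normal subgroups, as it has finitely many homomorphisms to each finite `ℓ`-group. -/
lemma countable_openNormalSubgroup (hG : IsProP ℓ G) [Finite (Z1 (trivInt ℓ G))] :
    Countable (OpenNormalSubgroup G) := by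
  have := hG.compact
  have hfin : ∀ n : ℕ, {K : Subgroup G | ∃ φ : G →* Equiv.Perm (Fin (ℓ ^ n)),
      IsLocallyConstant φ ∧ Nat.card φ.range = ℓ ^ n ∧ K = φ.ker}.Finite := fun n => by
    have h1 : (⋃ R : {R : Subgroup (Equiv.Perm (Fin (ℓ ^ n))) // Nat.card R = ℓ ^ n},
        (fun ψ : G →* R.1 => ψ.ker) '' {ψ | IsLocallyConstant ψ}).Finite :=
      Set.finite_iUnion fun R => (finite_setOf_isLocallyConstant n R.2).image _
    refine h1.subset ?_
    rintro _ ⟨φ, hφ, hcard, rfl⟩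
    refine Set.mem_iUnion.2 ⟨⟨φ.range, hcard⟩, φ.rangeRestrict, ?_, φ.ker_rangeRestrict⟩
    rw [Set.mem_ofPred_eq, IsLocallyConstant.iff_eventually_eq]
    intro g
    filter_upwards [(IsLocallyConstant.iff_eventually_eq _).1 hφ g] with h hh
    exact Subtype.ext hh
  have hc : (⋃ n : ℕ, {K : Subgroup G | ∃ φ : G →* Equiv.Perm (Fin (ℓ ^ n)),
      IsLocallyConstant φ ∧ Nat.card φ.range = ℓ ^ n ∧ K = φ.ker}).Countable :=
    Set.countable_iUnion fun n => (hfin n).countable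
  have hmem : ∀ O : OpenNormalSubgroup G, O.toSubgroup ∈ ⋃ n : ℕ,
      {K : Subgroup G | ∃ φ : G →* Equiv.Perm (Fin (ℓ ^ n)),
        IsLocallyConstant φ ∧ Nat.card φ.range = ℓ ^ n ∧ K = φ.ker} := fun O => by
    obtain ⟨n, hn⟩ := hG.index_eq_pow O
    have := O.toSubgroup.quotient_finite_of_isOpen O.isOpen'
    let e : G ⧸ O.toSubgroup ≃ Fin (ℓ ^ n) := Finite.equivFinOfCardEq hn
    let φ : G →* Equiv.Perm (Fin (ℓ ^ n)) :=
      (e.permCongrHom.toMonoidHom).comp (MulAction.toPermHom G (G ⧸ O.toSubgroup))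
    have hker : φ.ker = O.toSubgroup := by
      rw [← Subgroup.normalCore_eq_self O.toSubgroup, Subgroup.normalCore_eq_ker]
      ext g
      simp only [φ, MonoidHom.mem_ker, MonoidHom.comp_apply]
      exact (MulEquiv.map_eq_one_iff e.permCongrHom)
    refine Set.mem_iUnion.2 ⟨n, φ, ?_, ?_, hker.symm⟩
    · rw [IsLocallyConstant.iff_eventually_eq]
      intro a
      filter_upwards [eventually_inv_mul_mem continuous_id O.isOpen' a] with b hb
      rw [← hker, MonoidHom.mem_ker, map_mul, map_inv, inv_mul_eq_one] at hb
      exact hb.symm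
    · rw [← Subgroup.index_ker, hker, hn]
  have hc' := hc.to_subtype
  refine Function.Injective.countable (f := fun O : OpenNormalSubgroup G =>
    (⟨O.toSubgroup, hmem O⟩ : {K // K ∈ _})) fun O O' h => ?_
  exact OpenNormalSubgroup.toSubgroup_injective (congrArg Subtype.val h)

/-- A closed subgroup of a pro-`ℓ` group is a pro-`ℓ` group. -/
lemma IsProP.subgroup (hG : IsProP ℓ G) {N : Subgroup G} (hN : IsClosed (N : Set G)) :
    IsProP ℓ N := by
  have := hG.compact
  have := hG.t2
  have := hG.totallyDisconnected
  refine ⟨isCompact_iff_compactSpace.1 hN.isCompact, inferInstance, inferInstance, fun M => ?_⟩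
  obtain ⟨V, hV, hVM⟩ := isOpen_induced_iff.1 M.isOpen'
  have hV1 : (1 : G) ∈ V := by
    have h1 : (1 : N) ∈ ((↑) : N → G) ⁻¹' V := by rw [hVM]; exact M.toSubgroup.one_mem
    exact h1
  obtain ⟨W, hW⟩ := ProfiniteGrp.exist_openNormalSubgroup_sub_open_nhds_of_one hV hV1
  obtain ⟨n, hn⟩ := hG.index_eq_pow W
  have h2 : W.toSubgroup.subgroupOf N ≤ M.toSubgroup := fun x hx => by
    have h3 : x ∈ ((↑) : N → G) ⁻¹' V := hW hx
    rw [hVM] at h3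
    exact h3
  have h4 : M.toSubgroup.index ∣ ℓ ^ n := by
    refine (Subgroup.index_dvd_of_le h2).trans ?_
    rw [← hn]
    exact Subgroup.relIndex_dvd_index_of_normal W.toSubgroup N
  obtain ⟨k, -, hk⟩ := (Nat.dvd_prime_pow (Fact.out : ℓ.Prime)).1 h4
  exact ⟨k, hk⟩

/-- A closed subgroup of a pro-`ℓ` group with finite `H¹` is free if its `H²` vanishes. -/
theorem isFreeProP_subgroup (hG : IsProP ℓ G) [Finite (Z1 (trivInt ℓ G))] {N : Subgroup G}
    (hN : IsClosed (N : Set G)) (h2 : ∀ z ∈ Z2 (trivInt ℓ N), ∃ b : N → ZMod ℓ,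
      IsLocallyConstant b ∧ diffOne (trivInt ℓ N) b = z) : IsFreeProP ℓ N := by
  have := hG.compact
  have := hG.t2
  have := hG.totallyDisconnected
  have := countable_openNormalSubgroup hG
  have : Nonempty (OpenNormalSubgroup G) :=
    ⟨{ toSubgroup := ⊤, isOpen' := isOpen_univ, isNormal' := inferInstance }⟩
  obtain ⟨O, hO⟩ := exists_surjective_nat (OpenNormalSubgroup G)
  let U : ℕ → Subgroup N := fun n => ⨅ k : Fin n, (O k).toSubgroup.subgroupOf N
  have hUn : ∀ n, U n = ⨅ k : Fin n, (O k).toSubgroup.subgroupOf N := fun n => rfl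
  refine isFreeProP_of_H2_eq_zero (hG.subgroup hN) h2 (U := U) ?_ ?_ ?_ ?_
  · rw [hUn, iInf_of_empty]
  · intro m n hmn
    exact le_iInf fun k => iInf_le_of_le (Fin.castLE hmn k) le_rfl
  · intro n
    rw [hUn, Subgroup.coe_iInf]
    exact isOpen_iInter_of_finite fun k => (O k).isOpen'.preimage continuous_subtype_val
  · intro W hW
    rw [nhds_subtype_eq_comap, mem_comap] at hW
    obtain ⟨V, hV, hVW⟩ := hW
    obtain ⟨V', hV'V, hV'o, hV'1⟩ := mem_nhds_iff.1 hV
    obtain ⟨O', hO'⟩ := ProfiniteGrp.exist_openNormalSubgroup_sub_open_nhds_of_one hV'o hV'1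
    obtain ⟨k, rfl⟩ := hO O'
    refine ⟨k + 1, fun x hx => hVW (hV'V (hO' ?_))⟩
    rw [hUn, SetLike.mem_coe, Subgroup.mem_iInf] at hx
    exact hx (Fin.last k)

end Countable

/-! ### Kummerian orientations -/

section Orientation

variable {ℓ : ℕ} [Fact ℓ.Prime] {G : Type u} [Group G] [TopologicalSpace G] [IsTopologicalGroup G]

/-- An orientation of a pro-`ℓ` group is trivial modulo `ℓ`, since `(ℤ / ℓ)ˣ` has order prime to
`ℓ`. -/
lemma IsProP.dvd_sub_one (hG : IsProP ℓ G) (θ : G →ₜ* ℤ_[ℓ]ˣ) (g : G) :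
    (ℓ : ℤ_[ℓ]) ∣ (θ g : ℤ_[ℓ]) - 1 := by
  let f : G →* (ZMod ℓ)ˣ := (Units.map (PadicInt.toZMod (p := ℓ)).toMonoidHom).comp θ.toMonoidHom
  have hf : ∀ g, f g = 1 ↔ (ℓ : ℤ_[ℓ]) ∣ (θ g : ℤ_[ℓ]) - 1 := fun g => by
    rw [← PadicInt.toZMod_eq_zero_iff_dvd, map_sub, map_one, sub_eq_zero, Units.ext_iff]
    exact Iff.rfl
  have hopen : IsOpen (f.ker : Set G) := by
    have h1 : (f.ker : Set G) = (fun g => (θ g : ℤ_[ℓ]) - 1) ⁻¹' {y | (ℓ : ℤ_[ℓ]) ^ 1 ∣ y} := by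
      ext g
      rw [pow_one]
      exact hf g
    have h2 : Continuous fun g => (θ g : ℤ_[ℓ]) := Units.continuous_val.comp θ.continuous_toFun
    rw [h1]
    exact (PadicInt.isOpen_setOf_pow_dvd 1).preimage (by fun_prop)
  obtain ⟨n, hn⟩ := hG.index_eq_pow ⟨⟨f.ker, hopen⟩, inferInstance⟩
  have h3 : f (g ^ ℓ ^ n) = 1 := by
    rw [← MonoidHom.mem_ker, ← hn]
    exact f.ker.pow_index_mem g
  rw [← hf]
  ext
  have h4 := congrArg Units.val h3
  rwa [map_pow, Units.val_pow_eq_pow_val, ZMod.pow_card_pow] at h4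

namespace ModPow

lemma mk_eq_zero_iff {n : ℕ} {x : ℤ_[ℓ]} :
    (Submodule.Quotient.mk x : ModPow ℓ n) = 0 ↔ (ℓ : ℤ_[ℓ]) ^ n ∣ x := by
  rw [Submodule.Quotient.mk_eq_zero, Ideal.mem_span_singleton]

variable (ℓ) in
lemma card_eq (n : ℕ) : Nat.card (ModPow ℓ n) = ℓ ^ n := by
  have e1 : ModPow ℓ n ≃+* ℤ_[ℓ] ⧸ RingHom.ker (PadicInt.toZModPow (p := ℓ) n) :=
    Ideal.quotEquivOfEq (PadicInt.ker_toZModPow n).symm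
  have e2 := RingHom.quotientKerEquivOfSurjective
    (ZMod.ringHom_surjective (PadicInt.toZModPow (p := ℓ) n))
  rw [Nat.card_congr (e1.trans e2).toEquiv, Nat.card_zmod]

instance (n : ℕ) : Finite (ModPow ℓ n) :=
  Nat.finite_of_card_ne_zero (by
    rw [card_eq]; exact pow_ne_zero n (Fact.out : ℓ.Prime).ne_zero)

lemma proj_mk {m n : ℕ} (h : m ≤ n) (x : ℤ_[ℓ]) :
    proj ℓ h (Submodule.Quotient.mk x) = Submodule.Quotient.mk x := rfl

lemma proj_surjective {m n : ℕ} (h : m ≤ n) : Function.Surjective (proj ℓ h) := fun y => by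
  obtain ⟨x, rfl⟩ := Submodule.Quotient.mk_surjective _ y
  exact ⟨Submodule.Quotient.mk x, rfl⟩

variable (ℓ) in
/-- The embedding `ℤ_ℓ / ℓ ^ m → ℤ_ℓ / ℓ ^ (m + 1)` induced by multiplication by `ℓ`. -/
noncomputable def mulPrime (m : ℕ) : ModPow ℓ m →ₗ[ℤ_[ℓ]] ModPow ℓ (m + 1) :=
  Submodule.mapQ _ _ (LinearMap.mulLeft ℤ_[ℓ] (ℓ : ℤ_[ℓ])) fun x hx => by
    rw [Submodule.mem_comap, LinearMap.mulLeft_apply, Ideal.mem_span_singleton, pow_succ']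
    exact mul_dvd_mul_left _ (Ideal.mem_span_singleton.1 hx)

lemma mulPrime_mk (m : ℕ) (x : ℤ_[ℓ]) :
    mulPrime ℓ m (Submodule.Quotient.mk x) = Submodule.Quotient.mk (ℓ * x) := rfl

lemma mulPrime_injective (m : ℕ) : Function.Injective (mulPrime ℓ m) := by
  rw [injective_iff_map_eq_zero]
  intro y hy
  obtain ⟨x, rfl⟩ := Submodule.Quotient.mk_surjective _ y
  rw [mulPrime_mk, mk_eq_zero_iff, pow_succ'] at hy
  exact mk_eq_zero_iff.2 ((mul_dvd_mul_iff_left PadicInt.prime_ne_zero).1 hy)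

lemma exists_mulPrime_eq {m : ℕ} {y : ModPow ℓ (m + 1)}
    (hy : proj ℓ (Nat.le_add_left 1 m) y = 0) : ∃ x, mulPrime ℓ m x = y := by
  obtain ⟨x, rfl⟩ := Submodule.Quotient.mk_surjective _ y
  rw [proj_mk, mk_eq_zero_iff, pow_one] at hy
  obtain ⟨x, rfl⟩ := hy
  exact ⟨Submodule.Quotient.mk x, rfl⟩

lemma proj_mulPrime (m : ℕ) (y : ModPow ℓ m) :
    proj ℓ (Nat.le_add_left 1 m) (mulPrime ℓ m y) = 0 := by
  obtain ⟨x, rfl⟩ := Submodule.Quotient.mk_surjective _ y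
  rw [mulPrime_mk, proj_mk, mk_eq_zero_iff, pow_one]
  exact dvd_mul_right _ _

lemma pow_smul (n : ℕ) (y : ModPow ℓ n) : (ℓ : ℤ_[ℓ]) ^ n • y = 0 := by
  obtain ⟨x, rfl⟩ := Submodule.Quotient.mk_surjective _ y
  rw [← Submodule.Quotient.mk_smul, mk_eq_zero_iff, smul_eq_mul]
  exact dvd_mul_right _ _

lemma isDiscreteRep (θ : G →ₜ* ℤ_[ℓ]ˣ) (n : ℕ) : IsDiscreteRep (twist θ (ModPow ℓ n)) := by
  intro a
  obtain ⟨x, rfl⟩ := Submodule.Quotient.mk_surjective _ a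
  have h1 : {g : G | twist θ (ModPow ℓ n) g (Submodule.Quotient.mk x) = Submodule.Quotient.mk x} =
      (fun g => ((θ g : ℤ_[ℓ]) - 1) * x) ⁻¹' {y | (ℓ : ℤ_[ℓ]) ^ n ∣ y} := by
    ext g
    rw [Set.mem_ofPred_eq, Set.mem_preimage, Set.mem_ofPred_eq, twist_apply,
      ← Submodule.Quotient.mk_smul, ← sub_eq_zero, ← Submodule.Quotient.mk_sub, mk_eq_zero_iff,
      smul_eq_mul, sub_mul, one_mul]
  rw [h1]
  have h2 : Continuous fun g => (θ g : ℤ_[ℓ]) := Units.continuous_val.comp θ.continuous_toFun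
  exact (PadicInt.isOpen_setOf_pow_dvd n).preimage (by fun_prop)

end ModPow

/-- Additive maps on a module that is killed by a power of `ℓ` are `ℤ_ℓ`-linear. -/
lemma AddMonoidHom.map_padic_smul {M N : Type*} [AddCommGroup M] [Module ℤ_[ℓ] M] [AddCommGroup N]
    [Module ℤ_[ℓ] N] {n : ℕ} (hM : ∀ a : M, (ℓ : ℤ_[ℓ]) ^ n • a = 0) (F : M →+ N) (x : ℤ_[ℓ])
    (a : M) : F (x • a) = x • F a := by
  obtain ⟨w, hw⟩ := Ideal.mem_span_singleton.1 (PadicInt.appr_spec n x)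
  have hx : x = (x.appr n : ℕ) + w * ((ℓ ^ n : ℕ) : ℤ_[ℓ]) := by
    push_cast
    linear_combination hw
  have hM' : ∀ a : M, (ℓ ^ n) • a = 0 := fun a => by
    rw [← Nat.cast_smul_eq_nsmul ℤ_[ℓ], Nat.cast_pow, hM]
  rw [hx, add_smul, add_smul, mul_smul, mul_smul, Nat.cast_smul_eq_nsmul, Nat.cast_smul_eq_nsmul,
    Nat.cast_smul_eq_nsmul, Nat.cast_smul_eq_nsmul, ← map_nsmul F (ℓ ^ n), hM', map_zero, smul_zero,
    smul_zero, add_zero, add_zero, map_nsmul]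

/-- If `I` is a dualizing module, then classes in `H²(G, A)` are detected by the homomorphisms
from `A` to `I`. -/
lemma IsDualizingOrientation.exists_detecting {θ : G →ₜ* ℤ_[ℓ]ˣ} (hθ : IsDualizingOrientation θ) :
    ∃ i : H (twist θ (PadicQuot ℓ)) 2 →+ AddCircle (1 : ℚ),
      ∀ (A : Type) [AddCommGroup A] [Finite A] (ρ : Representation ℤ G A),
        (∃ m : ℕ, Nat.card A = ℓ ^ m) → IsDiscreteRep ρ → ∀ z : Z2 ρ,
        (∀ f : Representation.IntertwiningMap ρ (twist θ (PadicQuot ℓ)),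
          i (cls2 _ ⟨f ∘ z.1, comp_mem_Z2 f z.2⟩) = 0) →
        ∃ b : G → A, IsLocallyConstant b ∧ diffOne ρ b = z.1 := by
  obtain ⟨i, hi⟩ := hθ
  refine ⟨i, fun A _ _ ρ hA hρ z hz => ?_⟩
  rw [← cls2_eq_zero_iff]
  by_contra h
  obtain ⟨χ, hχ⟩ := CharacterModule.exists_character_apply_ne_zero_of_ne_zero h
  obtain ⟨f, hf⟩ := (hi A ρ hA hρ).2 χ
  exact hχ ((DFunLike.congr_fun hf (cls2 ρ z)).symm.trans (hz f))

/-- The map `H²(G, ℤ_ℓ(1) / ℓ ^ m) → H²(G, ℤ_ℓ(1) / ℓ ^ (m + 1))` is injective: this is dual to the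
fact that homomorphisms to `ℚ_ℓ / ℤ_ℓ` extend. -/
lemma IsDualizingOrientation.exists_diffOne_eq_of_mulPrime {θ : G →ₜ* ℤ_[ℓ]ˣ}
    (hθ : IsDualizingOrientation θ) {m : ℕ} (z : Z2 (twist θ (ModPow ℓ m)))
    {c : G → ModPow ℓ (m + 1)} (hc : IsLocallyConstant c)
    (hcz : diffOne (twist θ (ModPow ℓ (m + 1))) c = ModPow.mulPrime ℓ m ∘ z.1) :
    ∃ b : G → ModPow ℓ m, IsLocallyConstant b ∧ diffOne (twist θ (ModPow ℓ m)) b = z.1 := by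
  obtain ⟨i, hi⟩ := hθ.exists_detecting
  refine hi _ _ ⟨m, ModPow.card_eq ℓ m⟩ (ModPow.isDiscreteRep θ m) z fun f => ?_
  obtain ⟨F, hF⟩ := PadicQuot.exists_extend (ModPow.mulPrime ℓ m).toAddMonoidHom
    (ModPow.mulPrime_injective m) f.toLinearMap.toAddMonoidHom
  let F' : Representation.IntertwiningMap (twist θ (ModPow ℓ (m + 1))) (twist θ (PadicQuot ℓ)) :=
    ⟨F.toIntLinearMap, fun g => LinearMap.ext fun a =>
      F.map_padic_smul (ModPow.pow_smul (m + 1)) (θ g : ℤ_[ℓ]) a⟩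
  have h0 : cls2 (twist θ (PadicQuot ℓ)) ⟨f ∘ z.1, comp_mem_Z2 f z.2⟩ = 0 := by
    rw [cls2_eq_zero_iff]
    refine ⟨F' ∘ c, hc.comp _, ?_⟩
    rw [diffOne_comp, hcz]
    ext p
    exact DFunLike.congr_fun hF (z.1 p)
  rw [h0, map_zero]

/-- Over a dualizing module, `H¹(G, ℤ_ℓ(1) / ℓ ^ n) → H¹(G, ℤ_ℓ(1) / ℓ)` is surjective: the
obstruction lies in the kernel of an injective map. -/
theorem IsDualizingOrientation.isKummerian (hG : IsProP ℓ G) {θ : G →ₜ* ℤ_[ℓ]ˣ}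
    (hθ : IsDualizingOrientation θ) (htf : IsTorsionFreeOrientation θ) : IsKummerian θ := by
  refine ⟨hG, htf, fun n hn y => ?_⟩
  obtain ⟨m, rfl⟩ := Nat.exists_eq_add_of_le' hn
  obtain ⟨⟨a, ha⟩, rfl⟩ := cls1_surjective _ y
  let p := twistMap θ (ModPow.proj ℓ hn)
  let u := twistMap θ (ModPow.mulPrime ℓ m)
  have hu : Function.Injective u := ModPow.mulPrime_injective m
  let c : G → ModPow ℓ (m + 1) := Function.surjInv (ModPow.proj_surjective hn) ∘ a
  have hc : IsLocallyConstant c := ha.1.comp _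
  have hpc : p ∘ c = a := funext fun g => Function.surjInv_eq (ModPow.proj_surjective hn) (a g)
  have hdc := diffOne_mem_Z2 (ModPow.isDiscreteRep θ (m + 1)) hc
  have hex : ∀ q, ∃ x, u x = diffOne (twist θ (ModPow ℓ (m + 1))) c q := fun q => by
    refine ModPow.exists_mulPrime_eq ?_
    have h1 := congrFun (diffOne_comp p c) q
    rw [hpc, ha.2] at h1
    exact h1.symm
  let z : G × G → ModPow ℓ m :=
    Function.invFun u ∘ diffOne (twist θ (ModPow ℓ (m + 1))) c
  have huz : u ∘ z = diffOne (twist θ (ModPow ℓ (m + 1))) c :=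
    funext fun q => Function.invFun_eq (hex q)
  have hz : z ∈ Z2 (twist θ (ModPow ℓ m)) := by
    refine ⟨hdc.1.comp _, ?_⟩
    have h1 := diffTwo_comp u z
    rw [huz, hdc.2] at h1
    ext q
    refine hu ?_
    rw [Pi.zero_apply, map_zero]
    exact (congrFun h1 q).symm
  obtain ⟨e, he, hez⟩ := hθ.exists_diffOne_eq_of_mulPrime ⟨z, hz⟩ hc huz.symm
  have hc' : c - u ∘ e ∈ Z1 (twist θ (ModPow ℓ (m + 1))) := by
    refine ⟨hc.sub (he.comp _), ?_⟩
    rw [map_sub, diffOne_comp, hez, huz, sub_self]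
  refine ⟨cls1 _ ⟨c - u ∘ e, hc'⟩, ?_⟩
  refine (map_cls1 p ⟨c - u ∘ e, hc'⟩).trans (congrArg _ (Subtype.ext (funext fun g => ?_)))
  have h2 : p (u (e g)) = 0 := ModPow.proj_mulPrime m (e g)
  change p (c g - u (e g)) = a g
  rw [map_sub, h2, sub_zero]
  exact congrFun hpc g

end Orientation

/-! ### The subgroup `K_θ(G)` has infinite index -/

section Index

variable {ℓ : ℕ} [Fact ℓ.Prime]

/-- The group `1 + ℓ ℤ_ℓ` (`1 + 4 ℤ_2` if `ℓ = 2`) has no torsion. -/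
lemma PadicInt.eq_one_of_pow_prime_pow {x : ℤ_[ℓ]} (h1 : (ℓ : ℤ_[ℓ]) ∣ x - 1)
    (h2 : ℓ = 2 → (4 : ℤ_[ℓ]) ∣ x - 1) {n : ℕ} (hx : x ^ ℓ ^ n = 1) : x = 1 := by
  have base : ∀ x : ℤ_[ℓ], (ℓ : ℤ_[ℓ]) ∣ x - 1 → (ℓ = 2 → (4 : ℤ_[ℓ]) ∣ x - 1) → x ^ ℓ = 1 →
      x = 1 := by
    intro x h1 h2 hx
    by_contra hne
    -- The factor `1 + x + ⋯ + x ^ (ℓ - 1)` of `x ^ ℓ - 1` is `ℓ` modulo `ℓ ^ 2`.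
    have hS : ∑ i ∈ Finset.range ℓ, x ^ i = 0 := by
      have h3 := geom_sum_mul x ℓ
      rw [hx, sub_self] at h3
      exact (mul_eq_zero.1 h3).resolve_right (sub_ne_zero.2 hne)
    have h4 : (ℓ : ℤ_[ℓ]) ^ 2 ∣ ℓ := by
      rcases (Fact.out : ℓ.Prime).eq_two_or_odd' with h | h
      · obtain ⟨y, hy⟩ := h2 h
        have h5 : (∑ i ∈ Finset.range ℓ, x ^ i) = 1 + x := by
          have h6 : Finset.range ℓ = Finset.range 2 := congrArg _ h
          rw [h6, Finset.sum_range_succ, Finset.sum_range_one, pow_zero, pow_one]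
        have h6 : (ℓ : ℤ_[ℓ]) = 2 := (congrArg (Nat.cast : ℕ → ℤ_[ℓ]) h).trans Nat.cast_two
        rw [h5] at hS
        rw [h6]
        exact ⟨-y, by linear_combination hS - hy⟩
      · obtain ⟨y, hy⟩ := h1
        have h5 := odd_sq_dvd_geom_sum₂_sub (R := ℤ_[ℓ]) (a := 1) (b := y) h
        have h6 : 1 + (ℓ : ℤ_[ℓ]) * y = x := by rw [← hy]; ring
        rw [h6] at h5
        simp only [one_pow, mul_one] at h5
        rw [hS, zero_sub] at h5
        exact (dvd_neg.1 h5)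
    have h5 : (ℓ : ℤ_[ℓ]) * ℓ ∣ ℓ * 1 := by rwa [mul_one, ← pow_two]
    exact PadicInt.prime_p.not_isUnit
      (isUnit_of_dvd_one ((mul_dvd_mul_iff_left PadicInt.prime_ne_zero).1 h5))
  induction n generalizing x with
  | zero => rwa [pow_zero, pow_one] at hx
  | succ n ih =>
    have h3 : x ^ ℓ = 1 := by
      refine ih ?_ ?_ ?_
      · exact h1.trans (sub_one_dvd_pow_sub_one x ℓ)
      · exact fun h => (h2 h).trans (sub_one_dvd_pow_sub_one x ℓ)
      · rw [← pow_mul, ← pow_succ', hx]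
    exact base x h1 h2 h3

variable {G : Type u} [Group G] [TopologicalSpace G] [IsTopologicalGroup G]

lemma Kθ_le_ker (hG : IsProP ℓ G) (θ : G →ₜ* ℤ_[ℓ]ˣ) : Kθ θ ≤ θ.toMonoidHom.ker := by
  have hker : IsClosed (θ.toMonoidHom.ker : Set G) :=
    isClosed_singleton.preimage θ.continuous_toFun
  refine Subgroup.topologicalClosure_minimal _ ((Subgroup.closure_le _).2 ?_) hker
  rintro _ ⟨g, h, hh, rfl⟩
  have hh' : h ∈ θ.toMonoidHom.ker := hh
  refine mul_mem ?_ (Subgroup.Normal.conj_mem inferInstance h hh' g)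
  exact hker.mem_of_tendsto (tendsto_padicPow hG h _)
    (Eventually.of_forall fun n => pow_mem hh' _)

/-- If `θ` is trivial, then continuous homomorphisms to `ℤ / ℓ ^ n` vanish on `K_θ(G)`. -/
lemma eq_zero_of_mem_Kθ (hG : IsProP ℓ G) {θ : G →ₜ* ℤ_[ℓ]ˣ} (hθ : ∀ g, θ g = 1) {n : ℕ}
    {c : G → ModPow ℓ n} (hc : c ∈ Z1 (twist θ (ModPow ℓ n))) {x : G} (hx : x ∈ Kθ θ) :
    c x = 0 := by
  have hmul : ∀ g h, c (g * h) = c g + c h := fun g h => by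
    rw [Z1.map_mul hc, twist_apply, hθ, Units.val_one, one_smul]
  let φ : G →* Multiplicative (ModPow ℓ n) :=
    MonoidHom.mk' (fun g => Multiplicative.ofAdd (c g)) fun g h =>
      congrArg Multiplicative.ofAdd (hmul g h)
  have hφ : ∀ g, φ g = Multiplicative.ofAdd (c g) := fun g => rfl
  have hker : IsClosed (φ.ker : Set G) := (hc.1.isClopen_fiber 0).1
  refine (Subgroup.topologicalClosure_minimal _ ((Subgroup.closure_le _).2 ?_) hker hx : x ∈ φ.ker)
  rintro _ ⟨g, h, -, rfl⟩
  have h1 : c (padicPow h (-(θ g : ℤ_[ℓ]))) = -c h := by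
    have h2 := (tendsto_padicPow hG h (-(θ g : ℤ_[ℓ]))).eventually
      ((IsLocallyConstant.iff_eventually_eq _).1 hc.1 _)
    obtain ⟨k, hk, hnk⟩ := (h2.and (eventually_ge_atTop n)).exists
    rw [← hk]
    have h3 : ∀ k : ℕ, c (h ^ k) = (k : ℤ_[ℓ]) • c h := fun k => by
      rw [Nat.cast_smul_eq_nsmul]
      exact congrArg Multiplicative.toAdd (map_pow φ h k)
    obtain ⟨w, hw⟩ := Ideal.mem_span_singleton.1 (PadicInt.appr_spec k (-(θ g : ℤ_[ℓ])))
    obtain ⟨j, rfl⟩ := Nat.exists_eq_add_of_le hnk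
    rw [h3, eq_sub_of_add_eq' (sub_eq_iff_eq_add.1 hw).symm, hθ, Units.val_one, sub_smul,
      neg_smul, one_smul, pow_add, mul_assoc, mul_smul, ModPow.pow_smul, sub_zero]
  change φ _ = 1
  rw [map_mul, map_mul, map_mul, mul_right_comm (φ g), ← map_mul φ g, mul_inv_cancel, map_one,
    one_mul, hφ, hφ, h1, ofAdd_neg, inv_mul_cancel]

/-- Demushkin groups have nonzero homomorphisms to `𝔽_ℓ`: otherwise the group would be trivial, so
its `H²` would vanish. -/
lemma IsDemushkin.exists_apply_ne_zero (hG : IsDemushkin ℓ G) :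
    ∃ χ ∈ Z1 (trivInt ℓ G), ∃ g, χ g ≠ 0 := by
  by_contra! hχ
  have := hG.isProP.compact
  have := hG.isProP.t2
  have := hG.isProP.totallyDisconnected
  have h1 : ∀ g : G, g = 1 := fun g => by
    by_contra hg
    obtain ⟨O, hO⟩ := ProfiniteGrp.exist_openNormalSubgroup_sub_open_nhds_of_one
      (isOpen_compl_singleton (x := g)) (Set.mem_compl_singleton_iff.2 (Ne.symm hg))
    obtain ⟨n, hn⟩ := hG.isProP.index_eq_pow O
    have := O.toSubgroup.quotient_finite_of_isOpen O.isOpen'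
    have h2 := eq_of_eqOn_of_card_eq_pow (ℓ := ℓ) (X := (∅ : Set G))
      (fun χ h _ => funext fun g => hχ χ h g) n hn
      (φ := QuotientGroup.mk' O.toSubgroup) (ψ := 1) (by
        rw [IsLocallyConstant.iff_eventually_eq]
        intro a
        filter_upwards [eventually_inv_mul_mem continuous_id O.isOpen' a] with b hb
        exact (QuotientGroup.eq.2 hb).symm) (IsLocallyConstant.const 1) fun x hx => hx.elim
    exact hO ((QuotientGroup.eq_one_iff g).1 (DFunLike.congr_fun h2 g)) rfl
  obtain ⟨τ, hτs, hτ, -, -⟩ := hG.exists_functional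
  obtain ⟨z, hz⟩ := hτs 1
  refine one_ne_zero (hz.symm.trans ((hτ z).2
    ⟨fun _ => z.1 (1, 1), IsLocallyConstant.const _, ?_⟩))
  ext ⟨g, h⟩
  rw [diffOne_trivInt, h1 g, h1 h, sub_add_cancel]

/-- `K_θ(G)` has infinite index: otherwise `θ` has finite image, hence is trivial, and then
`K_θ(G)` is contained in the kernels of homomorphisms onto `ℤ / ℓ ^ n` for all `n`. -/
theorem IsDemushkin.not_isOpen_Kθ (hG : IsDemushkin ℓ G) {θ : G →ₜ* ℤ_[ℓ]ˣ}
    (hθ : IsKummerian θ) : ¬ IsOpen (Kθ θ : Set G) := by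
  intro hopen
  have := hG.isProP.compact
  have := hG.isProP.t2
  have := hG.isProP.totallyDisconnected
  obtain ⟨O, hO⟩ := ProfiniteGrp.exist_openNormalSubgroup_sub_open_nhds_of_one hopen
    (Kθ θ).one_mem
  obtain ⟨n, hn⟩ := hG.isProP.index_eq_pow O
  have hpow : ∀ g, g ^ ℓ ^ n ∈ Kθ θ := fun g => hO (by
    rw [← hn]; exact O.toSubgroup.pow_index_mem g)
  have hθ1 : ∀ g, θ g = 1 := fun g => by
    have h1 : θ (g ^ ℓ ^ n) = 1 := Kθ_le_ker hG.isProP θ (hpow g)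
    rw [map_pow] at h1
    exact Units.ext (PadicInt.eq_one_of_pow_prime_pow (hG.isProP.dvd_sub_one θ g)
      (fun h => hθ.torsionFree h g) (congrArg Units.val h1))
  obtain ⟨χ, hχ, g, hg⟩ := hG.exists_apply_ne_zero
  let a : G → ModPow ℓ 1 := fun g => Submodule.Quotient.mk (liftZMod ℓ (χ g))
  have htriv : ∀ (n : ℕ) (g : G) (y : ModPow ℓ n), twist θ (ModPow ℓ n) g y = y := fun n g y => by
    rw [twist_apply, hθ1, Units.val_one, one_smul]
  have ha : a ∈ Z1 (twist θ (ModPow ℓ 1)) := by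
    refine mem_Z1_iff.2 ⟨hχ.1.comp fun x => Submodule.Quotient.mk (liftZMod ℓ x), fun g h => ?_⟩
    rw [htriv, ← sub_eq_zero]
    change Submodule.Quotient.mk _ - (Submodule.Quotient.mk _ + Submodule.Quotient.mk _) = _
    rw [← Submodule.Quotient.mk_add, ← Submodule.Quotient.mk_sub, ModPow.mk_eq_zero_iff, pow_one,
      ← PadicInt.toZMod_eq_zero_iff_dvd]
    simp [(mem_Z1_trivInt.1 hχ).2]
  have hn1 : 1 ≤ n + 1 := Nat.le_add_left 1 n
  obtain ⟨y, hy⟩ := hθ.surjective (n + 1) hn1 (cls1 _ ⟨a, ha⟩)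
  obtain ⟨⟨c, hc⟩, rfl⟩ := cls1_surjective _ y
  rw [map_cls1, ← sub_eq_zero, ← map_sub, cls1_eq_zero_iff] at hy
  obtain ⟨m, hm⟩ := hy
  have hca : ModPow.proj ℓ hn1 (c g) = a g := by
    have h1 := hm g
    rw [htriv, sub_self] at h1
    exact sub_eq_zero.1 h1
  have h0 : ℓ ^ n • c g = 0 := by
    have h1 : ∀ k : ℕ, c (g ^ k) = k • c g := fun k => by
      induction k with
      | zero =>
        have h2 := Z1.map_mul hc 1 1
        rw [htriv, mul_one, left_eq_add] at h2
        rw [pow_zero, zero_nsmul, h2]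
      | succ k ih => rw [pow_succ, Z1.map_mul hc, htriv, ih, succ_nsmul]
    rw [← h1, eq_zero_of_mem_Kθ hG.isProP hθ1 hc (hpow g)]
  obtain ⟨x, hx⟩ := Submodule.Quotient.mk_surjective _ (c g)
  rw [← hx, ← Nat.cast_smul_eq_nsmul ℤ_[ℓ], ← Submodule.Quotient.mk_smul, ModPow.mk_eq_zero_iff,
    smul_eq_mul, Nat.cast_pow, pow_succ,
    mul_dvd_mul_iff_left (PadicInt.pow_prime_ne_zero n), ← PadicInt.toZMod_eq_zero_iff_dvd] at h0
  rw [← hx, ModPow.proj_mk, ← sub_eq_zero, ← Submodule.Quotient.mk_sub, ModPow.mk_eq_zero_iff,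
    pow_one, ← PadicInt.toZMod_eq_zero_iff_dvd, map_sub, h0, toZMod_liftZMod, zero_sub,
    neg_eq_zero] at hca
  exact hg hca

end Index

/-! ### Second cohomology of closed subgroups of infinite index -/

section Detecting

variable {ℓ : ℕ} [Fact ℓ.Prime] {G : Type u} [Group G] [TopologicalSpace G] [IsTopologicalGroup G]

/-- The detection of cohomology classes by homomorphisms to a dualizing module, for coefficients in
an arbitrary universe. -/
lemma IsDualizingOrientation.exists_diffOne_eq {θ : G →ₜ* ℤ_[ℓ]ˣ} (hθ : IsDualizingOrientation θ)
    {A B : Type w} [AddCommGroup A] [AddCommGroup B] [Finite B] {ρ : Representation ℤ G A}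
    {σ : Representation ℤ G B} {m : ℕ} (hB : Nat.card B = ℓ ^ m) (hσ : IsDiscreteRep σ)
    (p : Representation.IntertwiningMap ρ σ)
    (hp : ∀ f : Representation.IntertwiningMap σ (twist θ (PadicQuot ℓ)), ∀ a, f (p a) = 0)
    {z : G × G → A} (hz : z ∈ Z2 ρ) :
    ∃ b : G → B, IsLocallyConstant b ∧ diffOne σ b = p ∘ z := by
  obtain ⟨i, hi⟩ := hθ.exists_detecting
  let e : Shrink.{0} B ≃+ B := Shrink.addEquiv
  let σ' : Representation ℤ G (Shrink.{0} B) :=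
    { toFun := fun g =>
        ((e.symm.toAddMonoidHom.comp (σ g).toAddMonoidHom).comp e.toAddMonoidHom).toIntLinearMap
      map_one' := by ext x; simp
      map_mul' := fun g h => by ext x; simp }
  have hσ' : ∀ g x, σ' g x = e.symm (σ g (e x)) := fun g x => rfl
  let E : Representation.IntertwiningMap σ σ' :=
    ⟨e.symm.toAddMonoidHom.toIntLinearMap, fun g => by ext x; simp [hσ']⟩
  let E' : Representation.IntertwiningMap σ' σ :=
    ⟨e.toAddMonoidHom.toIntLinearMap, fun g => by ext x; simp [hσ']⟩
  have hE : ∀ x, E' (E x) = x := e.apply_symm_apply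
  have hpz := comp_mem_Z2 E (comp_mem_Z2 p hz)
  obtain ⟨b, hb, hbz⟩ := hi _ σ' ⟨m, by rw [Nat.card_congr e.toEquiv, hB]⟩
    (hσ.of_surjective E e.symm.surjective) ⟨_, hpz⟩ fun f => by
    have h1 : f ∘ E ∘ p ∘ z = 0 := by
      ext q
      exact hp (f.comp E) (z q)
    have h2 : (⟨f ∘ E ∘ p ∘ z, comp_mem_Z2 f hpz⟩ : Z2 (twist θ (PadicQuot ℓ))) = 0 :=
      Subtype.ext h1
    change i (cls2 _ ⟨f ∘ E ∘ p ∘ z, comp_mem_Z2 f hpz⟩) = 0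
    rw [h2, map_zero, map_zero]
  refine ⟨E' ∘ b, hb.comp _, ?_⟩
  rw [diffOne_comp, hbz]
  ext q
  exact hE _

end Detecting

section Permutation

variable {ℓ : ℕ} [Fact ℓ.Prime] {G : Type u} [Group G]

/-- The `G`-module of functions `X → 𝔽_ℓ` for a `G`-set `X`, with the action
`(g f)(x) = f(g⁻¹ x)`. -/
def permRep (ℓ : ℕ) (G : Type u) [Group G] (X : Type w) [MulAction G X] :
    Representation ℤ G (X → ZMod ℓ) where
  toFun g := LinearMap.funLeft ℤ (ZMod ℓ) fun x : X => g⁻¹ • x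
  map_one' := by
    ext f x
    simp [LinearMap.funLeft_apply]
  map_mul' g h := by
    ext f x
    simp [LinearMap.funLeft_apply, mul_smul]

lemma permRep_apply {X : Type w} [MulAction G X] (g : G) (f : X → ZMod ℓ) (x : X) :
    permRep ℓ G X g f x = f (g⁻¹ • x) := rfl

/-- The pullback of functions along a map of `G`-sets. -/
def permPullback {X Y : Type*} [MulAction G X] [MulAction G Y] (p : Y → X)
    (hp : ∀ (g : G) y, p (g • y) = g • p y) :
    Representation.IntertwiningMap (permRep ℓ G X) (permRep ℓ G Y) :=
  ⟨LinearMap.funLeft ℤ (ZMod ℓ) p, fun g => by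
    ext f y
    simp only [LinearMap.comp_apply, LinearMap.funLeft_apply, permRep_apply, hp]⟩

lemma isDiscreteRep_permRep [TopologicalSpace G] [IsTopologicalGroup G] {X : Type*} [MulAction G X]
    {W : Subgroup G} (hW : IsOpen (W : Set G)) (h : ∀ w ∈ W, ∀ x : X, w • x = x) :
    IsDiscreteRep (permRep ℓ G X) := by
  refine fun f => isOpen_iff_mem_nhds.2 fun g hg => ?_
  filter_upwards [eventually_inv_mul_mem continuous_id hW g] with k hk
  have h1 : permRep ℓ G X (g⁻¹ * k) f = f := by
    ext x
    exact congrArg f (h _ (W.inv_mem hk) x)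
  have h2 : k = g * (g⁻¹ * k) := by rw [mul_inv_cancel_left]
  change permRep ℓ G X k f = f
  rw [h2, map_mul, Module.End.mul_apply, h1]
  exact hg

/-- Homomorphisms from `Y → 𝔽_ℓ` to `ℚ_ℓ / ℤ_ℓ` vanish on the functions that are pulled back along a
map of transitive `G`-sets whose fibres have order divisible by `ℓ`: they are multiples of the sum
of all values. -/
lemma apply_permPullback_eq_zero [TopologicalSpace G] {θ : G →ₜ* ℤ_[ℓ]ˣ}
    (h1 : ∀ g, (ℓ : ℤ_[ℓ]) ∣ (θ g : ℤ_[ℓ]) - 1) {V U : Subgroup G} (hVU : V ≤ U) [V.FiniteIndex]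
    (hdvd : ℓ ∣ V.relIndex U)
    (hp : ∀ (g : G) y, Subgroup.quotientMapOfLE hVU (g • y) = g • Subgroup.quotientMapOfLE hVU y)
    (F : Representation.IntertwiningMap (permRep ℓ G (G ⧸ V)) (twist θ (PadicQuot ℓ)))
    (f : G ⧸ U → ZMod ℓ) : F (permPullback (Subgroup.quotientMapOfLE hVU) hp f) = 0 := by
  classical
  have := Fintype.ofFinite (G ⧸ V)
  let δ : ZMod ℓ →+ PadicQuot ℓ := F.toLinearMap.toAddMonoidHom.comp
    (AddMonoidHom.single (fun _ : G ⧸ V => ZMod ℓ) ((1 : G) : G ⧸ V))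
  have hδ : ∀ (y : G ⧸ V) (c : ZMod ℓ), F (Pi.single y c) = δ c := fun y c => by
    obtain ⟨g, rfl⟩ := QuotientGroup.mk_surjective y
    have h2 : permRep ℓ G (G ⧸ V) g (Pi.single ((1 : G) : G ⧸ V) c) =
        Pi.single (g : G ⧸ V) c := by
      ext y
      have h3 : (g⁻¹ • y = ((1 : G) : G ⧸ V)) ↔ y = (g : G ⧸ V) := by
        rw [inv_smul_eq_iff, MulAction.Quotient.smul_mk, smul_eq_mul, mul_one]
      rw [permRep_apply, Pi.single_apply, Pi.single_apply]
      exact if_congr h3 rfl rfl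
    have h4 : ℓ • δ c = 0 := by
      rw [← map_nsmul]
      simp
    rw [← h2, F.isIntertwining, twist_apply]
    exact PadicQuot.smul_eq_self (h1 g) h4
  have hsum : ∀ f' : G ⧸ V → ZMod ℓ, F f' = δ (∑ y, f' y) := fun f' => by
    conv_lhs => rw [← Finset.univ_sum_single f']
    rw [map_sum, map_sum]
    exact Finset.sum_congr rfl fun y _ => hδ y (f' y)
  have : U.FiniteIndex := Subgroup.finiteIndex_of_le hVU
  have := Fintype.ofFinite (G ⧸ U)
  let e := Subgroup.quotientEquivProdOfLE hVU
  have : Finite (U ⧸ V.subgroupOf U) := Finite.of_injective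
    (fun r => e.symm (((1 : G) : G ⧸ U), r)) fun r s h => (Prod.ext_iff.1 (e.symm.injective h)).2
  have := Fintype.ofFinite (U ⧸ V.subgroupOf U)
  have he : ∀ y, (e y).1 = Subgroup.quotientMapOfLE hVU y := fun y => by
    obtain ⟨g, rfl⟩ := QuotientGroup.mk_surjective y
    rfl
  have hc : ((Fintype.card (U ⧸ V.subgroupOf U) : ℕ) : ZMod ℓ) = 0 := by
    rw [ZMod.natCast_eq_zero_iff, Fintype.card_eq_nat_card]
    exact hdvd
  rw [hsum]
  have h5 : ∑ y, permPullback (Subgroup.quotientMapOfLE hVU) hp f y =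
      ∑ q : (G ⧸ U) × (U ⧸ V.subgroupOf U), f q.1 :=
    Fintype.sum_equiv e _ _ fun y => by rw [he]; rfl
  rw [h5, Fintype.sum_prod_type_right]
  dsimp only
  rw [Finset.sum_const, Finset.card_univ, nsmul_eq_mul, hc,
    zero_mul, map_zero]

end Permutation

section InfiniteIndex

variable {ℓ : ℕ} [Fact ℓ.Prime] {G : Type u} [Group G] [TopologicalSpace G] [IsTopologicalGroup G]

/-- A locally constant function of two variables in a closed subgroup `N` of a profinite group is
invariant under translation by `N ∩ W` for some open normal subgroup `W` of the group. -/
lemma exists_openNormalSubgroup_invariant [CompactSpace G] [T2Space G] [TotallyDisconnectedSpace G]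
    {N : Subgroup G} (hN : IsClosed (N : Set G)) {T : Type*} {z : N × N → T}
    (hz : IsLocallyConstant z) : ∃ W : OpenNormalSubgroup G, ∀ n m n' m' : N,
      (n : G)⁻¹ * n' ∈ W.toSubgroup → (m : G)⁻¹ * m' ∈ W.toSubgroup → z (n', m') = z (n, m) := by
  classical
  have : CompactSpace N := isCompact_iff_compactSpace.1 hN.isCompact
  have h1 : ∀ p : N × N, ∃ W : OpenNormalSubgroup G, ∀ n' m' : N,
      (p.1 : G)⁻¹ * n' ∈ W.toSubgroup → (p.2 : G)⁻¹ * m' ∈ W.toSubgroup → z (n', m') = z p := by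
    intro p
    have h2 := (IsLocallyConstant.iff_eventually_eq _).1 hz p
    have hind : IsInducing fun q : N × N => ((q.1 : G), (q.2 : G)) :=
      IsInducing.subtypeVal.prodMap IsInducing.subtypeVal
    rw [hind.nhds_eq_comap] at h2
    obtain ⟨S, hS, hSz⟩ := mem_comap.1 h2
    have hc : Continuous fun q : G × G => ((p.1 : G) * q.1, (p.2 : G) * q.2) := by fun_prop
    have h3 : (fun q : G × G => ((p.1 : G) * q.1, (p.2 : G) * q.2)) ⁻¹' S ∈ 𝓝 ((1, 1) : G × G) :=
      hc.continuousAt.preimage_mem_nhds (by simpa using hS)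
    rw [nhds_prod_eq, mem_prod_self_iff] at h3
    obtain ⟨V, hV, hVS⟩ := h3
    obtain ⟨V', hV'V, hV'o, hV'1⟩ := mem_nhds_iff.1 hV
    obtain ⟨W, hW⟩ := ProfiniteGrp.exist_openNormalSubgroup_sub_open_nhds_of_one hV'o hV'1
    refine ⟨W, fun n' m' hn hm => hSz ?_⟩
    have h4 := hVS (Set.mk_mem_prod (hV'V (hW hn)) (hV'V (hW hm)))
    simpa using h4
  choose W hW using h1
  obtain ⟨t, ht⟩ := CompactSpace.elim_nhds_subcover
    (fun p : N × N => {q : N × N | (p.1 : G)⁻¹ * q.1 ∈ (W p).toSubgroup ∧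
      (p.2 : G)⁻¹ * q.2 ∈ (W p).toSubgroup}) fun p =>
    ((eventually_inv_mul_mem (f := fun q : N × N => (q.1 : G)) (by fun_prop) (W p).isOpen' p).and
      (eventually_inv_mul_mem (f := fun q : N × N => (q.2 : G)) (by fun_prop) (W p).isOpen' p))
  have : Nonempty (OpenNormalSubgroup G) := ⟨W 1⟩
  obtain ⟨W', hW'⟩ := Finset.exists_le (α := (OpenNormalSubgroup G)ᵒᵈ)
    (t.image fun p => OrderDual.toDual (W p))
  refine ⟨OrderDual.ofDual W', fun n m n' m' hn hm => ?_⟩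
  obtain ⟨p, hp, hpn, hpm⟩ := Set.mem_iUnion₂.1 (ht.ge (Set.mem_univ (n, m)))
  have hle : (OrderDual.ofDual W').toSubgroup ≤ (W p).toSubgroup :=
    hW' _ (Finset.mem_image_of_mem _ hp)
  rw [hW p n m hpn hpm]
  refine hW p n' m' ?_ ?_
  · have := mul_mem hpn (hle hn)
    rwa [mul_assoc, mul_inv_cancel_left] at this
  · have := mul_mem hpm (hle hm)
    rwa [mul_assoc, mul_inv_cancel_left] at this

/-- If a pro-`ℓ` group has a dualizing module of the form `ℚ_ℓ / ℤ_ℓ` in dimension `2`, then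
`H²(N, 𝔽_ℓ) = 0` for its closed subgroups `N` of infinite index. A class of `N` extends to an open
subgroup `U`, and there its restriction to a smaller open subgroup `V` that contains `N` vanishes.
Instead of the cohomology of `U` and `V`, the proof uses the cohomology of `G` with coefficients in
`G ⧸ U → 𝔽_ℓ` and `G ⧸ V → 𝔽_ℓ`. -/
theorem IsDualizingOrientation.exists_diffOne_eq_subgroup (hG : IsProP ℓ G) {θ : G →ₜ* ℤ_[ℓ]ˣ}
    (hθ : IsDualizingOrientation θ) {N : Subgroup G} (hN : IsClosed (N : Set G))
    (hNo : ¬ IsOpen (N : Set G)) {z : N × N → ZMod ℓ} (hz : z ∈ Z2 (trivInt ℓ N)) :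
    ∃ b : N → ZMod ℓ, IsLocallyConstant b ∧ diffOne (trivInt ℓ N) b = z := by
  classical
  have := hG.compact
  have := hG.t2
  have := hG.totallyDisconnected
  obtain ⟨W, hW⟩ := exists_openNormalSubgroup_invariant hN hz.1
  let U : Subgroup G := N ⊔ W.toSubgroup
  have hNU : N ≤ U := le_sup_left
  have hWU : W.toSubgroup ≤ U := le_sup_right
  have hUo : IsOpen (U : Set G) := Subgroup.isOpen_mono hWU W.isOpen'
  -- A smaller open subgroup `V` that contains `N`.
  obtain ⟨g₀, hg₀U, hg₀N⟩ : ∃ g ∈ U, g ∉ N := by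
    by_contra! h
    exact hNo (by rwa [le_antisymm hNU h])
  obtain ⟨W', hW'⟩ : ∃ W' : OpenNormalSubgroup G, ∀ w ∈ W'.toSubgroup, g₀ * w ∉ N := by
    have h1 : (fun w => g₀ * w) ⁻¹' (N : Set G)ᶜ ∈ 𝓝 (1 : G) :=
      (continuous_const_mul g₀).continuousAt.preimage_mem_nhds
        (hN.isOpen_compl.mem_nhds (by rwa [mul_one]))
    obtain ⟨S, hS, hSo, hS1⟩ := mem_nhds_iff.1 h1
    obtain ⟨W', hW'⟩ := ProfiniteGrp.exist_openNormalSubgroup_sub_open_nhds_of_one hSo hS1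
    exact ⟨W', fun w hw => hS (hW' hw)⟩
  let M : OpenNormalSubgroup G := W ⊓ W'
  have hMW : M.toSubgroup ≤ W.toSubgroup := inf_le_left
  have hMW' : M.toSubgroup ≤ W'.toSubgroup := inf_le_right
  let V : Subgroup G := N ⊔ M.toSubgroup
  have hNV : N ≤ V := le_sup_left
  have hMV : M.toSubgroup ≤ V := le_sup_right
  have hVU : V ≤ U := sup_le_sup_left hMW N
  have hg₀V : g₀ ∉ V := fun h => by
    obtain ⟨n, hn, w, hw, h⟩ := Subgroup.mem_sup_of_normal_right.1 h
    refine hW' w⁻¹ (inv_mem (hMW' hw)) ?_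
    rwa [← h, mul_inv_cancel_right]
  obtain ⟨k, hk⟩ := hG.index_eq_pow M
  have hℓ : ℓ.Prime := Fact.out
  have := V.quotient_finite_of_isOpen (Subgroup.isOpen_mono hMV M.isOpen')
  have : V.FiniteIndex := Subgroup.finiteIndex_of_finite_quotient
  obtain ⟨kV, -, hkV⟩ := (Nat.dvd_prime_pow hℓ).1
    (hk ▸ Subgroup.index_dvd_of_le hMV : V.index ∣ ℓ ^ k)
  have hdvd : ℓ ∣ V.relIndex U := by
    have h1 : V.relIndex U ∣ ℓ ^ kV := by
      rw [← hkV, ← Subgroup.relIndex_mul_index hVU]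
      exact dvd_mul_right _ _
    obtain ⟨j, -, hj⟩ := (Nat.dvd_prime_pow hℓ).1 h1
    rcases j with _ | j
    · rw [pow_zero, Subgroup.relIndex_eq_one] at hj
      exact absurd (hj hg₀U) hg₀V
    · rw [hj]
      exact dvd_pow_self ℓ j.succ_ne_zero
  -- The extension of `z` to `U` is `(u, v) ↦ z (ν u, ν v)`.
  have hν : ∀ g ∈ U, ∃ n : N, (((n : G) : G ⧸ W.toSubgroup)) = g := fun g hg => by
    obtain ⟨n, hn, w, hw, h⟩ := Subgroup.mem_sup_of_normal_right.1 hg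
    refine ⟨⟨n, hn⟩, QuotientGroup.eq.2 ?_⟩
    rwa [← h, inv_mul_cancel_left]
  choose! ν hν using hν
  have hzW : ∀ {n m n' m' : N}, ((n : G) : G ⧸ W.toSubgroup) = n' →
      ((m : G) : G ⧸ W.toSubgroup) = m' → z (n', m') = z (n, m) := fun hn hm =>
    hW _ _ _ _ (QuotientGroup.eq.1 hn) (QuotientGroup.eq.1 hm)
  obtain ⟨s, hs1, hs⟩ : ∃ s : G ⧸ U → G, s ((1 : G) : G ⧸ U) = 1 ∧
      ∀ x, ((s x : G) : G ⧸ U) = x := by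
    refine ⟨Function.update Quotient.out ((1 : G) : G ⧸ U) 1, Function.update_self _ _ _,
      fun x => ?_⟩
    rcases eq_or_ne x ((1 : G) : G ⧸ U) with rfl | hx
    · rw [Function.update_self]
    · rw [Function.update_of_ne hx]
      exact Quotient.out_eq' x
  let υ : G → G ⧸ U → G := fun g x => (s x)⁻¹ * (g * s (g⁻¹ • x))
  have hυU : ∀ g x, υ g x ∈ U := fun g x => by
    refine QuotientGroup.eq.1 ?_
    rw [hs, ← smul_eq_mul, ← MulAction.Quotient.smul_mk, hs, smul_inv_smul]
  have hυmul : ∀ g h x, υ (g * h) x = υ g x * υ h (g⁻¹ • x) := fun g h x => by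
    simp only [υ, mul_inv_rev, mul_smul]
    group
  have htriv : ∀ w ∈ W.toSubgroup, ∀ x : G ⧸ U, w • x = x := fun w hw x => by
    obtain ⟨a, rfl⟩ := QuotientGroup.mk_surjective x
    rw [MulAction.Quotient.smul_mk, QuotientGroup.eq, smul_eq_mul]
    refine hWU ?_
    have := W.isNormal'.conj_mem _ (inv_mem hw) a⁻¹
    simpa [mul_assoc] using this
  have hυW : ∀ g g' x, g⁻¹ * g' ∈ W.toSubgroup →
      g'⁻¹ • x = g⁻¹ • x ∧ (υ g' x : G ⧸ W.toSubgroup) = υ g x := fun g g' x hg => by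
    have h1 : g'⁻¹ • x = g⁻¹ • x := by
      have h2 := htriv _ (inv_mem hg) (g⁻¹ • x)
      rwa [mul_inv_rev, inv_inv, mul_smul, smul_inv_smul] at h2
    refine ⟨h1, ?_⟩
    simp only [υ, h1]
    rw [QuotientGroup.mk_mul, QuotientGroup.mk_mul, QuotientGroup.mk_mul, QuotientGroup.mk_mul,
      (QuotientGroup.eq.2 hg : (g : G ⧸ W.toSubgroup) = g')]
  let Z : G × G → (G ⧸ U → ZMod ℓ) := fun q x => z (ν (υ q.1 x), ν (υ q.2 (q.1⁻¹ • x)))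
  have hZ : Z ∈ Z2 (permRep ℓ G (G ⧸ U)) := by
    refine mem_Z2_iff.2 ⟨?_, fun g h j => ?_⟩
    · rw [IsLocallyConstant.iff_eventually_eq]
      intro p
      filter_upwards [eventually_inv_mul_mem (f := fun q : G × G => q.1) (by fun_prop) W.isOpen' p,
        eventually_inv_mul_mem (f := fun q : G × G => q.2) (by fun_prop) W.isOpen' p] with q h1 h2
      ext x
      obtain ⟨h3, h4⟩ := hυW _ _ x h1
      refine hzW ?_ ?_
      · rw [hν _ (hυU _ _), hν _ (hυU _ _), h4]
      · rw [hν _ (hυU _ _), hν _ (hυU _ _), h3, (hυW _ _ _ h2).2]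
    · ext x
      have h1 := (mem_Z2_trivInt.1 hz).2 (ν (υ g x)) (ν (υ h (g⁻¹ • x)))
        (ν (υ j (h⁻¹ • g⁻¹ • x)))
      have h2 : Z (g * h, j) x =
          z (ν (υ g x) * ν (υ h (g⁻¹ • x)), ν (υ j (h⁻¹ • g⁻¹ • x))) := by
        refine hzW ?_ ?_
        · rw [hν _ (hυU _ _), hυmul, Subgroup.coe_mul, QuotientGroup.mk_mul, QuotientGroup.mk_mul,
            hν _ (hυU _ _), hν _ (hυU _ _)]
        · rw [mul_inv_rev, mul_smul]
      have h3 : Z (g, h * j) x =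
          z (ν (υ g x), ν (υ h (g⁻¹ • x)) * ν (υ j (h⁻¹ • g⁻¹ • x))) := by
        refine hzW rfl ?_
        rw [hν _ (hυU _ _), hυmul, Subgroup.coe_mul, QuotientGroup.mk_mul, QuotientGroup.mk_mul,
          hν _ (hυU _ _), hν _ (hυU _ _)]
      change Z (h, j) (g⁻¹ • x) - Z (g * h, j) x + Z (g, h * j) x - Z (g, h) x = 0
      rw [h2, h3]
      exact h1
  have hp : ∀ (g : G) (y : G ⧸ V),
      Subgroup.quotientMapOfLE hVU (g • y) = g • Subgroup.quotientMapOfLE hVU y := fun g y => by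
    obtain ⟨a, rfl⟩ := QuotientGroup.mk_surjective y
    rfl
  have hdisc : IsDiscreteRep (permRep ℓ G (G ⧸ V)) :=
    isDiscreteRep_permRep M.isOpen' fun w hw x => by
      obtain ⟨a, rfl⟩ := QuotientGroup.mk_surjective x
      rw [MulAction.Quotient.smul_mk, QuotientGroup.eq, smul_eq_mul]
      refine hMV ?_
      have := M.isNormal'.conj_mem _ (inv_mem hw) a⁻¹
      simpa [mul_assoc] using this
  have hcard : Nat.card (G ⧸ V → ZMod ℓ) = ℓ ^ V.index := by
    rw [Nat.card_fun, Nat.card_zmod]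
    rfl
  obtain ⟨B, hB, hBZ⟩ := hθ.exists_diffOne_eq hcard hdisc
    (permPullback (Subgroup.quotientMapOfLE hVU) hp)
    (apply_permPullback_eq_zero (hG.dvd_sub_one θ) hVU hdvd hp) hZ
  -- The restriction of `B` to `N`, evaluated at the base point.
  refine ⟨fun n => B n ((1 : G) : G ⧸ V),
    (hB.comp fun f => f ((1 : G) : G ⧸ V)).comp_continuous continuous_subtype_val, ?_⟩
  ext ⟨n, m⟩
  have hfixV : ((n : G)⁻¹ • ((1 : G) : G ⧸ V)) = ((1 : G) : G ⧸ V) := by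
    rw [MulAction.Quotient.smul_mk, QuotientGroup.eq, smul_eq_mul, mul_one, mul_one, inv_inv]
    exact hNV n.2
  have hfixU : ∀ n : N, ((n : G)⁻¹ • ((1 : G) : G ⧸ U)) = ((1 : G) : G ⧸ U) := fun n => by
    rw [MulAction.Quotient.smul_mk, QuotientGroup.eq, smul_eq_mul, mul_one, mul_one, inv_inv]
    exact hNU n.2
  have hυ1 : ∀ n : N, υ n ((1 : G) : G ⧸ U) = n := fun n => by
    simp only [υ, hfixU, hs1, mul_one, inv_one, one_mul]
  have h1 := congrFun (congrFun hBZ ((n : G), (m : G))) ((1 : G) : G ⧸ V)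
  rw [diffOne_apply, Pi.add_apply, Pi.sub_apply, permRep_apply, hfixV] at h1
  rw [diffOne_trivInt]
  refine h1.trans ?_
  change z (ν (υ n ((1 : G) : G ⧸ U)), ν (υ m ((n : G)⁻¹ • ((1 : G) : G ⧸ U)))) = z (n, m)
  rw [hfixU, hυ1, hυ1]
  exact hzW (hν _ (hNU n.2)).symm (hν _ (hNU m.2)).symm

end InfiniteIndex

theorem theorem5p1 (ℓ : ℕ) [Fact ℓ.Prime] (G : Type u) [Group G] [TopologicalSpace G]
    [IsTopologicalGroup G] (hG : IsDemushkin ℓ G)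
    (him : ℓ = 2 → ∀ g : G, (4 : ℤ_[ℓ]) ∣ (canonicalOrientation ℓ G g : ℤ_[ℓ]) - 1) :
    HasBogomolovProperty (canonicalOrientation ℓ G) := by
  have hθ : IsDualizingOrientation (canonicalOrientation ℓ G) := by
    rw [canonicalOrientation, dif_pos hG.exists_isDualizingOrientation]
    exact hG.exists_isDualizingOrientation.choose_spec
  have hK := hθ.isKummerian hG.isProP him
  have := hG.finite_Z1
  have hcl : IsClosed (Kθ (canonicalOrientation ℓ G) : Set G) :=
    Subgroup.isClosed_topologicalClosure _
  exact ⟨hK, isFreeProP_subgroup hG.isProP hcl fun z hz =>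
    hθ.exists_diffOne_eq_subgroup hG.isProP hcl (hG.not_isOpen_Kθ hK) hz⟩
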